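/- Let $\Omega\subset\mathbb R^d$ be a bounded open set with a polytopal mesh: a finite set $\mathcal M$ of nonempty, pairwise disjoint open cells $K\subset\Omega$ with $\overline\Omega=\bigcup_{K\in\mathcal M}\overline K$, and a finite set of pairwise disjoint faces, each of which is a nonempty relatively open subset of a hyperplane whose relative boundary is null for the $(d-1)$-dimensional measure, such that the boundary of each cell $K$ is the union of the closures of the faces contained in $\partial K$, and such that each face is either contained in $\Omega$ and in the boundaries of exactly two cells, or contained in $\partial\Omega$ and in the boundary of exactly one cell. (Cells need not be convex and hanging nodes are allowed.) Let $0<\phi_*\le\phi^*$, $\Gamma_{\rm div}\ge 0$ and $T\ge 0$. Let $\phi$ be piecewise smooth (on each cell, the restriction of a $C^\infty$ function on $\mathbb R^d$) with $\phi_*\le\phi\le\phi^*$ on the cells. Let $V\in H_{\rm div}(\Omega)$ be a vector field whose components are polynomials on each cell, with $|{\rm div}\,V|\le\Gamma_{\rm div}$ a.e. on $\Omega$ and $V\cdot n=0$ on the faces contained in $\partial\Omega$. Values of $\phi$ and $V$ at the boundary of a cell $K$, denoted by $\phi_K$, $V_K$, are limits from inside $K$. For $s\in\mathbb R$ and $y\in\overline\Omega$,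 let $F_s(y)$ be the position at time $s$ of the characteristic starting from $y$, that is, of a Lipschitz curve $\gamma$ from the closed interval between $0$ and $s$ to $\overline\Omega$ with $\gamma(0)=y$ and $\gamma'(r)=\frac{V(\gamma(r))}{\phi(\gamma(r))}$ for all but countably many $r$. When $\gamma(r)$ lies on cell boundaries, the right-hand side may be $V_K(\gamma(r))/\phi_K(\gamma(r))$ for any cell $K$ with $\gamma(r)\in\overline K$; when the characteristic is not unique, $F_s(y)$ stands for the set of all such positions. Let $\sigma$ be a face of the mesh with unit normal $n_\sigma$ and, for $t\in[-T,T]$, let $V_t$ be the $d$-dimensional Lebesgue (outer) measure of the region $F_{[0,t]}(\sigma)$ covered by all the points $F_s(y)$ with $y\in\sigma$ and $s$ between $0$ and $t$. Then, for every cell $K$ with $\sigma\subset\partial K$, $$\forall t\in[-T,T],\qquad V_t\le\frac{C_1(T)}{\phi_*}\,|t|\int_\sigma|V_K(y)\cdot n_\sigma|\,{\rm d}s(y),\qquad C_1(T)=\frac{\phi^*}{\phi_*}\exp\Big(\frac{\Gamma_{\rm div}}{\phi_*}T\Big),$$ where ${\rm d}s$ is the $(d-1)$-dimensional surface measure. 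-/

import Mathlib

open MeasureTheory Set Filter Topology
open scoped ContDiff RealInnerProductSpace Gradient

noncomputable section

namespace EllamFlow

variable {d : ℕ}

/-- The affine hyperplane with normal vector `n` and offset `c`. -/
def hyperplane (n : EuclideanSpace ℝ (Fin d)) (c : ℝ) : Set (EuclideanSpace ℝ (Fin d)) :=
  {x | ⟪n, x⟫ = c}

/-- A polytopal mesh of a bounded open set `Ω ⊆ ℝᵈ`: a finite partition of `Ω` (up to cell
boundaries) into open cells, whose boundaries are made of finitely many flat faces. Cells need not
be convex and hanging nodes are allowed. -/
structure PolytopalMesh (Ω : Set (EuclideanSpace ℝ (Fin d))) where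
  /-- the cells -/
  cells : Set (Set (EuclideanSpace ℝ (Fin d)))
  /-- the faces (edges if `d = 2`) -/
  faces : Set (Set (EuclideanSpace ℝ (Fin d)))
  isOpen_domain : IsOpen Ω
  isBounded_domain : Bornology.IsBounded Ω
  finite_cells : cells.Finite
  finite_faces : faces.Finite
  isOpen_cell : ∀ K ∈ cells, IsOpen K
  nonempty_cell : ∀ K ∈ cells, K.Nonempty
  cell_subset : ∀ K ∈ cells, K ⊆ Ω
  disjoint_cells : cells.PairwiseDisjoint id
  closure_domain : closure Ω = ⋃ K ∈ cells, closure K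
  nonempty_face : ∀ σ ∈ faces, σ.Nonempty
  /-- a face is a relatively open subset of a hyperplane -/
  face_flat : ∀ σ ∈ faces, ∃ (n : EuclideanSpace ℝ (Fin d)) (c : ℝ)
    (U : Set (EuclideanSpace ℝ (Fin d))), ‖n‖ = 1 ∧ IsOpen U ∧ σ = U ∩ hyperplane n c
  /-- the relative boundary of a face is negligible for the `(d-1)`-dimensional measure -/
  face_boundary_null : ∀ σ ∈ faces, μHE[d - 1] (closure σ \ σ) = 0
  disjoint_faces : faces.PairwiseDisjoint id
  /-- the boundary of each cell is made of faces -/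
  frontier_cell : ∀ K ∈ cells, frontier K = ⋃ σ ∈ {σ ∈ faces | σ ⊆ frontier K}, closure σ
  /-- a face is either an interface between two cells inside `Ω`, or a face of one cell that
  lies on the boundary of `Ω` -/
  face_cells : ∀ σ ∈ faces,
    (σ ⊆ Ω ∧ {K ∈ cells | σ ⊆ frontier K}.ncard = 2) ∨
    (σ ⊆ frontier Ω ∧ {K ∈ cells | σ ⊆ frontier K}.ncard = 1)

/-- `n` is a unit normal vector to the flat set `σ`. -/
def IsUnitNormal (σ : Set (EuclideanSpace ℝ (Fin d))) (n : EuclideanSpace ℝ (Fin d)) : Prop :=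
  ‖n‖ = 1 ∧ ∃ c : ℝ, σ ⊆ hyperplane n c

/-- `φ` is piecewise smooth: in each cell it is the restriction of a `C^∞` function on `ℝᵈ`
(so it is smooth up to the boundary of the cell, and may jump across faces). -/
def IsPiecewiseSmooth {Ω : Set (EuclideanSpace ℝ (Fin d))} (M : PolytopalMesh Ω)
    (φ : EuclideanSpace ℝ (Fin d) → ℝ) : Prop :=
  ∀ K ∈ M.cells, ∃ f : EuclideanSpace ℝ (Fin d) → ℝ, ContDiff ℝ ∞ f ∧ EqOn φ f K

/-- In each cell, all the components of `V` are polynomials in the coordinates. -/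
def IsPiecewisePolynomial {Ω : Set (EuclideanSpace ℝ (Fin d))} (M : PolytopalMesh Ω)
    (V : EuclideanSpace ℝ (Fin d) → EuclideanSpace ℝ (Fin d)) : Prop :=
  ∀ K ∈ M.cells, ∃ p : Fin d → MvPolynomial (Fin d) ℝ,
    ∀ x ∈ K, ∀ i, V x i = MvPolynomial.eval (fun j => x j) (p i)

/-- `g` is the divergence of `V` on `Ω` in the sense of distributions. -/
def IsWeakDiv (Ω : Set (EuclideanSpace ℝ (Fin d)))
    (V : EuclideanSpace ℝ (Fin d) → EuclideanSpace ℝ (Fin d))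
    (g : EuclideanSpace ℝ (Fin d) → ℝ) : Prop :=
  ∀ ψ : EuclideanSpace ℝ (Fin d) → ℝ, ContDiff ℝ ∞ ψ → HasCompactSupport ψ → tsupport ψ ⊆ Ω →
    ∫ x in Ω, ⟪V x, ∇ ψ x⟫ = - ∫ x in Ω, g x * ψ x

/-- The standing assumptions on the porosity `φ` and the velocity `V`. The value on a face of a
piecewise regular function, seen from an adjacent cell `K`, is `extendFrom K _`, the limit from
inside `K`. -/
structure FlowAssumptions {Ω : Set (EuclideanSpace ℝ (Fin d))} (M : PolytopalMesh Ω)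
    (φ : EuclideanSpace ℝ (Fin d) → ℝ)
    (V : EuclideanSpace ℝ (Fin d) → EuclideanSpace ℝ (Fin d))
    (φlow φhigh Γ : ℝ) : Prop where
  φlow_pos : 0 < φlow
  smooth : IsPiecewiseSmooth M φ
  bounds : ∀ K ∈ M.cells, ∀ x ∈ K, φlow ≤ φ x ∧ φ x ≤ φhigh
  polynomial : IsPiecewisePolynomial M V
  memLp : MemLp V 2 (volume.restrict Ω)
  /-- `V ∈ H_div(Ω)` with `|div V| ≤ Γ` -/
  hdiv : ∃ g : EuclideanSpace ℝ (Fin d) → ℝ, MemLp g 2 (volume.restrict Ω) ∧ IsWeakDiv Ω V g ∧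
    ∀ᵐ x ∂volume.restrict Ω, |g x| ≤ Γ
  /-- `V · n = 0` on `∂Ω` -/
  no_flow : ∀ σ ∈ M.faces, σ ⊆ frontier Ω → ∀ n, IsUnitNormal σ n →
    ∀ K ∈ M.cells, σ ⊆ frontier K → ∀ y ∈ σ, ⟪extendFrom K V y, n⟫ = 0

/-- `γ` is, on the time interval with endpoints `0` and `s`, a characteristic starting from `y`:
a Lipschitz curve in the closure of `Ω` with `γ 0 = y` and `γ' = V(γ) / φ(γ)` except at countably
many times. At a point on the boundary of several cells, `V` and `φ` may be evaluated from any one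
of these cells. -/
def IsCharacteristic {Ω : Set (EuclideanSpace ℝ (Fin d))} (M : PolytopalMesh Ω)
    (φ : EuclideanSpace ℝ (Fin d) → ℝ)
    (V : EuclideanSpace ℝ (Fin d) → EuclideanSpace ℝ (Fin d))
    (y : EuclideanSpace ℝ (Fin d)) (s : ℝ) (γ : ℝ → EuclideanSpace ℝ (Fin d)) : Prop :=
  γ 0 = y ∧
  (∀ r ∈ uIcc 0 s, γ r ∈ closure Ω) ∧
  (∃ L, LipschitzOnWith L γ (uIcc 0 s)) ∧
  ∃ N : Set ℝ, N.Countable ∧ ∀ r ∈ uIcc 0 s \ N, ∃ K ∈ M.cells, γ r ∈ closure K ∧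
    HasDerivWithinAt γ ((extendFrom K φ (γ r))⁻¹ • extendFrom K V (γ r)) (uIcc 0 s) r

/-- The flow `F_s(y)`, as the set of positions at time `s` of the characteristics that start
from `y` (a single point whenever the characteristic is unique). -/
def flow {Ω : Set (EuclideanSpace ℝ (Fin d))} (M : PolytopalMesh Ω)
    (φ : EuclideanSpace ℝ (Fin d) → ℝ)
    (V : EuclideanSpace ℝ (Fin d) → EuclideanSpace ℝ (Fin d))
    (s : ℝ) (y : EuclideanSpace ℝ (Fin d)) : Set (EuclideanSpace ℝ (Fin d)) :=
  {x | ∃ γ, IsCharacteristic M φ V y s γ ∧ γ s = x}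

/-- The region `F_{[0,t]}(σ)` covered by `σ` when transported by the flow over `[0,t]`
(over `[t,0]` if `t < 0`). -/
def sweptRegion {Ω : Set (EuclideanSpace ℝ (Fin d))} (M : PolytopalMesh Ω)
    (φ : EuclideanSpace ℝ (Fin d) → ℝ)
    (V : EuclideanSpace ℝ (Fin d) → EuclideanSpace ℝ (Fin d))
    (σ : Set (EuclideanSpace ℝ (Fin d))) (t : ℝ) : Set (EuclideanSpace ℝ (Fin d)) :=
  ⋃ s ∈ uIcc 0 t, ⋃ y ∈ σ, flow M φ V s y

/-- The constant `C₁(s) = (φ^* / φ_*) exp (Γ |s| / φ_*)`. -/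
def C₁ (φlow φhigh Γ s : ℝ) : ℝ := φhigh / φlow * Real.exp (Γ / φlow * |s|)

end EllamFlow

end

namespace EllamFlow

/-! ### Differential inequalities off a countable set -/

/-! A point swept by `σ` at a negative time is the start of a trajectory that reaches `σ` within
time `|t|`. Positive times reduce to this case by replacing `V` with `-V`, which preserves all
assumptions. So it is enough to bound the volume of `arrivalSet`, the set of points from which `σ`
is reached within a time `T`.

The obstacle is that `V / φ` jumps across faces, so trajectories need not be unique and there is no
global flow. The flow is nevertheless locally unique and Lipschitz around the points of
`regularSet`: the points of the cells, and the interface points off the skeleton where `V · n ≠ 0`.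
At such an interface point, `V · n` takes the same value from both sides because `V` has an
integrable divergence (`inner_eq_inner_of_isWeakDiv`). Both fields therefore push through the face
in the same direction, and the distance of two trajectories, corrected by the difference of their
depths before the face, obeys a Gronwall estimate (`BrokenTraj.dist_le_of_transversal`).

Along trajectories that stay in `regularSet` for a time `r`, preimages of sets grow by a factor at
most `exp (Γ r / φlow)` for the measure `φ dx`. Locally, with `u r = ψ ∘ G r`, the derivative of `∫
u r φ` in `r` is `∫ V · ∇ (u r) = -∫ (div V) u r`, because the weight `φ` cancels the denominator of
the velocity (`IsLocalFlow.integral_transport_le`). A countable cover and short time steps make this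
global (`FlowAssumptions.weightedVolume_trajPreimage_le`).

Each trajectory is then followed only up to the first time `τ` at which it leaves `regularSet` or
touches `closure σ`; what happens later, possibly without uniqueness, does not matter. Cut `[0, T]`
into steps of length `h`. If `τ` lies in `(j h, (j + 1) h]`, the starting point is in the preimage,
after the time `j h`, of the layer of points that reach the stopping set within `h`
(`arrivalSet_subset_of_step`). The volume of this layer is at most `h (∫_σ |V · n| / φlow + o(1))`:
its thickness above a face is governed by the normal velocity, and on the other faces almost every
stopping point has `V · n = 0`, so these faces contribute `o(h)` only
(`FlowAssumptions.eventually_volume_arrivalSet_stoppingSet_le`). Summing the layers, whose steps add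
up to `T`, with the compression factor and `φlow ≤ φ ≤ φhigh`, and letting `h` tend to zero gives
the constant. -/

theorem le_of_deriv_nonpos_off_countable {g : ℝ → ℝ} {a b : ℝ} (hab : a ≤ b)
    (hg : AbsolutelyContinuousOnInterval g a b) {N : Set ℝ} (hN : N.Countable)
    (h : ∀ t ∈ Ioo a b \ N, DifferentiableAt ℝ g t → deriv g t ≤ 0) : g b ≤ g a := by
  have h1 := hg.integral_deriv_eq_sub
  have h2 : ∫ x in a..b, deriv g x ≤ ∫ x in a..b, (0 : ℝ) := by
    apply intervalIntegral.integral_mono_ae_restrict hab hg.intervalIntegrable_deriv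
      (by simp)
    have hN' : ∀ᵐ t : ℝ, t ∉ N ∪ {a, b} :=
      measure_eq_zero_iff_ae_notMem.mp
        ((hN.union ((countable_singleton b).insert a)).measure_zero volume)
    rw [EventuallyLE, ae_restrict_iff' measurableSet_Icc]
    filter_upwards [hN'] with t ht htI
    simp only [mem_union, mem_insert_iff, mem_singleton_iff, not_or] at ht
    by_cases hd : DifferentiableAt ℝ g t
    · exact h t ⟨⟨lt_of_le_of_ne htI.1 (Ne.symm ht.2.1), lt_of_le_of_ne htI.2 ht.2.2⟩, ht.1⟩ hd
    -- Where `g` is not differentiable, `deriv` is zero by convention, so the hypothesis is needed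
    -- at points of differentiability only.
    · simp [deriv_zero_of_not_differentiableAt hd]
  simp only [intervalIntegral.integral_zero] at h2
  linarith

theorem deriv_le_of_eventually_slope_le {f : ℝ → ℝ} {t c : ℝ} (hf : DifferentiableAt ℝ f t)
    (h : ∀ ε > 0, ∀ᶠ s in 𝓝[>] t, f s - f t ≤ (c + ε) * (s - t)) : deriv f t ≤ c := by
  refine le_of_forall_pos_le_add fun ε hε => ?_
  have h1 : Tendsto (slope f t) (𝓝[>] t) (𝓝 (deriv f t)) :=
    (hasDerivAt_iff_tendsto_slope.mp hf.hasDerivAt).mono_left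
      (nhdsWithin_mono _ fun x (hx : t < x) => ne_of_gt hx)
  refine le_of_tendsto h1 ?_
  filter_upwards [h ε hε, self_mem_nhdsWithin] with s hs hts
  have hts' : 0 < s - t := sub_pos.mpr hts
  rw [slope_def_field, div_le_iff₀ hts']
  exact hs

/-- Gronwall's lemma by the integrating factor `exp (-C (t - a))`. The hypothesis is an upper bound
on right slopes because it is applied to norms and absolute values, which have no derivative at some
times; absolute continuity makes the other times sufficient. -/
theorem le_mul_exp_of_slope_le_off_countable {f : ℝ → ℝ} {a b C : ℝ} (hab : a ≤ b) {L : NNReal}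
    (hf : LipschitzOnWith L f (Icc a b)) {N : Set ℝ} (hN : N.Countable)
    (h : ∀ t ∈ Ioo a b \ N, ∀ ε > 0, ∀ᶠ s in 𝓝[>] t, f s - f t ≤ (C * f t + ε) * (s - t)) :
    f b ≤ f a * Real.exp (C * (b - a)) := by
  have hfac : AbsolutelyContinuousOnInterval f a b :=
    LipschitzOnWith.absolutelyContinuousOnInterval (K := L) (by rwa [uIcc_of_le hab])
  let e : ℝ → ℝ := fun t => Real.exp (-C * (t - a))
  have hed : ∀ t, HasDerivAt e (Real.exp (-C * (t - a)) * (-C)) t := fun t => by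
    have := (((hasDerivAt_id t).sub_const a).const_mul (-C)).exp
    simpa [e] using this
  have hec : ContDiff ℝ 1 e := by fun_prop
  have heac : AbsolutelyContinuousOnInterval e a b := by
    obtain ⟨K, hK⟩ := hec.contDiffOn.exists_lipschitzOnWith (s := uIcc a b) (by simp)
      (convex_uIcc a b) isCompact_uIcc
    exact hK.absolutelyContinuousOnInterval
  have hg : AbsolutelyContinuousOnInterval (f * e) a b := hfac.mul heac
  have key := le_of_deriv_nonpos_off_countable hab hg hN fun t ht hd => by
    have hft : DifferentiableAt ℝ f t := by
      -- Undoing the integrating factor transfers differentiability from the product to `f`.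
      have h1 : f = fun s => (f * e) s * Real.exp (C * (s - a)) := by
        funext s
        simp only [Pi.mul_apply, e]
        rw [mul_assoc, ← Real.exp_add]
        simp
      rw [h1]
      exact hd.mul (by fun_prop)
    have h2 := deriv_le_of_eventually_slope_le hft (h t ht)
    have h3 := (hft.hasDerivAt.mul (hed t)).deriv
    rw [h3]
    have h4 : 0 < e t := Real.exp_pos _
    have : deriv f t * e t + f t * (Real.exp (-C * (t - a)) * -C)
        = (deriv f t - C * f t) * e t := by simp only [e]; ring
    rw [this]
    exact mul_nonpos_of_nonpos_of_nonneg (by linarith) h4.le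
  have h5 : (f * e) a = f a := by simp [e]
  rw [h5] at key
  have h6 : f b = (f * e) b * Real.exp (C * (b - a)) := by
    simp only [Pi.mul_apply, e]
    rw [mul_assoc, ← Real.exp_add]
    simp
  rw [h6]
  exact mul_le_mul_of_nonneg_right key (Real.exp_pos _).le

theorem sub_le_of_hasDerivAt_le_off_countable {f : ℝ → ℝ} {a b c : ℝ} (hab : a ≤ b) {L : NNReal}
    (hf : LipschitzOnWith L f (Icc a b)) {N : Set ℝ} (hN : N.Countable)
    (h : ∀ t ∈ Ioo a b \ N, ∃ f', HasDerivAt f f' t ∧ f' ≤ c) :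
    f b - f a ≤ c * (b - a) := by
  have hfac : AbsolutelyContinuousOnInterval f a b :=
    LipschitzOnWith.absolutelyContinuousOnInterval (K := L) (by rwa [uIcc_of_le hab])
  have hlin : AbsolutelyContinuousOnInterval (fun t : ℝ => c * t) a b := by
    have : LipschitzOnWith (Real.nnabs c) (fun t : ℝ => c * t) (uIcc a b) := by
      refine LipschitzOnWith.of_dist_le_mul fun x _ y _ => ?_
      simp [Real.dist_eq, ← mul_sub, abs_mul]
    exact this.absolutelyContinuousOnInterval
  have key := le_of_deriv_nonpos_off_countable hab (hfac.sub hlin) hN fun t ht _ => by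
    obtain ⟨f', hf', hle⟩ := h t ht
    have h1 := (hf'.sub ((hasDerivAt_id t).const_mul c)).deriv
    simp only [mul_one] at h1
    have h2 : deriv (f - fun t => c * t) t = f' - c := h1
    rw [h2]; linarith
  simp only [Pi.sub_apply] at key
  linarith

section

variable {G : Type*} [NormedAddCommGroup G] [NormedSpace ℝ G]

theorem eventually_norm_sub_norm_le {u : ℝ → G} {u' : G} {t : ℝ} (hu : HasDerivAt u u' t)
    {c : ℝ} (hc : ‖u'‖ ≤ c) {ε : ℝ} (hε : 0 < ε) :
    ∀ᶠ s in 𝓝[>] t, ‖u s‖ - ‖u t‖ ≤ (c + ε) * (s - t) := by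
  have h1 := (hasDerivAt_iff_isLittleO.mp hu).def hε
  filter_upwards [nhdsWithin_le_nhds h1, self_mem_nhdsWithin] with s hs hts
  have hts' : 0 < s - t := sub_pos.mpr hts
  rw [Real.norm_of_nonneg hts'.le] at hs
  have h2 : u s = u t + ((s - t) • u' + (u s - u t - (s - t) • u')) := by abel
  have h3 : ‖u s‖ ≤ ‖u t‖ + (‖(s - t) • u'‖ + ‖u s - u t - (s - t) • u'‖) := by
    conv_lhs => rw [h2]
    exact (norm_add_le _ _).trans (by gcongr; exact norm_add_le _ _)
  rw [norm_smul, Real.norm_of_nonneg hts'.le] at h3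
  nlinarith [mul_le_mul_of_nonneg_left hc hts'.le]

end

/-- Pairing `γ` with the fixed vector `z` to be estimated reduces the mean value inequality to the
scalar case. With `w = 0` it is a speed bound; with `w` the velocity at a point it recovers the
derivative there. -/
theorem norm_sub_le_of_hasDerivAt_off_countable {G : Type*} [NormedAddCommGroup G]
    [InnerProductSpace ℝ G] {γ : ℝ → G} {a b v : ℝ} (hv : 0 ≤ v) (hab : a ≤ b) {L : NNReal}
    (hf : LipschitzOnWith L γ (Icc a b)) {N : Set ℝ} (hN : N.Countable) {w : G}
    (h : ∀ t ∈ Ioo a b \ N, ∃ γ', HasDerivAt γ γ' t ∧ ‖γ' - w‖ ≤ v) :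
    ‖γ b - γ a - (b - a) • w‖ ≤ v * (b - a) := by
  set z := γ b - γ a - (b - a) • w with hz
  rcases eq_or_ne z 0 with h0 | h0
  · rw [h0, norm_zero]; exact mul_nonneg hv (by linarith)
  have hl : LipschitzOnWith (‖z‖₊ * L) (fun t => ⟪z, γ t⟫) (Icc a b) := by
    have h1 : LipschitzWith ‖z‖₊ (fun y : G => ⟪z, y⟫) := by
      refine LipschitzWith.of_dist_le_mul fun x y => ?_
      rw [Real.dist_eq, ← inner_sub_right, dist_eq_norm]
      exact abs_real_inner_le_norm _ _
    exact h1.comp_lipschitzOnWith hf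
  have key := sub_le_of_hasDerivAt_le_off_countable (c := ‖z‖ * v + ⟪z, w⟫) hab hl hN
    fun t ht => by
      obtain ⟨γ', h1, h2⟩ := h t ht
      refine ⟨⟪z, γ'⟫, ?_, ?_⟩
      · simpa using (hasDerivAt_const t z).inner ℝ h1
      · have h3 : ⟪z, γ'⟫ = ⟪z, γ' - w⟫ + ⟪z, w⟫ := by rw [inner_sub_right]; ring
        rw [h3]
        gcongr
        exact (real_inner_le_norm _ _).trans (by gcongr)
  have h4 : ⟪z, γ b⟫ - ⟪z, γ a⟫ - (b - a) * ⟪z, w⟫ = ‖z‖ * ‖z‖ := by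
    rw [← real_inner_self_eq_norm_mul_norm]
    conv_rhs => rw [hz]
    rw [← hz, inner_sub_right, inner_sub_right, inner_smul_right]
  have h5 : 0 < ‖z‖ := norm_pos_iff.mpr h0
  have h6 : ‖z‖ * ‖z‖ ≤ ‖z‖ * (v * (b - a)) := by nlinarith
  exact le_of_mul_le_mul_left h6 h5

/-! ### Trajectories of a vector field that is broken along a hyperplane -/

section BrokenField

variable {G : Type*} [NormedAddCommGroup G] [InnerProductSpace ℝ G]

/-- `γ` is, on `[a, b]`, a curve in `B` that follows the field `X` in `⟪n, ·⟫ < c` and the field `Y`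
in `⟪n, ·⟫ > c`, and one of them on the hyperplane `⟪n, ·⟫ = c`. -/
structure BrokenTraj (X Y : G → G) (n : G) (c : ℝ) (B : Set G) (a b : ℝ) (γ : ℝ → G) : Prop where
  lipschitz : ∃ L, LipschitzOnWith L γ (Icc a b)
  mem : ∀ r ∈ Icc a b, γ r ∈ B
  hasDerivAt : ∃ N : Set ℝ, N.Countable ∧ ∀ r ∈ Ioo a b \ N,
    (HasDerivAt γ (X (γ r)) r ∧ ⟪n, γ r⟫ ≤ c) ∨ (HasDerivAt γ (Y (γ r)) r ∧ c ≤ ⟪n, γ r⟫)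

variable {X Y : G → G} {n : G} {c : ℝ} {B : Set G} {a b : ℝ} {γ γ₁ γ₂ : ℝ → G} {K : NNReal}

theorem dist_le_mul_exp_of_lipschitzOnWith (hX : LipschitzOnWith K X B) (hab : a ≤ b)
    (hl₁ : ∃ L, LipschitzOnWith L γ₁ (Icc a b)) (hl₂ : ∃ L, LipschitzOnWith L γ₂ (Icc a b))
    (hm₁ : ∀ r ∈ Icc a b, γ₁ r ∈ B) (hm₂ : ∀ r ∈ Icc a b, γ₂ r ∈ B)
    {N : Set ℝ} (hN : N.Countable) (hd₁ : ∀ r ∈ Ioo a b \ N, HasDerivAt γ₁ (X (γ₁ r)) r)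
    (hd₂ : ∀ r ∈ Ioo a b \ N, HasDerivAt γ₂ (X (γ₂ r)) r) :
    ‖γ₁ b - γ₂ b‖ ≤ ‖γ₁ a - γ₂ a‖ * Real.exp (K * (b - a)) := by
  obtain ⟨L₁, hl₁⟩ := hl₁
  obtain ⟨L₂, hl₂⟩ := hl₂
  have hl : LipschitzOnWith (1 * (L₁ + L₂)) (fun t => ‖γ₁ t - γ₂ t‖) (Icc a b) :=
    lipschitzWith_one_norm.comp_lipschitzOnWith (hl₁.sub hl₂)
  refine le_mul_exp_of_slope_le_off_countable (f := fun t => ‖γ₁ t - γ₂ t‖) hab hl hN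
    fun t ht ε hε => ?_
  refine eventually_norm_sub_norm_le ((hd₁ t ht).sub (hd₂ t ht)) ?_ hε
  exact hX.norm_sub_le (hm₁ t (Ioo_subset_Icc_self ht.1)) (hm₂ t (Ioo_subset_Icc_self ht.1))

theorem BrokenTraj.dist_le_of_eqOn (hX : LipschitzOnWith K X B) (hXY : EqOn X Y B) (hab : a ≤ b)
    (h₁ : BrokenTraj X Y n c B a b γ₁) (h₂ : BrokenTraj X Y n c B a b γ₂) :
    ‖γ₁ b - γ₂ b‖ ≤ ‖γ₁ a - γ₂ a‖ * Real.exp (K * (b - a)) := by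
  have aux : ∀ {γ}, BrokenTraj X Y n c B a b γ → ∃ N : Set ℝ, N.Countable ∧
      ∀ r ∈ Ioo a b \ N, HasDerivAt γ (X (γ r)) r := fun {γ} h => by
    obtain ⟨N, hN, hd⟩ := h.hasDerivAt
    refine ⟨N, hN, fun r hr => ?_⟩
    rcases hd r hr with h' | h'
    · exact h'.1
    · rw [hXY (h.mem r (Ioo_subset_Icc_self hr.1))]; exact h'.1
  obtain ⟨N₁, hN₁, hd₁⟩ := aux h₁
  obtain ⟨N₂, hN₂, hd₂⟩ := aux h₂
  exact dist_le_mul_exp_of_lipschitzOnWith hX hab h₁.lipschitz h₂.lipschitz h₁.mem h₂.mem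
    (hN₁.union hN₂) (fun r hr => hd₁ r ⟨hr.1, fun h => hr.2 (Or.inl h)⟩)
    (fun r hr => hd₂ r ⟨hr.1, fun h => hr.2 (Or.inr h)⟩)

theorem lipschitzOnWith_inner_left (n : G) {L : NNReal} {s : Set ℝ} (h : LipschitzOnWith L γ s) :
    LipschitzOnWith (‖n‖₊ * L) (fun t => ⟪n, γ t⟫) s := by
  have h1 : LipschitzWith ‖n‖₊ (fun y : G => ⟪n, y⟫) := by
    refine LipschitzWith.of_dist_le_mul fun x y => ?_
    rw [Real.dist_eq, ← inner_sub_right, dist_eq_norm]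
    exact abs_real_inner_le_norm _ _
  exact h1.comp_lipschitzOnWith h

theorem hasDerivAt_inner_left {γ' : G} {t : ℝ} (n : G) (h : HasDerivAt γ γ' t) :
    HasDerivAt (fun s => ⟪n, γ s⟫) ⟪n, γ'⟫ t := by
  simpa using (hasDerivAt_const t n).inner ℝ h

theorem BrokenTraj.mono {a' b' : ℝ} (h : BrokenTraj X Y n c B a b γ) (ha : a ≤ a') (hb : b' ≤ b) :
    BrokenTraj X Y n c B a' b' γ := by
  obtain ⟨L, hL⟩ := h.lipschitz
  obtain ⟨N, hN, hd⟩ := h.hasDerivAt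
  exact ⟨⟨L, hL.mono (Icc_subset_Icc ha hb)⟩, fun r hr => h.mem r (Icc_subset_Icc ha hb hr),
    N, hN, fun r hr => hd r ⟨Ioo_subset_Ioo ha hb hr.1, hr.2⟩⟩

theorem BrokenTraj.inner_add_le {c₀ : ℝ} (hX : ∀ x ∈ B, c₀ ≤ ⟪n, X x⟫)
    (hY : ∀ x ∈ B, c₀ ≤ ⟪n, Y x⟫) (h : BrokenTraj X Y n c B a b γ) (hab : a ≤ b) :
    ⟪n, γ a⟫ + c₀ * (b - a) ≤ ⟪n, γ b⟫ := by
  obtain ⟨L, hL⟩ := h.lipschitz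
  obtain ⟨N, hN, hd⟩ := h.hasDerivAt
  have := sub_le_of_hasDerivAt_le_off_countable (c := -c₀) hab
    (lipschitzOnWith_inner_left (-n) hL) hN fun t ht => by
      have hB := h.mem t (Ioo_subset_Icc_self ht.1)
      rcases hd t ht with h' | h'
      · exact ⟨_, hasDerivAt_inner_left (-n) h'.1, by rw [inner_neg_left]; linarith [hX _ hB]⟩
      · exact ⟨_, hasDerivAt_inner_left (-n) h'.1, by rw [inner_neg_left]; linarith [hY _ hB]⟩
  simp only [inner_neg_left] at this
  linarith

/-- The height `⟪n, γ⟫` increases strictly, so the hyperplane is met at most once. Adding this time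
to the exceptional set leaves only times at which the curve is strictly on one side. -/
theorem BrokenTraj.countable_crossing {c₀ : ℝ} (hc₀ : 0 < c₀) (hX : ∀ x ∈ B, c₀ ≤ ⟪n, X x⟫)
    (hY : ∀ x ∈ B, c₀ ≤ ⟪n, Y x⟫) (h : BrokenTraj X Y n c B a b γ) :
    {r ∈ Icc a b | ⟪n, γ r⟫ = c}.Countable := by
  apply Set.Subsingleton.countable
  have aux : ∀ r s, r ∈ Icc a b → s ∈ Icc a b → ⟪n, γ r⟫ = c → ⟪n, γ s⟫ = c → ¬ r < s := by
    intro r s hr hs h1 h2 hrs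
    have h3 := (h.mono hr.1 hs.2).inner_add_le hX hY hrs.le
    have : 0 < c₀ * (s - r) := mul_pos hc₀ (by linarith)
    linarith
  rintro r ⟨hr, hr'⟩ s ⟨hs, hs'⟩
  exact le_antisymm (not_lt.mp (aux s r hs hr hs' hr')) (not_lt.mp (aux r s hr hs hr' hs'))

/-- While the curves are on opposite sides, their velocities may differ by an extra jump `J`. But
the depth `c - ⟪n, γ₂⟫` of the late curve decreases at a rate at least `c₀`, so the second term,
with weight `J / c₀`, absorbs this jump. -/
theorem norm_add_abs_slope_le_of_lt_of_lt {J c₀ : ℝ} (hc₀ : 0 < c₀) (hJ : 0 ≤ J) {D : ℝ}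
    {t : ℝ} {γ₁' γ₂' : G} (h1 : HasDerivAt γ₁ γ₁' t) (h2 : HasDerivAt γ₂ γ₂' t)
    (hn1 : c < ⟪n, γ₁ t⟫) (hn2 : ⟪n, γ₂ t⟫ < c) (hD : ‖γ₁' - γ₂'‖ ≤ D + J)
    (hc : c₀ ≤ ⟪n, γ₂'⟫) {ε : ℝ} (hε : 0 < ε) :
    ∀ᶠ s in 𝓝[>] t, (‖γ₁ s - γ₂ s‖ + J / c₀ * |max (c - ⟪n, γ₁ s⟫) 0 - max (c - ⟪n, γ₂ s⟫) 0|) -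
      (‖γ₁ t - γ₂ t‖ + J / c₀ * |max (c - ⟪n, γ₁ t⟫) 0 - max (c - ⟪n, γ₂ t⟫) 0|) ≤
      (D + ε) * (s - t) := by
  have e1 := eventually_norm_sub_norm_le (h1.sub h2) hD (half_pos hε)
  have ha1 := hasDerivAt_inner_left n h1
  have ha2 := hasDerivAt_inner_left n h2
  have hκ : 0 ≤ J / c₀ := div_nonneg hJ hc₀.le
  have e2 : ∀ᶠ s in 𝓝[>] t, ⟪n, γ₂ t⟫ - ⟪n, γ₂ s⟫ + ⟪n, γ₂'⟫ * (s - t)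
      ≤ ε / (2 * (J / c₀ + 1)) * (s - t) := by
    have h3 := (hasDerivAt_iff_isLittleO.mp ha2).def
      (show 0 < ε / (2 * (J / c₀ + 1)) by positivity)
    filter_upwards [nhdsWithin_le_nhds h3, self_mem_nhdsWithin] with s hs hts
    have hts' : 0 < s - t := sub_pos.mpr hts
    rw [Real.norm_of_nonneg hts'.le, Real.norm_eq_abs, abs_le, smul_eq_mul] at hs
    nlinarith [hs.1]
  have e3 : ∀ᶠ s in 𝓝[>] t, c < ⟪n, γ₁ s⟫ :=
    nhdsWithin_le_nhds (ha1.continuousAt.eventually (lt_mem_nhds hn1))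
  have e4 : ∀ᶠ s in 𝓝[>] t, ⟪n, γ₂ s⟫ < c :=
    nhdsWithin_le_nhds (ha2.continuousAt.eventually (gt_mem_nhds hn2))
  filter_upwards [e1, e2, e3, e4, self_mem_nhdsWithin] with s hs1 hs2 hs3 hs4 hts
  have hts' : 0 < s - t := sub_pos.mpr hts
  have f1 : ∀ {u w : ℝ}, c < u → w < c → |max (c - u) 0 - max (c - w) 0| = c - w := by
    intro u w hu hw
    rw [max_eq_right (by linarith), max_eq_left (by linarith), zero_sub, abs_neg,
      abs_of_pos (by linarith)]
  rw [f1 hs3 hs4, f1 hn1 hn2]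
  simp only [Pi.sub_apply] at hs1
  have h5 : J / c₀ * (ε / (2 * (J / c₀ + 1)) * (s - t)) ≤ ε / 2 * (s - t) := by
    rw [← mul_assoc]
    gcongr
    rw [mul_div_assoc', div_le_div_iff₀ (by positivity) two_pos]
    nlinarith
  have h6 := mul_le_mul_of_nonneg_left hs2 hκ
  have h7 : J ≤ J / c₀ * ⟪n, γ₂'⟫ := by
    rw [div_mul_eq_mul_div, le_div_iff₀ hc₀]
    exact mul_le_mul_of_nonneg_left hc hJ
  nlinarith [mul_le_mul_of_nonneg_right h7 hts'.le]

/-- Gronwall's lemma for `E`, the distance plus `J / c₀` times the difference of the depths below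
the hyperplane. On opposite sides the depth term pays for the jump. On the same side each field is
Lipschitz, and the depth term costs at most the factor `1 + J / c₀`. -/
theorem BrokenTraj.dist_le_of_transversal {J c₀ : ℝ} (hc₀ : 0 < c₀) (hJ : 0 ≤ J) (hn : ‖n‖ = 1)
    (hXl : LipschitzOnWith K X B) (hYl : LipschitzOnWith K Y B)
    (hXY : ∀ x ∈ B, ‖X x - Y x‖ ≤ J)
    (hX : ∀ x ∈ B, c₀ ≤ ⟪n, X x⟫) (hY : ∀ x ∈ B, c₀ ≤ ⟪n, Y x⟫) (hab : a ≤ b)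
    (h₁ : BrokenTraj X Y n c B a b γ₁) (h₂ : BrokenTraj X Y n c B a b γ₂) :
    ‖γ₁ b - γ₂ b‖ ≤ (1 + J / c₀) * ‖γ₁ a - γ₂ a‖ * Real.exp ((1 + J / c₀) * K * (b - a)) := by
  have hκ : 0 ≤ J / c₀ := div_nonneg hJ hc₀.le
  obtain ⟨L₁, hl₁⟩ := h₁.lipschitz
  obtain ⟨L₂, hl₂⟩ := h₂.lipschitz
  obtain ⟨N₁, hN₁, hd₁⟩ := h₁.hasDerivAt
  obtain ⟨N₂, hN₂, hd₂⟩ := h₂.hasDerivAt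
  let ξ : G → ℝ := fun y => max (c - ⟪n, y⟫) 0
  have hξ : LipschitzWith 1 ξ := by
    refine LipschitzWith.max_const ?_ 0
    refine LipschitzWith.of_dist_le_mul fun x y => ?_
    rw [Real.dist_eq, sub_sub_sub_cancel_left, ← inner_sub_right, dist_eq_norm, norm_sub_rev]
    simpa [hn] using abs_real_inner_le_norm n (y - x)
  let E : ℝ → ℝ := fun t => ‖γ₁ t - γ₂ t‖ + J / c₀ * |ξ (γ₁ t) - ξ (γ₂ t)|
  obtain ⟨LE, hE⟩ : ∃ LE, LipschitzOnWith LE E (Icc a b) := by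
    have l1 : LipschitzOnWith (1 * (L₁ + L₂)) (fun t => ‖γ₁ t - γ₂ t‖) (Icc a b) :=
      lipschitzWith_one_norm.comp_lipschitzOnWith (hl₁.sub hl₂)
    have l2 : LipschitzOnWith (1 * (1 * L₁ + 1 * L₂)) (fun t => ‖ξ (γ₁ t) - ξ (γ₂ t)‖) (Icc a b) :=
      lipschitzWith_one_norm.comp_lipschitzOnWith
        ((hξ.comp_lipschitzOnWith hl₁).sub (hξ.comp_lipschitzOnWith hl₂))
    have l3 : LipschitzWith (Real.nnabs (J / c₀)) (fun y : ℝ => J / c₀ * y) := by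
      refine LipschitzWith.of_dist_le_mul fun x y => ?_
      rw [Real.dist_eq, Real.dist_eq, ← mul_sub, abs_mul, Real.coe_nnabs]
    exact ⟨_, l1.add (l3.comp_lipschitzOnWith l2)⟩
  have hN : (N₁ ∪ N₂ ∪ ({r ∈ Icc a b | ⟪n, γ₁ r⟫ = c} ∪ {r ∈ Icc a b | ⟪n, γ₂ r⟫ = c})).Countable :=
    (hN₁.union hN₂).union
      ((h₁.countable_crossing hc₀ hX hY).union (h₂.countable_crossing hc₀ hX hY))
  have hEle : ∀ t, ‖γ₁ t - γ₂ t‖ ≤ E t := fun t => le_add_of_nonneg_right (by positivity)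
  have key := le_mul_exp_of_slope_le_off_countable (C := (1 + J / c₀) * K) hab hE hN
    fun t ht ε hε => by
      have htI := Ioo_subset_Icc_self ht.1
      have hB1 := h₁.mem t htI
      have hB2 := h₂.mem t htI
      simp only [Set.mem_sdiff, mem_union, not_or, mem_ofPred_eq, not_and] at ht
      obtain ⟨ht, ⟨hn1, hn2⟩, hz1, hz2⟩ := ht
      replace hz1 := hz1 htI
      replace hz2 := hz2 htI
      have hXd := hXl.norm_sub_le hB1 hB2
      have hYd := hYl.norm_sub_le hB1 hB2
      set δ := ‖γ₁ t - γ₂ t‖ with hδ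
      have hbound : K * δ ≤ (1 + J / c₀) * K * E t := by
        have := mul_le_mul_of_nonneg_left (hEle t) K.2
        have h0 : 0 ≤ (K : ℝ) * E t := mul_nonneg K.2 ((norm_nonneg _).trans (hEle t))
        calc (K : ℝ) * δ ≤ K * E t := this
          _ ≤ (1 + J / c₀) * (K * E t) := le_mul_of_one_le_left h0 (by linarith)
          _ = _ := by ring
      -- In all cases but the one with both curves below the hyperplane, the slope of `E` is bounded
      -- by `K * δ` itself.
      have finish : (∀ᶠ s in 𝓝[>] t, E s - E t ≤ (K * δ + ε) * (s - t)) →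
          ∀ᶠ s in 𝓝[>] t, E s - E t ≤ ((1 + J / c₀) * K * E t + ε) * (s - t) := fun h => by
        filter_upwards [h, self_mem_nhdsWithin] with s hs hts
        refine hs.trans (mul_le_mul_of_nonneg_right (by linarith) (sub_nonneg.mpr (le_of_lt hts)))
      rcases hd₁ t ⟨ht, hn1⟩ with ⟨d1, s1⟩ | ⟨d1, s1⟩ <;>
        rcases hd₂ t ⟨ht, hn2⟩ with ⟨d2, s2⟩ | ⟨d2, s2⟩
      · have s1' := lt_of_le_of_ne s1 hz1
        have s2' := lt_of_le_of_ne s2 hz2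
        have ha1 := hasDerivAt_inner_left n d1
        have ha2 := hasDerivAt_inner_left n d2
        -- The error `ε / (1 + J / c₀)` is used for the distance and for the depth, whose weights
        -- add up to `1 + J / c₀`.
        have e1 := eventually_norm_sub_norm_le (d1.sub d2) hXd
          (show 0 < ε / (1 + J / c₀) by positivity)
        have e2 := eventually_norm_sub_norm_le (ha1.sub ha2) (c := K * δ) (by
          rw [← inner_sub_right]
          refine (abs_real_inner_le_norm _ _).trans ?_
          rw [hn, one_mul]; exact hXd) (show 0 < ε / (1 + J / c₀) by positivity)
        have e3 : ∀ᶠ s in 𝓝[>] t, ⟪n, γ₁ s⟫ < c :=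
          nhdsWithin_le_nhds (ha1.continuousAt.eventually (gt_mem_nhds s1'))
        have e4 : ∀ᶠ s in 𝓝[>] t, ⟪n, γ₂ s⟫ < c :=
          nhdsWithin_le_nhds (ha2.continuousAt.eventually (gt_mem_nhds s2'))
        have f1 : ∀ {u w : ℝ}, u < c → w < c → |max (c - u) 0 - max (c - w) 0| = ‖u - w‖ := by
          intro u w hu hw
          rw [max_eq_left (by linarith), max_eq_left (by linarith), sub_sub_sub_cancel_left,
            Real.norm_eq_abs, abs_sub_comm]
        filter_upwards [e1, e2, e3, e4, self_mem_nhdsWithin] with s q1 q2 q3 q4 hts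
        have hts' : 0 < s - t := sub_pos.mpr hts
        simp only [Pi.sub_apply] at q1 q2
        simp only [E, ξ]
        rw [f1 q3 q4, f1 s1' s2']
        have q5 := mul_le_mul_of_nonneg_left q2 hκ
        have q6 : (1 + J / c₀) * ((K * δ + ε / (1 + J / c₀)) * (s - t)) =
            ((1 + J / c₀) * K * δ + ε) * (s - t) := by field_simp
        have q7 : (1 + J / c₀) * K * δ ≤ (1 + J / c₀) * K * E t := by
          gcongr; exact hEle t
        have q8 := mul_le_mul_of_nonneg_right q7 hts'.le
        simp only [E, ξ] at q8
        rw [f1 s1' s2'] at q8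
        nlinarith
      · have s1' := lt_of_le_of_ne s1 hz1
        have s2' := lt_of_le_of_ne s2 (Ne.symm hz2)
        apply finish
        have := norm_add_abs_slope_le_of_lt_of_lt hc₀ hJ (D := K * δ) d2 d1 s2' s1' (by
          have : Y (γ₂ t) - X (γ₁ t) = -(X (γ₁ t) - X (γ₂ t)) + -(X (γ₂ t) - Y (γ₂ t)) := by abel
          rw [this]
          refine (norm_add_le _ _).trans ?_
          rw [norm_neg, norm_neg]
          exact add_le_add hXd (hXY _ hB2)) (hX _ hB1) hε
        simp only [E, ξ]
        simp_rw [norm_sub_rev (γ₁ _), abs_sub_comm (max (c - ⟪n, γ₁ _⟫) 0)]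
        exact this
      · have s1' := lt_of_le_of_ne s1 (Ne.symm hz1)
        have s2' := lt_of_le_of_ne s2 hz2
        apply finish
        exact norm_add_abs_slope_le_of_lt_of_lt hc₀ hJ (D := K * δ) d1 d2 s1' s2' (by
          have : Y (γ₁ t) - X (γ₂ t) = (Y (γ₁ t) - Y (γ₂ t)) + -(X (γ₂ t) - Y (γ₂ t)) := by abel
          rw [this]
          refine (norm_add_le _ _).trans ?_
          rw [norm_neg]
          exact add_le_add hYd (hXY _ hB2)) (hX _ hB2) hε
      · have s1' := lt_of_le_of_ne s1 (Ne.symm hz1)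
        have s2' := lt_of_le_of_ne s2 (Ne.symm hz2)
        apply finish
        have ha1 := hasDerivAt_inner_left n d1
        have ha2 := hasDerivAt_inner_left n d2
        have e1 := eventually_norm_sub_norm_le (d1.sub d2) hYd hε
        have e3 : ∀ᶠ s in 𝓝[>] t, c < ⟪n, γ₁ s⟫ :=
          nhdsWithin_le_nhds (ha1.continuousAt.eventually (lt_mem_nhds s1'))
        have e4 : ∀ᶠ s in 𝓝[>] t, c < ⟪n, γ₂ s⟫ :=
          nhdsWithin_le_nhds (ha2.continuousAt.eventually (lt_mem_nhds s2'))
        have f1 : ∀ {u w : ℝ}, c < u → c < w → |max (c - u) 0 - max (c - w) 0| = 0 := by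
          intro u w hu hw
          rw [max_eq_right (by linarith), max_eq_right (by linarith), sub_self, abs_zero]
        filter_upwards [e1, e3, e4] with s q1 q3 q4
        simp only [Pi.sub_apply] at q1
        simp only [E, ξ]
        rw [f1 q3 q4, f1 s1' s2']
        simpa using q1
  refine (hEle b).trans (key.trans (mul_le_mul_of_nonneg_right ?_ (Real.exp_pos _).le))
  have h8 : |ξ (γ₁ a) - ξ (γ₂ a)| ≤ ‖γ₁ a - γ₂ a‖ := by
    simpa using hξ.norm_sub_le (γ₁ a) (γ₂ a)
  have := mul_le_mul_of_nonneg_left h8 hκ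
  simp only [E]
  linarith

end BrokenField

/-! ### Existence of trajectories across a hyperplane -/

section BrokenField

variable {G : Type*} [NormedAddCommGroup G] [InnerProductSpace ℝ G]

/-- Picard–Lindelöf, applied through its fixed point in the space of curves so as to keep track of
the ball that contains the solution. -/
theorem exists_integral_curve_mem_closedBall [CompleteSpace G] {X : G → G} {p x : G} {A r δ : ℝ}
    {v K : NNReal} (hX : LipschitzOnWith K X (Metric.closedBall p A))
    (hv : ∀ y ∈ Metric.closedBall p A, ‖X y‖ ≤ v) (hr : 0 ≤ r) (hδ : 0 ≤ δ) (hA : v * δ ≤ A - r)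
    (hx : x ∈ Metric.closedBall p r) :
    ∃ α : ℝ → G, α 0 = x ∧ LipschitzOnWith v α (Icc 0 δ) ∧ ∀ t ∈ Icc 0 δ,
      α t ∈ Metric.closedBall p A ∧ HasDerivWithinAt α (X (α t)) (Icc 0 δ) t := by
  have hA0 : 0 ≤ A := by nlinarith [mul_nonneg v.2 hδ, v.2]
  lift A to NNReal using hA0
  lift r to NNReal using hr
  have hf : IsPicardLindelof (fun _ => X) (tmin := 0) (tmax := δ) ⟨0, left_mem_Icc.mpr hδ⟩ p
      A r v K := by
    refine IsPicardLindelof.of_time_independent hv hX ?_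
    simpa [max_eq_left hδ] using hA
  obtain ⟨α, hα⟩ := ODE.FunSpace.exists_isFixedPt_next hf hx
  have hmem : ∀ t, α.compProj t ∈ Metric.closedBall p A := fun t =>
    ODE.FunSpace.compProj_mem_closedBall α hf.mul_max_le
  have hder : ∀ t ∈ Icc 0 δ, HasDerivWithinAt α.compProj (X (α.compProj t)) (Icc 0 δ) t := by
    intro t ht
    apply ODE.hasDerivWithinAt_picard_Icc (left_mem_Icc.mpr hδ) hf.continuousOn_uncurry
      α.continuous_compProj.continuousOn (fun _ ht' => hmem _) x ht |>.congr_of_mem _ ht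
    intro t' ht'
    nth_rw 1 [← hα]
    rw [ODE.FunSpace.compProj_of_mem ht', ODE.FunSpace.next_apply]
  refine ⟨α.compProj, ?_, ?_, fun t ht => ⟨hmem t, hder t ht⟩⟩
  · have := ODE.FunSpace.next_apply₀ hf hx α
    rw [hα] at this
    rw [ODE.FunSpace.compProj_of_mem (left_mem_Icc.mpr hδ)]
    exact this
  · refine (convex_Icc 0 δ).lipschitzOnWith_of_nnnorm_hasDerivWithin_le (fun t ht => hder t ht)
      fun t ht => ?_
    exact_mod_cast hv _ (hmem t)

variable {X Y : G → G} {n : G} {c : ℝ}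

theorem exists_brokenTraj_of_eqOn [CompleteSpace G] {p x : G} {A r δ : ℝ}
    {v K : NNReal} (hX : LipschitzOnWith K X (Metric.closedBall p A))
    (hXY : EqOn X Y (Metric.closedBall p A))
    (hv : ∀ y ∈ Metric.closedBall p A, ‖X y‖ ≤ v) (hr : 0 ≤ r) (hδ : 0 ≤ δ) (hA : v * δ ≤ A - r)
    (hx : x ∈ Metric.closedBall p r) :
    ∃ α : ℝ → G, α 0 = x ∧ BrokenTraj X Y n c (Metric.closedBall p A) 0 δ α := by
  obtain ⟨α, h0, hl, h⟩ := exists_integral_curve_mem_closedBall hX hv hr hδ hA hx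
  refine ⟨α, h0, ⟨_, hl⟩, fun t ht => (h t ht).1, ∅, countable_empty, fun t ht => ?_⟩
  have h1 := h t (Ioo_subset_Icc_self ht.1)
  have h2 := h1.2.hasDerivAt (Icc_mem_nhds ht.1.1 ht.1.2)
  rcases le_total ⟪n, α t⟫ c with h3 | h3
  · exact Or.inl ⟨h2, h3⟩
  · exact Or.inr ⟨hXY h1.1 ▸ h2, h3⟩

theorem strictMonoOn_inner_integral_curve {X : G → G} {A δ : ℝ} {p : G}
    (hn : ∀ y ∈ Metric.closedBall p A, 0 < ⟪n, X y⟫) {α : ℝ → G}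
    (h : ∀ t ∈ Icc 0 δ, α t ∈ Metric.closedBall p A ∧ HasDerivWithinAt α (X (α t)) (Icc 0 δ) t) :
    StrictMonoOn (fun t => ⟪n, α t⟫) (Icc 0 δ) := by
  refine strictMonoOn_of_hasDerivWithinAt_pos (f' := fun t => ⟪n, X (α t)⟫) (convex_Icc _ _)
    ?_ ?_ ?_
  · intro t ht
    exact ((h t ht).2.continuousWithinAt.inner continuousWithinAt_const).congr
      (fun y _ => real_inner_comm _ _) (real_inner_comm _ _)
  · intro t ht
    rw [interior_Icc] at ht ⊢
    exact (hasDerivAt_inner_left n ((h t (Ioo_subset_Icc_self ht)).2.hasDerivAt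
      (Icc_mem_nhds ht.1 ht.2))).hasDerivWithinAt
  · intro t ht
    exact hn _ (h t (interior_subset ht)).1

/-- Follow `X` up to the hyperplane, then `Y`; since both fields increase `⟪n, ·⟫`, the curve never
comes back. The factor 2 in `hA` allows a displacement `v * δ` for each of the two pieces. -/
theorem exists_brokenTraj_of_transversal [CompleteSpace G] {p x : G} {A r δ : ℝ}
    {v K : NNReal} (hX : LipschitzOnWith K X (Metric.closedBall p A))
    (hY : LipschitzOnWith K Y (Metric.closedBall p A))
    (hvX : ∀ y ∈ Metric.closedBall p A, ‖X y‖ ≤ v) (hvY : ∀ y ∈ Metric.closedBall p A, ‖Y y‖ ≤ v)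
    (hnX : ∀ y ∈ Metric.closedBall p A, 0 < ⟪n, X y⟫)
    (hnY : ∀ y ∈ Metric.closedBall p A, 0 < ⟪n, Y y⟫)
    (hr : 0 ≤ r) (hδ : 0 ≤ δ) (hA : 2 * (v * δ) ≤ A - r)
    (hx : x ∈ Metric.closedBall p r) :
    ∃ α : ℝ → G, α 0 = x ∧ BrokenTraj X Y n c (Metric.closedBall p A) 0 δ α := by
  have hvδ : 0 ≤ v * δ := mul_nonneg v.2 hδ
  -- a trajectory issued from the downstream side
  have down : ∀ y ∈ Metric.closedBall p (r + v * δ), c ≤ ⟪n, y⟫ → ∃ β : ℝ → G, β 0 = y ∧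
      LipschitzOnWith v β (Icc 0 δ) ∧ (∀ t ∈ Icc 0 δ, β t ∈ Metric.closedBall p A ∧
        HasDerivWithinAt β (Y (β t)) (Icc 0 δ) t ∧ c ≤ ⟪n, β t⟫) := by
    intro y hy hcy
    obtain ⟨β, h0, hl, h⟩ := exists_integral_curve_mem_closedBall hY hvY (by positivity) hδ
      (by linarith) hy
    refine ⟨β, h0, hl, fun t ht => ⟨(h t ht).1, (h t ht).2, ?_⟩⟩
    have := (strictMonoOn_inner_integral_curve hnY h).monotoneOn (left_mem_Icc.mpr hδ) ht ht.1
    simp only [h0] at this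
    exact hcy.trans this
  have hx' : x ∈ Metric.closedBall p (r + v * δ) :=
    Metric.closedBall_subset_closedBall (by linarith) hx
  rcases le_total c ⟪n, x⟫ with hc | hc
  · obtain ⟨β, h0, hl, h⟩ := down x hx' hc
    refine ⟨β, h0, ⟨_, hl⟩, fun t ht => (h t ht).1, ∅, countable_empty, fun t ht => Or.inr ?_⟩
    have h1 := h t (Ioo_subset_Icc_self ht.1)
    exact ⟨h1.2.1.hasDerivAt (Icc_mem_nhds ht.1.1 ht.1.2), h1.2.2⟩
  obtain ⟨α, h0, hl, h⟩ := exists_integral_curve_mem_closedBall hX hvX hr hδ (by linarith) hx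
  have hmono := strictMonoOn_inner_integral_curve hnX h
  rcases le_total ⟪n, α δ⟫ c with hδc | hδc
  · refine ⟨α, h0, ⟨_, hl⟩, fun t ht => (h t ht).1, ∅, countable_empty, fun t ht => Or.inl ?_⟩
    have h1 := h t (Ioo_subset_Icc_self ht.1)
    exact ⟨h1.2.hasDerivAt (Icc_mem_nhds ht.1.1 ht.1.2),
      (hmono.monotoneOn (Ioo_subset_Icc_self ht.1) (right_mem_Icc.mpr hδ) ht.1.2.le).trans hδc⟩
  -- the curve crosses the hyperplane at time `θ`
  obtain ⟨θ, hθ, hθc⟩ : ∃ θ ∈ Icc 0 δ, ⟪n, α θ⟫ = c := by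
    have hcont : ContinuousOn (fun t => ⟪n, α t⟫) (Icc 0 δ) :=
      (lipschitzOnWith_inner_left n hl).continuousOn
    have := intermediate_value_Icc hδ hcont
    exact this ⟨by simpa [h0] using hc, hδc⟩
  have hαθ : α θ ∈ Metric.closedBall p (r + v * δ) := by
    have h1 := hl.dist_le_mul θ hθ 0 (left_mem_Icc.mpr hδ)
    rw [h0, Real.dist_eq, sub_zero, abs_of_nonneg hθ.1] at h1
    have h2 : (v : ℝ) * θ ≤ v * δ := mul_le_mul_of_nonneg_left hθ.2 v.2
    rw [Metric.mem_closedBall] at hx ⊢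
    linarith [dist_triangle (α θ) x p]
  obtain ⟨β, hβ0, hβl, hβ⟩ := down (α θ) hαθ hθc.ge
  let γ : ℝ → G := fun t => if t ≤ θ then α t else β (t - θ)
  have hγ1 : ∀ t, t ≤ θ → γ t = α t := fun t ht => if_pos ht
  have hγ2 : ∀ t, θ ≤ t → γ t = β (t - θ) := fun t ht => by
    rcases ht.eq_or_lt with rfl | ht'
    · simp [γ, hβ0]
    · exact if_neg (not_le.mpr ht')
  have hsh : ∀ t ∈ Icc 0 δ, θ ≤ t → t - θ ∈ Icc 0 δ := fun t ht h' =>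
    ⟨by linarith, by linarith [ht.2, hθ.1]⟩
  have hγl : ∀ s ∈ Icc 0 δ, ∀ t ∈ Icc 0 δ, s ≤ t → dist (γ s) (γ t) ≤ v * (t - s) := by
    intro s hs t ht hst
    have d1 : ∀ s ∈ Icc 0 δ, ∀ t ∈ Icc 0 δ, s ≤ t → t ≤ θ → dist (γ s) (γ t) ≤ v * (t - s) := by
      intro s hs t ht hst hθt
      rw [hγ1 s (hst.trans hθt), hγ1 t hθt, dist_comm]
      have := hl.dist_le_mul t ht s hs
      rwa [Real.dist_eq, abs_of_nonneg (sub_nonneg.mpr hst)] at this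
    have d2 : ∀ s ∈ Icc 0 δ, ∀ t ∈ Icc 0 δ, s ≤ t → θ ≤ s → dist (γ s) (γ t) ≤ v * (t - s) := by
      intro s hs t ht hst hθs
      rw [hγ2 s hθs, hγ2 t (hθs.trans hst), dist_comm]
      have := hβl.dist_le_mul (t - θ) (hsh t ht (hθs.trans hst)) (s - θ) (hsh s hs hθs)
      rwa [Real.dist_eq, sub_sub_sub_cancel_right, abs_of_nonneg (sub_nonneg.mpr hst)] at this
    rcases le_total t θ with h1 | h1
    · exact d1 s hs t ht hst h1
    rcases le_total θ s with h2 | h2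
    · exact d2 s hs t ht hst h2
    · have := d1 s hs θ hθ h2 le_rfl
      have := d2 θ hθ t ht h1 le_rfl
      linarith [dist_triangle (γ s) (γ θ) (γ t)]
  -- The only time at which the glued curve may fail to be differentiable is the crossing time.
  refine ⟨γ, by rw [hγ1 0 hθ.1, h0], ⟨v, ?_⟩, ?_, {θ}, countable_singleton _, ?_⟩
  · refine LipschitzOnWith.of_dist_le_mul fun s hs t ht => ?_
    rcases le_total s t with hst | hst
    · rw [Real.dist_eq, abs_sub_comm, abs_of_nonneg (sub_nonneg.mpr hst)]
      exact hγl s hs t ht hst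
    · rw [Real.dist_eq, dist_comm, abs_of_nonneg (sub_nonneg.mpr hst)]
      exact hγl t ht s hs hst
  · intro t ht
    rcases le_total t θ with h1 | h1
    · rw [hγ1 t h1]; exact (h t ht).1
    · rw [hγ2 t h1]; exact (hβ _ (hsh t ht h1)).1
  · rintro t ⟨ht, htθ⟩
    have htI := Ioo_subset_Icc_self ht
    rcases lt_or_gt_of_ne (show t ≠ θ from htθ) with h1 | h1
    · left
      have e : γ =ᶠ[𝓝 t] α := by
        filter_upwards [gt_mem_nhds h1] with s hs using hγ1 s (le_of_lt hs)
      rw [hγ1 t h1.le]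
      refine ⟨((h t htI).2.hasDerivAt (Icc_mem_nhds ht.1 ht.2)).congr_of_eventuallyEq e, ?_⟩
      exact hθc ▸ hmono.monotoneOn htI hθ h1.le
    · right
      have e : γ =ᶠ[𝓝 t] fun s => β (s - θ) := by
        filter_upwards [lt_mem_nhds h1] with s hs using hγ2 s (le_of_lt hs)
      rw [hγ2 t h1.le]
      have h2 := hβ _ (hsh t htI h1.le)
      refine ⟨HasDerivAt.congr_of_eventuallyEq ?_ e, h2.2.2⟩
      have h3 := h2.2.1.hasDerivAt (Icc_mem_nhds (by linarith) (by linarith [ht.2, hθ.1]))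
      exact h3.comp_sub_const t θ

end BrokenField

/-! ### Geometry of a polytopal mesh -/

section Geometry

variable {d : ℕ} {Ω : Set (EuclideanSpace ℝ (Fin d))}

/-- The union of the cells of a mesh. -/
def PolytopalMesh.cellUnion (M : PolytopalMesh Ω) : Set (EuclideanSpace ℝ (Fin d)) :=
  ⋃ K ∈ M.cells, K

/-- The union of the closed faces of a mesh. -/
def PolytopalMesh.faceUnion (M : PolytopalMesh Ω) : Set (EuclideanSpace ℝ (Fin d)) :=
  ⋃ σ ∈ M.faces, closure σ

/-- The union of the relative boundaries of the faces of a mesh. -/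
def PolytopalMesh.skeleton (M : PolytopalMesh Ω) : Set (EuclideanSpace ℝ (Fin d)) :=
  ⋃ σ ∈ M.faces, closure σ \ σ

variable (M : PolytopalMesh Ω) {σ K L : Set (EuclideanSpace ℝ (Fin d))}
  {n y : EuclideanSpace ℝ (Fin d)} {c : ℝ}

theorem isClosed_hyperplane (n : EuclideanSpace ℝ (Fin d)) (c : ℝ) : IsClosed (hyperplane n c) :=
  isClosed_eq (by fun_prop) continuous_const

theorem PolytopalMesh.isCompact_closure_cell (hK : K ∈ M.cells) : IsCompact (closure K) :=
  (M.isBounded_domain.subset (M.cell_subset K hK)).isCompact_closure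

theorem PolytopalMesh.closure_cell_subset (hK : K ∈ M.cells) : closure K ⊆ closure Ω :=
  closure_mono (M.cell_subset K hK)

theorem PolytopalMesh.exists_cell_of_face (hσ : σ ∈ M.faces) : ∃ K ∈ M.cells, σ ⊆ frontier K := by
  have : {K ∈ M.cells | σ ⊆ frontier K}.Nonempty := by
    apply nonempty_of_ncard_ne_zero
    rcases M.face_cells σ hσ with h | h <;> omega
  exact this

theorem PolytopalMesh.face_subset_closure (hσ : σ ∈ M.faces) : σ ⊆ closure Ω := by
  obtain ⟨K, hK, h⟩ := M.exists_cell_of_face hσ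
  exact (h.trans frontier_subset_closure).trans (M.closure_cell_subset hK)

theorem PolytopalMesh.isCompact_closure_face (hσ : σ ∈ M.faces) : IsCompact (closure σ) :=
  (M.isBounded_domain.closure.subset (M.face_subset_closure hσ)).isCompact_closure

/-- A face is open in its closed hyperplane, so its relative boundary is the closure minus an open
set of the whole space. -/
theorem PolytopalMesh.isClosed_closure_sdiff_face (hσ : σ ∈ M.faces) :
    IsClosed (closure σ \ σ) := by
  obtain ⟨n, c, U, -, hU, rfl⟩ := M.face_flat σ hσ
  have h : closure (U ∩ hyperplane n c) ⊆ hyperplane n c :=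
    closure_minimal inter_subset_right (isClosed_hyperplane n c)
  have : closure (U ∩ hyperplane n c) \ (U ∩ hyperplane n c) =
      closure (U ∩ hyperplane n c) \ U := by
    ext x
    simp only [Set.mem_sdiff, mem_inter_iff, not_and]
    exact ⟨fun hx => ⟨hx.1, fun hU => hx.2 hU (h hx.1)⟩, fun hx => ⟨hx.1, fun hU => absurd hU hx.2⟩⟩
  rw [this]
  exact isClosed_closure.sdiff hU

theorem PolytopalMesh.isClosed_skeleton : IsClosed M.skeleton :=
  M.finite_faces.isClosed_biUnion fun _ hσ => M.isClosed_closure_sdiff_face hσ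

theorem PolytopalMesh.isOpen_cellUnion : IsOpen M.cellUnion :=
  isOpen_biUnion fun K hK => M.isOpen_cell K hK

theorem PolytopalMesh.cellUnion_subset : M.cellUnion ⊆ Ω :=
  iUnion₂_subset fun K hK => M.cell_subset K hK

theorem PolytopalMesh.frontier_cell_subset (hK : K ∈ M.cells) : frontier K ⊆ M.faceUnion := by
  rw [M.frontier_cell K hK]
  exact biUnion_subset_biUnion_left fun _ h => h.1

theorem PolytopalMesh.closure_subset_union : closure Ω ⊆ M.cellUnion ∪ M.faceUnion := by
  rw [M.closure_domain]
  refine iUnion₂_subset fun K hK x hx => ?_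
  by_cases hxK : x ∈ K
  · exact Or.inl (mem_biUnion hK hxK)
  · exact Or.inr (M.frontier_cell_subset hK ⟨hx, by rwa [(M.isOpen_cell K hK).interior_eq]⟩)

theorem volume_hyperplane (hn : n ≠ 0) (c : ℝ) : volume (hyperplane n c) = 0 := by
  have hne : (LinearMap.ker (innerₗ (EuclideanSpace ℝ (Fin d)) n)) ≠ ⊤ := by
    intro h
    have : n ∈ LinearMap.ker (innerₗ (EuclideanSpace ℝ (Fin d)) n) := h ▸ Submodule.mem_top
    exact hn (by simpa using this)
  by_cases hempty : (hyperplane n c).Nonempty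
  · obtain ⟨p, hp⟩ := hempty
    have h0 := Measure.addHaar_submodule volume _ hne
    have : hyperplane n c ⊆ (fun x => -p + x) ⁻¹'
        (LinearMap.ker (innerₗ (EuclideanSpace ℝ (Fin d)) n) : Set (EuclideanSpace ℝ (Fin d))) := by
      intro x hx
      simp only [hyperplane, mem_ofPred_eq] at hx hp
      simp [inner_add_right, hx, hp]
    refine measure_mono_null this ?_
    rwa [measure_preimage_add]
  · rw [not_nonempty_iff_eq_empty.mp hempty, measure_empty]

theorem PolytopalMesh.volume_faceUnion : volume M.faceUnion = 0 := by
  rw [PolytopalMesh.faceUnion, measure_biUnion_null_iff M.finite_faces.countable]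
  intro σ hσ
  obtain ⟨n, c, U, hn, -, rfl⟩ := M.face_flat σ hσ
  exact measure_mono_null (closure_minimal inter_subset_right (isClosed_hyperplane n c))
    (volume_hyperplane (norm_ne_zero_iff.mp (by rw [hn]; exact one_ne_zero)) c)

theorem PolytopalMesh.face_disjoint_cellUnion (hσ : σ ∈ M.faces) : Disjoint σ M.cellUnion := by
  rw [Set.disjoint_left]
  intro y hy hyD
  simp only [PolytopalMesh.cellUnion, mem_iUnion, exists_prop] at hyD
  obtain ⟨K', hK', hyK'⟩ := hyD
  obtain ⟨K, hK, hσK⟩ := M.exists_cell_of_face hσ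
  have hyK := hσK hy
  obtain ⟨z, hzK', hzK⟩ := mem_closure_iff.mp (frontier_subset_closure hyK) K'
    (M.isOpen_cell K' hK') hyK'
  have : K = K' := by
    by_contra hne
    exact Set.disjoint_left.mp (M.disjoint_cells hK hK' hne) hzK hzK'
  subst this
  exact hyK.2 (by rwa [(M.isOpen_cell K hK).interior_eq])

/-- The part `w` of `n` tangential to the face is orthogonal to `n`: the face is relatively open, so
it contains a small displacement along `w`, and `⟪n, ·⟫` is constant on it. Hence `w = 0`. -/
theorem eq_or_eq_neg_of_isUnitNormal {n₀ : EuclideanSpace ℝ (Fin d)} {c₀ : ℝ}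
    {U : Set (EuclideanSpace ℝ (Fin d))} (hU : IsOpen U) (hn₀ : ‖n₀‖ = 1)
    (hne : (U ∩ hyperplane n₀ c₀).Nonempty) (hn : IsUnitNormal (U ∩ hyperplane n₀ c₀) n) :
    n = n₀ ∨ n = -n₀ := by
  obtain ⟨hn1, c, hc⟩ := hn
  obtain ⟨y, hyU, hy⟩ := hne
  have hn₀' : ⟪n₀, n₀⟫ = 1 := by rw [real_inner_self_eq_norm_sq, hn₀, one_pow]
  have hn' : ⟪n, n⟫ = 1 := by rw [real_inner_self_eq_norm_sq, hn1, one_pow]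
  set w := n - ⟪n₀, n⟫ • n₀ with hw
  have hw0 : ⟪n₀, w⟫ = 0 := by rw [hw, inner_sub_right, inner_smul_right, hn₀']; ring
  have hev : ∀ᶠ t : ℝ in 𝓝 0, y + t • w ∈ U := by
    have : Continuous fun t : ℝ => y + t • w := by fun_prop
    exact this.continuousAt.eventually (hU.mem_nhds (by simpa using hyU))
  obtain ⟨ε, hε, hball⟩ := Metric.eventually_nhds_iff.mp hev
  have hmem : y + (ε / 2) • w ∈ U ∩ hyperplane n₀ c₀ := by
    refine ⟨hball (by simp [abs_of_pos hε]; linarith), ?_⟩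
    simp only [hyperplane, mem_ofPred_eq] at hy ⊢
    rw [inner_add_right, inner_smul_right, hw0, hy]; ring
  have h1 := hc hmem
  have h2 := hc ⟨hyU, hy⟩
  simp only [hyperplane, mem_ofPred_eq] at h1 h2
  rw [inner_add_right, inner_smul_right, h2] at h1
  have h3 : ⟪n, w⟫ = 0 := by
    have : ε / 2 * ⟪n, w⟫ = 0 := by linarith
    exact (mul_eq_zero.mp this).resolve_left (by linarith)
  have h4 : ⟪w, w⟫ = 0 := by
    conv_lhs => rw [hw, ← hw, inner_sub_left, inner_smul_left, h3, hw0]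
    simp
  have h5 : n = ⟪n₀, n⟫ • n₀ := by
    rw [inner_self_eq_zero] at h4
    rw [hw, sub_eq_zero] at h4
    exact h4
  have h6 : |⟪n₀, n⟫| = 1 := by
    have := congrArg norm h5
    rw [norm_smul, hn1, hn₀, mul_one] at this
    exact this.symm
  rcases eq_or_eq_neg_of_abs_eq h6 with h | h
  · left; rw [h5, h, one_smul]
  · right; rw [h5, h, neg_one_smul]

theorem PolytopalMesh.exists_isOpen_of_isUnitNormal (hσ : σ ∈ M.faces) (hn : IsUnitNormal σ n) :
    ∃ c U, IsOpen U ∧ σ = U ∩ hyperplane n c := by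
  obtain ⟨n₀, c₀, U, hn₀, hU, rfl⟩ := M.face_flat σ hσ
  rcases eq_or_eq_neg_of_isUnitNormal hU hn₀ (M.nonempty_face _ hσ) hn with rfl | rfl
  · exact ⟨c₀, U, hU, rfl⟩
  · refine ⟨-c₀, U, hU, ?_⟩
    ext x
    simp [hyperplane, inner_neg_left]

theorem IsUnitNormal.neg (hn : IsUnitNormal σ n) : IsUnitNormal σ (-n) := by
  obtain ⟨h1, c, hc⟩ := hn
  refine ⟨by rwa [norm_neg], -c, fun x hx => ?_⟩
  have := hc hx
  simp only [hyperplane, mem_ofPred_eq] at this ⊢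
  rw [inner_neg_left, this]

theorem PolytopalMesh.exists_isUnitNormal (hσ : σ ∈ M.faces) : ∃ n, IsUnitNormal σ n := by
  obtain ⟨n, c, U, hn, -, rfl⟩ := M.face_flat σ hσ
  exact ⟨n, hn, c, inter_subset_right⟩

/-- The part of a ball below a hyperplane. -/
def lowerHalfBall (n : EuclideanSpace ℝ (Fin d)) (c : ℝ) (y : EuclideanSpace ℝ (Fin d)) (ρ : ℝ) :
    Set (EuclideanSpace ℝ (Fin d)) := Metric.ball y ρ ∩ {x | ⟪n, x⟫ < c}

/-- The part of a ball above a hyperplane. -/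
def upperHalfBall (n : EuclideanSpace ℝ (Fin d)) (c : ℝ) (y : EuclideanSpace ℝ (Fin d)) (ρ : ℝ) :
    Set (EuclideanSpace ℝ (Fin d)) := Metric.ball y ρ ∩ {x | c < ⟪n, x⟫}

theorem convex_lowerHalfBall (n y : EuclideanSpace ℝ (Fin d)) (c ρ : ℝ) :
    Convex ℝ (lowerHalfBall n c y ρ) :=
  (convex_ball y ρ).inter (convex_halfSpace_lt (innerₗ (EuclideanSpace ℝ (Fin d)) n).isLinear c)

theorem convex_upperHalfBall (n y : EuclideanSpace ℝ (Fin d)) (c ρ : ℝ) :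
    Convex ℝ (upperHalfBall n c y ρ) :=
  (convex_ball y ρ).inter (convex_halfSpace_gt (innerₗ (EuclideanSpace ℝ (Fin d)) n).isLinear c)

theorem subset_or_disjoint_closure_of_disjoint_frontier
    {s K : Set (EuclideanSpace ℝ (Fin d))} (hs : IsPreconnected s) (hK : IsOpen K)
    (h : Disjoint s (frontier K)) : s ⊆ K ∨ Disjoint s (closure K) := by
  by_contra hcon
  rw [not_or, Set.not_subset, Set.not_disjoint_iff] at hcon
  obtain ⟨⟨x, hxs, hxK⟩, z, hzs, hzK⟩ := hcon
  have hz : z ∈ K := by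
    by_contra hz
    exact Set.disjoint_left.mp h hzs ⟨hzK, by rwa [hK.interior_eq]⟩
  have hfr : ∀ w ∈ s, w ∉ K → w ∉ closure K := fun w hw hwK hwc =>
    Set.disjoint_left.mp h hw ⟨hwc, by rwa [hK.interior_eq]⟩
  obtain ⟨w, -, hw1, hw2⟩ := hs K (closure K)ᶜ hK isClosed_closure.isOpen_compl
    (fun w hw => or_iff_not_imp_left.mpr (hfr w hw)) ⟨z, hzs, hz⟩ ⟨x, hxs, hfr x hxs hxK⟩
  exact hw2 (subset_closure hw1)

/-- Off the skeleton, a small ball avoids all other closed faces, so cell boundaries inside it lie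
in the hyperplane of `σ`. The open half balls are connected and meet no cell boundary: each of them
is inside or outside a given cell. -/
theorem PolytopalMesh.exists_ball_at_face (hσ : σ ∈ M.faces) (hn : IsUnitNormal σ n)
    (hc : σ ⊆ hyperplane n c) (hy : y ∈ σ) (hyb : y ∉ M.skeleton) :
    ∃ ρ > 0, Metric.ball y ρ ∩ hyperplane n c ⊆ σ ∧
      ∀ K ∈ M.cells, (closure K ∩ Metric.ball y ρ).Nonempty → σ ⊆ frontier K ∧
        (lowerHalfBall n c y ρ ⊆ K ∨ Disjoint (lowerHalfBall n c y ρ) (closure K)) ∧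
        (upperHalfBall n c y ρ ⊆ K ∨ Disjoint (upperHalfBall n c y ρ) (closure K)) := by
  obtain ⟨c', U, hU, hσU⟩ := M.exists_isOpen_of_isUnitNormal hσ hn
  have hcc : c' = c := by
    have h1 := hc hy
    have h2 := (hσU ▸ hy : y ∈ U ∩ hyperplane n c').2
    simp only [hyperplane, mem_ofPred_eq] at h1 h2
    rw [← h1, ← h2]
  subst hcc
  have hother : IsClosed (⋃ σ' ∈ M.faces \ {σ}, closure σ') :=
    (M.finite_faces.subset sdiff_subset).isClosed_biUnion fun _ _ => isClosed_closure
  have hyother : y ∉ ⋃ σ' ∈ M.faces \ {σ}, closure σ' := by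
    simp only [mem_iUnion, not_exists]
    rintro σ' ⟨hσ', hne⟩ hy'
    refine hyb (mem_biUnion hσ' ⟨hy', fun hyσ' => ?_⟩)
    exact Set.disjoint_left.mp (M.disjoint_faces hσ' hσ hne) hyσ' hy
  obtain ⟨ρ, hρ, hball⟩ := Metric.mem_nhds_iff.mp
    ((hU.inter hother.isOpen_compl).mem_nhds ⟨(hσU ▸ hy : y ∈ U ∩ hyperplane n c').1, hyother⟩)
  refine ⟨ρ, hρ, fun x hx => hσU ▸ ⟨(hball hx.1).1, hx.2⟩, fun K hK hKne => ?_⟩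
  have hfr : ∀ x ∈ Metric.ball y ρ, x ∈ frontier K → σ ⊆ frontier K ∧ x ∈ hyperplane n c' := by
    intro x hx hxK
    rw [M.frontier_cell K hK] at hxK
    simp only [mem_iUnion, exists_prop, mem_ofPred_eq] at hxK
    obtain ⟨σ', ⟨hσ', hσ'K⟩, hxσ'⟩ := hxK
    have : σ' = σ := by
      by_contra hne
      exact (hball hx).2 (mem_biUnion (show σ' ∈ M.faces \ {σ} from ⟨hσ', hne⟩) hxσ')
    subst this
    exact ⟨hσ'K, closure_minimal hc (isClosed_hyperplane n c') hxσ'⟩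
  refine ⟨?_, ?_, ?_⟩
  -- If the boundary of `K` missed the ball, then `K` would contain the ball and its centre, which
  -- is on a face, or its closure would miss the ball.
  · by_cases hd : Disjoint (Metric.ball y ρ) (frontier K)
    · rcases subset_or_disjoint_closure_of_disjoint_frontier
        (convex_ball y ρ).isPreconnected (M.isOpen_cell K hK) hd with h | h
      · exact absurd (mem_biUnion hK (h (Metric.mem_ball_self hρ)))
          (Set.disjoint_left.mp (M.face_disjoint_cellUnion hσ) hy)
      · obtain ⟨z, hz1, hz2⟩ := hKne
        exact absurd hz1 (Set.disjoint_left.mp h hz2)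
    · obtain ⟨x, hx1, hx2⟩ := Set.not_disjoint_iff.mp hd
      exact (hfr x hx1 hx2).1
  · refine subset_or_disjoint_closure_of_disjoint_frontier
      (convex_lowerHalfBall n y c' ρ).isPreconnected (M.isOpen_cell K hK) ?_
    rw [Set.disjoint_left]
    exact fun x hx hxK => (ne_of_lt hx.2) (hfr x hx.1 hxK).2
  · refine subset_or_disjoint_closure_of_disjoint_frontier
      (convex_upperHalfBall n y c' ρ).isPreconnected (M.isOpen_cell K hK) ?_
    rw [Set.disjoint_left]
    exact fun x hx hxK => (ne_of_gt hx.2) (hfr x hx.1 hxK).2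

theorem PolytopalMesh.eq_or_eq_of_face_subset (hσ : σ ∈ M.faces) (hK : K ∈ M.cells)
    (hL : L ∈ M.cells) (hKL : K ≠ L) (hσK : σ ⊆ frontier K) (hσL : σ ⊆ frontier L)
    {K' : Set (EuclideanSpace ℝ (Fin d))} (hK' : K' ∈ M.cells) (hσK' : σ ⊆ frontier K') :
    K' = K ∨ K' = L := by
  have hsub : ({K, L} : Set _) ⊆ {K ∈ M.cells | σ ⊆ frontier K} := by
    rintro x (rfl | rfl)
    · exact ⟨hK, hσK⟩
    · exact ⟨hL, hσL⟩
  have hfin : {K ∈ M.cells | σ ⊆ frontier K}.Finite := M.finite_cells.subset fun _ h => h.1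
  have heq := eq_of_subset_of_ncard_le hsub (by
    rw [ncard_pair hKL]
    rcases M.face_cells σ hσ with h | h <;> omega) hfin
  have : K' ∈ ({K, L} : Set _) := heq ▸ ⟨hK', hσK'⟩
  simpa using this

theorem nonempty_lowerHalfBall (hn : ‖n‖ = 1) (hy : ⟪n, y⟫ = c) {ρ : ℝ} (hρ : 0 < ρ) :
    (lowerHalfBall n c y ρ).Nonempty := by
  refine ⟨y - (ρ / 2) • n, ?_, ?_⟩
  · rw [Metric.mem_ball, dist_eq_norm, sub_sub_cancel_left, norm_neg, norm_smul, hn,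
      Real.norm_of_nonneg (by linarith)]
    linarith
  · rw [mem_ofPred_eq, inner_sub_right, inner_smul_right, real_inner_self_eq_norm_sq, hn, hy]
    linarith

/-- A nonempty open set has positive volume, so it cannot be contained in the hyperplane. -/
theorem nonempty_inter_halfBall {U : Set (EuclideanSpace ℝ (Fin d))} (hn : n ≠ 0) {ρ : ℝ}
    (hU : IsOpen U) (hne : (U ∩ Metric.ball y ρ).Nonempty) :
    (U ∩ lowerHalfBall n c y ρ).Nonempty ∨ (U ∩ upperHalfBall n c y ρ).Nonempty := by
  by_contra hcon
  rw [not_or, not_nonempty_iff_eq_empty, not_nonempty_iff_eq_empty] at hcon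
  have hsub : U ∩ Metric.ball y ρ ⊆ hyperplane n c := by
    intro x hx
    rcases lt_trichotomy ⟪n, x⟫ c with h | h | h
    · exact absurd (show x ∈ U ∩ lowerHalfBall n c y ρ from ⟨hx.1, hx.2, h⟩)
        (by rw [hcon.1]; exact notMem_empty x)
    · exact h
    · exact absurd (show x ∈ U ∩ upperHalfBall n c y ρ from ⟨hx.1, hx.2, h⟩)
        (by rw [hcon.2]; exact notMem_empty x)
  have h1 : 0 < volume (U ∩ Metric.ball y ρ) := (hU.inter Metric.isOpen_ball).measure_pos _ hne
  exact absurd (measure_mono_null hsub (volume_hyperplane hn c)) h1.ne'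

/-- Each of the two cells contains at least one of the half balls, and they are disjoint. -/
theorem PolytopalMesh.halfBall_subset_of_ne (hK : K ∈ M.cells)
    (hL : L ∈ M.cells) (hKL : K ≠ L) (hσK : σ ⊆ frontier K) (hσL : σ ⊆ frontier L) (hn : ‖n‖ = 1)
    {ρ : ℝ} (hρ : 0 < ρ) (hy : y ∈ σ) (hc : σ ⊆ hyperplane n c)
    (hloc : ∀ K ∈ M.cells, (closure K ∩ Metric.ball y ρ).Nonempty → σ ⊆ frontier K ∧
        (lowerHalfBall n c y ρ ⊆ K ∨ Disjoint (lowerHalfBall n c y ρ) (closure K)) ∧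
        (upperHalfBall n c y ρ ⊆ K ∨ Disjoint (upperHalfBall n c y ρ) (closure K))) :
    (lowerHalfBall n c y ρ ⊆ K ∧ upperHalfBall n c y ρ ⊆ L) ∨
    (lowerHalfBall n c y ρ ⊆ L ∧ upperHalfBall n c y ρ ⊆ K) := by
  have hn0 : n ≠ 0 := norm_ne_zero_iff.mp (by rw [hn]; exact one_ne_zero)
  have aux : ∀ K ∈ M.cells, σ ⊆ frontier K →
      lowerHalfBall n c y ρ ⊆ K ∨ upperHalfBall n c y ρ ⊆ K := by
    intro K hK hσK
    have hyK := frontier_subset_closure (hσK hy)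
    obtain ⟨-, h1, h2⟩ := hloc K hK ⟨y, hyK, Metric.mem_ball_self hρ⟩
    have hne : (K ∩ Metric.ball y ρ).Nonempty := by
      rw [inter_comm]
      exact mem_closure_iff.mp hyK _ Metric.isOpen_ball (Metric.mem_ball_self hρ)
    rcases nonempty_inter_halfBall (c := c) hn0 (M.isOpen_cell K hK) hne with
      ⟨z, hzK, hz⟩ | ⟨z, hzK, hz⟩
    · exact Or.inl (h1.resolve_right fun h => Set.disjoint_left.mp h hz (subset_closure hzK))
    · exact Or.inr (h2.resolve_right fun h => Set.disjoint_left.mp h hz (subset_closure hzK))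
  have hy' : ⟪n, y⟫ = c := hc hy
  obtain ⟨z1, hz1⟩ := nonempty_lowerHalfBall hn hy' hρ
  have hz2 : (upperHalfBall n c y ρ).Nonempty := by
    obtain ⟨z, hz⟩ := nonempty_lowerHalfBall (n := -n) (c := -c) (y := y) (by rwa [norm_neg])
      (by rw [inner_neg_left, hy']) hρ
    refine ⟨z, hz.1, ?_⟩
    have := hz.2
    rw [mem_ofPred_eq, inner_neg_left] at this
    exact neg_lt_neg_iff.mp this
  obtain ⟨z2, hz2⟩ := hz2
  have hdisj := M.disjoint_cells hK hL hKL
  rcases aux K hK hσK with h1 | h1 <;> rcases aux L hL hσL with h2 | h2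
  · exact absurd (h2 hz1) (Set.disjoint_left.mp hdisj (h1 hz1))
  · exact Or.inl ⟨h1, h2⟩
  · exact Or.inr ⟨h2, h1⟩
  · exact absurd (h2 hz2) (Set.disjoint_left.mp hdisj (h1 hz2))

end Geometry

/-! ### Lipschitz test functions for the weak divergence -/

section Mollify

open scoped Convolution

variable {E : Type*} [NormedAddCommGroup E] [NormedSpace ℝ E] [FiniteDimensional ℝ E]
  [MeasurableSpace E] [BorelSpace E] (μ : Measure E) [μ.IsAddHaarMeasure]

/-- The derivative is put on the merely Lipschitz factor: Rademacher's theorem gives it almost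
everywhere, and the Lipschitz constant dominates the difference quotients. -/
theorem hasFDerivAt_convolution_of_lipschitzWith {ψ : E → ℝ} {L : NNReal} (hψ : LipschitzWith L ψ)
    {η : E → ℝ} (hη : Continuous η) (hηc : HasCompactSupport η) (x : E) :
    HasFDerivAt (η ⋆[ContinuousLinearMap.lsmul ℝ ℝ, μ] ψ)
      ((η ⋆[ContinuousLinearMap.lsmul ℝ ℝ, μ] fderiv ℝ ψ) x) x := by
  have hηi : Integrable η μ := hη.integrable_of_hasCompactSupport hηc
  refine (hasFDerivAt_integral_of_dominated_loc_of_lip (F := fun x t => η t * ψ (x - t))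
    (F' := fun t => η t • fderiv ℝ ψ (x - t)) (bound := fun t => η t * L) univ_mem
    ?_ ?_ ?_ ?_ ?_ ?_).2
  · refine Eventually.of_forall fun z => Continuous.aestronglyMeasurable ?_
    exact hη.mul (hψ.continuous.comp (continuous_const.sub continuous_id))
  · refine Continuous.integrable_of_hasCompactSupport
      (hη.mul (hψ.continuous.comp (continuous_const.sub continuous_id))) ?_
    exact hηc.mul_right
  · refine AEStronglyMeasurable.smul hη.aestronglyMeasurable ?_
    exact ((measurable_fderiv ℝ ψ).comp (measurable_const.sub measurable_id)).aestronglyMeasurable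
  · refine Eventually.of_forall fun t => LipschitzWith.lipschitzOnWith ?_
    refine LipschitzWith.of_dist_le_mul fun z w => ?_
    rw [Real.dist_eq, ← mul_sub, abs_mul, Real.coe_nnabs, abs_mul, NNReal.abs_eq, mul_assoc]
    gcongr
    have := hψ.dist_le_mul (z - t) (w - t)
    rwa [Real.dist_eq, dist_sub_right] at this
  · exact hηi.mul_const _
  · have h1 : ∀ᵐ t ∂μ, DifferentiableAt ℝ ψ (x - t) :=
      (Measure.measurePreserving_sub_left μ x).quasiMeasurePreserving.ae hψ.ae_differentiableAt
    filter_upwards [h1] with t ht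
    have h2 : HasFDerivAt (fun z => ψ (z - t)) (fderiv ℝ ψ (x - t)) x :=
      (hasFDerivAt_comp_sub t).mpr ht.hasFDerivAt
    exact h2.const_mul (η t)

end Mollify

section WeakDiv

open scoped Convolution

variable {d : ℕ} {Ω : Set (EuclideanSpace ℝ (Fin d))}
  {V : EuclideanSpace ℝ (Fin d) → EuclideanSpace ℝ (Fin d)} {g : EuclideanSpace ℝ (Fin d) → ℝ}

theorem inner_gradient_eq_fderiv (ψ : EuclideanSpace ℝ (Fin d) → ℝ)
    (w x : EuclideanSpace ℝ (Fin d)) : ⟪w, ∇ ψ x⟫ = fderiv ℝ ψ x w := by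
  rw [real_inner_comm, gradient, InnerProductSpace.toDual_symm_apply]

/-- Test functions transported by the flow are Lipschitz only. Mollification keeps the Lipschitz
bound, the gradients converge almost everywhere, and dominated convergence passes to the limit in
the identity for smooth test functions. -/
theorem IsWeakDiv.setIntegral_fderiv_of_lipschitzWith (h : IsWeakDiv Ω V g) (hΩ : IsOpen Ω)
    (hV : IntegrableOn V Ω) (hg : IntegrableOn g Ω) {ψ : EuclideanSpace ℝ (Fin d) → ℝ}
    {L : NNReal} (hψ : LipschitzWith L ψ) (hψc : HasCompactSupport ψ) (hψΩ : tsupport ψ ⊆ Ω) :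
    ∫ x in Ω, fderiv ℝ ψ x (V x) = - ∫ x in Ω, g x * ψ x := by
  -- The ratio of the two radii stays equal to 2, which the almost everywhere convergence of the
  -- mollified gradients requires.
  let β : ℕ → ContDiffBump (0 : EuclideanSpace ℝ (Fin d)) := fun k =>
    { rIn := 1 / (2 * (k + 1)), rOut := 1 / (k + 1), rIn_pos := by positivity
      rIn_lt_rOut := by
        apply one_div_lt_one_div_of_lt
        · positivity
        · linarith [show (0 : ℝ) < k + 1 by positivity] }
  have hβ : Tendsto (fun k => (β k).rOut) atTop (𝓝 0) := tendsto_one_div_add_atTop_nhds_zero_nat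
  have hβ' : ∀ k, (β k).rOut ≤ 2 * (β k).rIn := fun k => by
    simp only [β]; apply le_of_eq; field_simp
  let u : ℕ → EuclideanSpace ℝ (Fin d) → ℝ := fun k =>
    (β k).normed volume ⋆[ContinuousLinearMap.lsmul ℝ ℝ, volume] ψ
  have hηc : ∀ k, HasCompactSupport ((β k).normed volume) := fun k => (β k).hasCompactSupport_normed
  have hus : ∀ k, ContDiff ℝ ∞ (u k) := fun k =>
    (hηc k).contDiff_convolution_left _ (β k).contDiff_normed hψ.continuous.locallyIntegrable
  have huc : ∀ k, HasCompactSupport (u k) := fun k => (hηc k).convolution _ hψc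
  have hfd : ∀ k x, fderiv ℝ (u k) x =
      ((β k).normed volume ⋆[ContinuousLinearMap.lsmul ℝ ℝ, volume] fderiv ℝ ψ) x := fun k x =>
    (hasFDerivAt_convolution_of_lipschitzWith volume hψ (β k).continuous_normed (hηc k) x).fderiv
  have hηi : ∀ k, Integrable ((β k).normed volume) (volume : Measure (EuclideanSpace ℝ (Fin d))) :=
    fun k => (β k).integrable_normed
  have hψ' : ∀ x, ‖fderiv ℝ ψ x‖ ≤ L := fun x => norm_fderiv_le_of_lipschitz ℝ hψ
  have hbound : ∀ k x, ‖fderiv ℝ (u k) x‖ ≤ L := fun k x => by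
    rw [hfd]
    calc ‖∫ t, (β k).normed volume t • fderiv ℝ ψ (x - t)‖
        ≤ ∫ t, (β k).normed volume t * L := by
          refine norm_integral_le_of_norm_le ((hηi k).mul_const _)
            (Eventually.of_forall fun t => ?_)
          rw [norm_smul, Real.norm_of_nonneg ((β k).nonneg_normed t)]
          exact mul_le_mul_of_nonneg_left (hψ' _) ((β k).nonneg_normed t)
      _ = L := by rw [integral_mul_const, (β k).integral_normed, one_mul]
  obtain ⟨C, hC⟩ := hψc.exists_bound_of_continuous hψ.continuous
  have hub : ∀ k x, ‖u k x‖ ≤ C := fun k x => by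
    calc ‖∫ t, (β k).normed volume t • ψ (x - t)‖
        ≤ ∫ t, (β k).normed volume t * C := by
          refine norm_integral_le_of_norm_le ((hηi k).mul_const _)
            (Eventually.of_forall fun t => ?_)
          rw [norm_smul, Real.norm_of_nonneg ((β k).nonneg_normed t)]
          exact mul_le_mul_of_nonneg_left (hC _) ((β k).nonneg_normed t)
      _ = C := by rw [integral_mul_const, (β k).integral_normed, one_mul]
  have hlim : ∀ x, Tendsto (fun k => u k x) atTop (𝓝 (ψ x)) := fun x =>
    ContDiffBump.convolution_tendsto_right_of_continuous hβ hψ.continuous x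
  have hloc : LocallyIntegrable (fderiv ℝ ψ) (volume : Measure (EuclideanSpace ℝ (Fin d))) := by
    rw [locallyIntegrable_iff]
    intro k hk
    refine Measure.integrableOn_of_bounded (M := L) hk.measure_lt_top.ne
      (measurable_fderiv ℝ ψ).aestronglyMeasurable ?_
    exact Eventually.of_forall hψ'
  have hlim' : ∀ᵐ x : EuclideanSpace ℝ (Fin d),
      Tendsto (fun k => fderiv ℝ (u k) x) atTop (𝓝 (fderiv ℝ ψ x)) := by
    filter_upwards [ContDiffBump.ae_convolution_tendsto_right_of_locallyIntegrable hβ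
      (Eventually.of_forall hβ') hloc] with x hx
    simpa only [hfd] using hx
  have t1 : Tendsto (fun k => ∫ x in Ω, fderiv ℝ (u k) x (V x)) atTop
      (𝓝 (∫ x in Ω, fderiv ℝ ψ x (V x))) := by
    refine tendsto_integral_of_dominated_convergence (fun x => L * ‖V x‖) (fun k => ?_)
      (hV.norm.const_mul _) (fun k => Eventually.of_forall fun x => ?_) ?_
    · have h1 : Continuous (fderiv ℝ (u k)) := (hus k).continuous_fderiv (by simp)
      exact (ContinuousLinearMap.id ℝ _).aestronglyMeasurable_comp₂ h1.aestronglyMeasurable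
        hV.aestronglyMeasurable
    · exact ((fderiv ℝ (u k) x).le_opNorm _).trans (by gcongr; exact hbound k x)
    · filter_upwards [ae_restrict_of_ae hlim'] with x hx
      exact ((ContinuousLinearMap.apply ℝ ℝ (V x)).continuous.tendsto _).comp hx
  have t2 : Tendsto (fun k => - ∫ x in Ω, g x * u k x) atTop (𝓝 (- ∫ x in Ω, g x * ψ x)) := by
    refine (tendsto_integral_of_dominated_convergence (fun x => ‖g x‖ * C) (fun k => ?_)
      (hg.norm.mul_const _) (fun k => Eventually.of_forall fun x => ?_) ?_).neg
    · exact hg.aestronglyMeasurable.mul (hus k).continuous.aestronglyMeasurable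
    · rw [norm_mul]; gcongr; exact hub k x
    · exact Eventually.of_forall fun x => (hlim x).const_mul _
  refine tendsto_nhds_unique t1 (t2.congr' ?_)
  -- The mollified functions are admissible only once their radius is less than the distance left
  -- between the support of `ψ` and the complement of `Ω`.
  obtain ⟨δ, hδ, hδΩ⟩ := hψc.isCompact.exists_cthickening_subset_open hΩ hψΩ
  filter_upwards [hβ.eventually (gt_mem_nhds hδ)] with k hk
  have hsupp : tsupport (u k) ⊆ Ω := by
    refine (closure_minimal ?_ Metric.isClosed_cthickening).trans hδΩ
    refine (support_convolution_subset _).trans ?_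
    rintro _ ⟨a, ha, b, hb, rfl⟩
    rw [(β k).support_normed_eq, Metric.mem_ball, dist_zero_right] at ha
    refine Metric.mem_cthickening_of_dist_le _ b _ _ (subset_tsupport _ hb) ?_
    rw [dist_eq_norm, add_sub_cancel_right]
    exact (ha.trans hk).le
  rw [← h (u k) (hus k) (huc k) hsupp]
  simp only [inner_gradient_eq_fderiv]

end WeakDiv

/-! ### Continuity of the normal component of a field with a weak divergence -/

section NormalTrace

variable {d : ℕ} {Ω : Set (EuclideanSpace ℝ (Fin d))}
  {V : EuclideanSpace ℝ (Fin d) → EuclideanSpace ℝ (Fin d)} {g : EuclideanSpace ℝ (Fin d) → ℝ}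
  {n y : EuclideanSpace ℝ (Fin d)} {c : ℝ}

theorem isOpen_lowerHalfBall (n : EuclideanSpace ℝ (Fin d)) (c : ℝ) (y : EuclideanSpace ℝ (Fin d))
    (ρ : ℝ) : IsOpen (lowerHalfBall n c y ρ) :=
  Metric.isOpen_ball.inter (isOpen_lt (by fun_prop) continuous_const)

theorem isOpen_upperHalfBall (n : EuclideanSpace ℝ (Fin d)) (c : ℝ) (y : EuclideanSpace ℝ (Fin d))
    (ρ : ℝ) : IsOpen (upperHalfBall n c y ρ) :=
  Metric.isOpen_ball.inter (isOpen_lt continuous_const (by fun_prop))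

theorem norm_inv_norm_smul_le {E : Type*} [NormedAddCommGroup E] [NormedSpace ℝ E] (x : E) :
    ‖‖x‖⁻¹ • x‖ ≤ 1 := by
  rw [norm_smul, norm_inv, norm_norm]
  exact inv_mul_le_one

theorem measurable_inv_norm_smul :
    Measurable fun x : EuclideanSpace ℝ (Fin d) => ‖x‖⁻¹ • x :=
  measurable_norm.inv.smul measurable_id

theorem integrableOn_inner_inv_norm_smul (w : EuclideanSpace ℝ (Fin d)) (ε : ℝ) :
    IntegrableOn (fun x : EuclideanSpace ℝ (Fin d) => ⟪‖x‖⁻¹ • x, w⟫) (Metric.ball 0 ε) := by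
  refine Measure.integrableOn_of_bounded (M := ‖w‖) measure_ball_lt_top.ne ?_ ?_
  · exact (measurable_inv_norm_smul.inner measurable_const).aestronglyMeasurable
  · refine Eventually.of_forall fun x => (norm_inner_le_norm _ _).trans ?_
    exact mul_le_of_le_one_left (norm_nonneg _) (norm_inv_norm_smul_le x)

/-- The integral over a half ball of the radial unit vector is normal to the flat side. -/
theorem setIntegral_lowerHalfBall_radial (hn : ‖n‖ = 1) (w : EuclideanSpace ℝ (Fin d)) (ε : ℝ) :
    ∫ x in lowerHalfBall n 0 0 ε, ⟪‖x‖⁻¹ • x, w⟫ =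
      ⟪n, w⟫ * ∫ x in lowerHalfBall n 0 0 ε, ⟪‖x‖⁻¹ • x, n⟫ := by
  have hint : ∀ w : EuclideanSpace ℝ (Fin d),
      IntegrableOn (fun x : EuclideanSpace ℝ (Fin d) => ⟪‖x‖⁻¹ • x, w⟫) (lowerHalfBall n 0 0 ε) :=
    fun w => (integrableOn_inner_inv_norm_smul w ε).mono_set inter_subset_left
  -- The reflection across the line of `n` preserves the half ball and the norm, and `w + R w = 2
  -- ⟪n, w⟫ n`.
  let R := (ℝ ∙ n).reflection
  have hR : ∀ x, R x = 2 • (⟪n, x⟫ • n) - x := fun x => by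
    simp only [R]
    rw [Submodule.reflection_apply, Submodule.starProjection_unit_singleton ℝ hn]
  have hRn : ∀ x, ⟪n, R x⟫ = ⟪n, x⟫ := fun x => by
    rw [hR, inner_sub_right, two_smul, inner_add_right, inner_smul_right,
      real_inner_self_eq_norm_sq,
      hn]
    ring
  have hpre : R ⁻¹' lowerHalfBall n 0 0 ε = lowerHalfBall n 0 0 ε := by
    ext x
    simp [lowerHalfBall, hRn]
  have h1 : ∫ x in lowerHalfBall n 0 0 ε, ⟪‖x‖⁻¹ • x, R w⟫ =
      ∫ x in lowerHalfBall n 0 0 ε, ⟪‖x‖⁻¹ • x, w⟫ := by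
    have := R.measurePreserving.setIntegral_preimage_emb R.toHomeomorph.measurableEmbedding
      (fun x => ⟪‖x‖⁻¹ • x, R w⟫) (lowerHalfBall n 0 0 ε)
    rw [hpre] at this
    rw [← this]
    refine integral_congr_ae (Eventually.of_forall fun x => ?_)
    simp only [LinearIsometryEquiv.norm_map, inner_smul_left, LinearIsometryEquiv.inner_map_map]
  have h2 : ∫ x in lowerHalfBall n 0 0 ε, ⟪‖x‖⁻¹ • x, w + R w⟫ =
      ∫ x in lowerHalfBall n 0 0 ε, (2 * ⟪n, w⟫) * ⟪‖x‖⁻¹ • x, n⟫ := by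
    refine integral_congr_ae (Eventually.of_forall fun x => ?_)
    simp only
    rw [hR, add_sub_cancel, two_smul, inner_add_right, inner_smul_right]
    ring
  simp_rw [inner_add_right] at h2
  rw [integral_add (hint w) (hint (R w)), h1, integral_const_mul] at h2
  linarith

/-- Only a positive multiple of the volume is needed. On the ball of radius `ε / 4` centred at `-(ε
/ 2) n` the integrand is at least `1 / 4`, and this ball has `(1 / 4) ^ d` of the volume. -/
theorem mul_volume_ball_le_setIntegral_radial (hn : ‖n‖ = 1) {ε : ℝ} (hε : 0 < ε) :
    (1 / 4) ^ (d + 1) * volume.real (Metric.ball (0 : EuclideanSpace ℝ (Fin d)) ε) ≤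
      - ∫ x in lowerHalfBall n 0 0 ε, ⟪‖x‖⁻¹ • x, n⟫ := by
  have hnn : ⟪n, n⟫ = 1 := by rw [real_inner_self_eq_norm_sq, hn, one_pow]
  have hsub : Metric.ball (-(ε / 2) • n) (ε / 4) ⊆ {x | ⟪n, x⟫ ≤ -(ε / 4) ∧ ‖x‖ < ε} := by
    intro x hx
    rw [Metric.mem_ball, dist_eq_norm] at hx
    have h1 : ⟪n, x - -(ε / 2) • n⟫ ≤ ε / 4 :=
      (real_inner_le_norm _ _).trans (by rw [hn, one_mul]; exact hx.le)
    rw [inner_sub_right, inner_smul_right, hnn] at h1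
    have h2 : ‖x‖ ≤ ‖x - -(ε / 2) • n‖ + ‖-(ε / 2) • n‖ := norm_le_norm_sub_add _ _
    rw [norm_smul, hn, norm_neg, Real.norm_of_nonneg (by linarith)] at h2
    exact ⟨by linarith, by linarith⟩
  have hsub' : Metric.ball (-(ε / 2) • n) (ε / 4) ⊆ lowerHalfBall n 0 0 ε := fun x hx =>
    ⟨by simpa using (hsub hx).2, by
      have := (hsub hx).1
      rw [mem_ofPred_eq]; linarith⟩
  rw [← integral_neg]
  have hint : IntegrableOn (fun x => -⟪‖x‖⁻¹ • x, n⟫) (lowerHalfBall n 0 0 ε) :=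
    ((integrableOn_inner_inv_norm_smul n ε).mono_set inter_subset_left).neg
  have hvol : volume.real (Metric.ball (-(ε / 2) • n) (ε / 4)) =
      (1 / 4) ^ d * volume.real (Metric.ball (0 : EuclideanSpace ℝ (Fin d)) ε) := by
    have := Measure.addHaar_ball_mul_of_pos (volume : Measure (EuclideanSpace ℝ (Fin d)))
      (-(ε / 2) • n) (show (0 : ℝ) < 1 / 4 by norm_num) ε
    rw [finrank_euclideanSpace_fin, one_div_mul_eq_div] at this
    rw [measureReal_def, this, ENNReal.toReal_mul, ENNReal.toReal_ofReal (by positivity),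
      measureReal_def]
  calc (1 / 4) ^ (d + 1) * volume.real (Metric.ball (0 : EuclideanSpace ℝ (Fin d)) ε)
      = ∫ x in Metric.ball (-(ε / 2) • n) (ε / 4), (1 / 4 : ℝ) := by
        rw [setIntegral_const, smul_eq_mul, hvol]; ring
    _ ≤ ∫ x in Metric.ball (-(ε / 2) • n) (ε / 4), -⟪‖x‖⁻¹ • x, n⟫ := by
        refine setIntegral_mono_on (integrableOn_const measure_ball_lt_top.ne)
          (hint.mono_set hsub') measurableSet_ball fun x hx => ?_
        obtain ⟨h1, h2⟩ := hsub hx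
        rw [inner_smul_left, real_inner_comm]
        have hx0 : 0 < ‖x‖ := by
          rw [norm_pos_iff]; rintro rfl
          simp at h1; linarith
        simp only [conj_trivial]
        rw [← mul_neg, inv_mul_eq_div, le_div_iff₀ hx0]
        linarith
    _ ≤ ∫ x in lowerHalfBall n 0 0 ε, -⟪‖x‖⁻¹ • x, n⟫ := by
        refine setIntegral_mono_set hint ?_ (LE.le.eventuallyLE hsub')
        filter_upwards [ae_restrict_mem (isOpen_lowerHalfBall n 0 0 ε).measurableSet] with x hx
        have := hx.2
        rw [mem_ofPred_eq] at this
        rw [Pi.zero_apply, inner_smul_left, real_inner_comm, ← mul_neg]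
        exact mul_nonneg (by simp) (by linarith)

theorem setIntegral_lowerHalfBall_translate (hy : ⟪n, y⟫ = c) (w : EuclideanSpace ℝ (Fin d))
    (ε : ℝ) : ∫ x in lowerHalfBall n c y ε, ⟪‖x - y‖⁻¹ • (x - y), w⟫ =
      ∫ x in lowerHalfBall n 0 0 ε, ⟪‖x‖⁻¹ • x, w⟫ := by
  have := (measurePreserving_sub_right volume y).setIntegral_preimage_emb
    (MeasurableEquiv.subRight y).measurableEmbedding (fun x => ⟪‖x‖⁻¹ • x, w⟫)
    (lowerHalfBall n 0 0 ε)
  rw [← this]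
  congr 2
  ext x
  simp [lowerHalfBall, inner_sub_right, hy, dist_eq_norm]

/-- The point reflection through `y` exchanges the two half balls and changes the sign of the radial
vector. -/
theorem setIntegral_upperHalfBall_translate (hy : ⟪n, y⟫ = c) (w : EuclideanSpace ℝ (Fin d))
    (ε : ℝ) : ∫ x in upperHalfBall n c y ε, ⟪‖x - y‖⁻¹ • (x - y), w⟫ =
      - ∫ x in lowerHalfBall n 0 0 ε, ⟪‖x‖⁻¹ • x, w⟫ := by
  have := (Measure.measurePreserving_sub_left volume y).setIntegral_preimage_emb
    (MeasurableEquiv.subLeft y).measurableEmbedding (fun x => ⟪‖x‖⁻¹ • x, w⟫)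
    (lowerHalfBall n 0 0 ε)
  rw [← this, ← integral_neg]
  have hs : upperHalfBall n c y ε = (fun x => y - x) ⁻¹' lowerHalfBall n 0 0 ε := by
    ext x
    simp [lowerHalfBall, upperHalfBall, inner_sub_right, hy, dist_eq_norm, norm_sub_rev]
  rw [hs]
  refine integral_congr_ae (Eventually.of_forall fun x => ?_)
  simp only
  rw [← inner_neg_left, ← smul_neg, neg_sub, norm_sub_rev]

/-- The tent function of radius `ε` centred at `y`. -/
noncomputable def tent (y : EuclideanSpace ℝ (Fin d)) (ε : ℝ) (x : EuclideanSpace ℝ (Fin d)) : ℝ :=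
  max (ε - ‖x - y‖) 0

theorem lipschitzWith_tent (y : EuclideanSpace ℝ (Fin d)) (ε : ℝ) : LipschitzWith 1 (tent y ε) := by
  refine LipschitzWith.max_const ?_ 0
  refine LipschitzWith.of_dist_le_mul fun x z => ?_
  rw [Real.dist_eq, sub_sub_sub_cancel_left, NNReal.coe_one, one_mul, dist_comm, dist_eq_norm]
  refine (abs_norm_sub_norm_le _ _).trans ?_
  rw [sub_sub_sub_cancel_right]

theorem tsupport_tent_subset (y : EuclideanSpace ℝ (Fin d)) (ε : ℝ) :
    tsupport (tent y ε) ⊆ Metric.closedBall y ε := by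
  refine closure_minimal (fun x hx => ?_) Metric.isClosed_closedBall
  by_contra h
  rw [Metric.mem_closedBall, dist_eq_norm, not_le] at h
  exact hx (max_eq_right (by linarith))

theorem fderiv_tent_of_mem_ball {ε : ℝ} {x : EuclideanSpace ℝ (Fin d)} (hx : x ∈ Metric.ball y ε)
    (hxy : x ≠ y) (w : EuclideanSpace ℝ (Fin d)) :
    fderiv ℝ (tent y ε) x w = -⟪‖x - y‖⁻¹ • (x - y), w⟫ := by
  have h0 : x - y ≠ 0 := sub_ne_zero.mpr hxy
  have hev : tent y ε =ᶠ[𝓝 x] fun z => ε - ‖z - y‖ := by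
    filter_upwards [Metric.isOpen_ball.mem_nhds hx] with z hz
    rw [Metric.mem_ball, dist_eq_norm] at hz
    exact max_eq_left (by linarith)
  have h1 : HasFDerivAt (fun z : EuclideanSpace ℝ (Fin d) => ‖z - y‖)
      (‖x - y‖⁻¹ • innerSL ℝ (x - y)) x := by
    have h2 : HasFDerivAt (fun z : EuclideanSpace ℝ (Fin d) => ‖z - y‖ ^ 2)
        (2 • (innerSL ℝ (x - y)).comp (ContinuousLinearMap.id ℝ _)) x :=
      ((hasFDerivAt_id x).sub_const y).norm_sq
    have h3 := h2.sqrt (by positivity)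
    simp only [Real.sqrt_sq (norm_nonneg _)] at h3
    have h4 : ‖x - y‖⁻¹ • innerSL ℝ (x - y) = (1 / (2 * ‖x - y‖)) •
        (2 • (innerSL ℝ (x - y)).comp (ContinuousLinearMap.id ℝ (EuclideanSpace ℝ (Fin d)))) := by
      rw [ContinuousLinearMap.comp_id, ← Nat.cast_smul_eq_nsmul ℝ, smul_smul]
      congr 1
      have : ‖x - y‖ ≠ 0 := norm_ne_zero_iff.mpr h0
      field_simp
      norm_num
    rw [h4]
    exact h3
  have h3 := (h1.const_sub ε).congr_of_eventuallyEq hev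
  rw [h3.fderiv]
  rw [neg_apply, smul_apply, innerSL_apply_apply,
    real_inner_smul_left, smul_eq_mul]

theorem fderiv_tent_of_notMem {ε : ℝ} {x : EuclideanSpace ℝ (Fin d)}
    (hx : x ∉ Metric.closedBall y ε) : fderiv ℝ (tent y ε) x = 0 := by
  have hev : tent y ε =ᶠ[𝓝 x] fun z => 0 := by
    filter_upwards [Metric.isClosed_closedBall.isOpen_compl.mem_nhds hx] with z hz
    by_contra h
    exact hz (tsupport_tent_subset y ε (subset_tsupport _ h))
  rw [hev.fderiv_eq]
  simp

theorem abs_setIntegral_radial_sub_le {P : EuclideanSpace ℝ (Fin d) → EuclideanSpace ℝ (Fin d)}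
    (hP : Continuous P) {η ε : ℝ} {s : Set (EuclideanSpace ℝ (Fin d))} (hs : MeasurableSet s)
    (hsB : s ⊆ Metric.ball y ε) (h : ∀ x ∈ Metric.ball y ε, ‖P x - P y‖ ≤ η) :
    IntegrableOn (fun x => ⟪‖x - y‖⁻¹ • (x - y), P x⟫) s ∧
    |(∫ x in s, ⟪‖x - y‖⁻¹ • (x - y), P x⟫) - ∫ x in s, ⟪‖x - y‖⁻¹ • (x - y), P y⟫| ≤
      η * volume.real (Metric.ball y ε) := by
  have hfin : volume s ≠ ⊤ := ((measure_mono hsB).trans_lt measure_ball_lt_top).ne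
  have hm : Measurable fun x : EuclideanSpace ℝ (Fin d) => ‖x - y‖⁻¹ • (x - y) :=
    measurable_inv_norm_smul.comp (measurable_id.sub_const y)
  have hle : ∀ x w : EuclideanSpace ℝ (Fin d), ‖⟪‖x - y‖⁻¹ • (x - y), w⟫‖ ≤ ‖w‖ := fun x w =>
    (norm_inner_le_norm _ _).trans
      (mul_le_of_le_one_left (norm_nonneg _) (norm_inv_norm_smul_le _))
  have i1 : IntegrableOn (fun x => ⟪‖x - y‖⁻¹ • (x - y), P x⟫) s := by
    refine Measure.integrableOn_of_bounded (M := ‖P y‖ + η) hfin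
      (hm.inner hP.measurable).aestronglyMeasurable ?_
    filter_upwards [ae_restrict_mem hs] with x hx
    refine (hle _ _).trans ?_
    have := h x (hsB hx)
    linarith [norm_le_norm_add_norm_sub (P y) (P x), norm_sub_rev (P x) (P y)]
  have i2 : IntegrableOn (fun x => ⟪‖x - y‖⁻¹ • (x - y), P y⟫) s :=
    Measure.integrableOn_of_bounded (M := ‖P y‖) hfin
      (hm.inner measurable_const).aestronglyMeasurable (Eventually.of_forall fun x => hle _ _)
  refine ⟨i1, ?_⟩
  rcases s.eq_empty_or_nonempty with rfl | ⟨z, hz⟩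
  · rcases (Metric.ball y ε).eq_empty_or_nonempty with h0 | ⟨z, hz⟩
    · simp [h0]
    · have := (norm_nonneg _).trans (h z hz)
      simp only [Measure.restrict_empty, integral_zero_measure, sub_self, abs_zero]
      positivity
  have hη : 0 ≤ η := (norm_nonneg _).trans (h z (hsB hz))
  rw [← integral_sub i1 i2]
  have := norm_setIntegral_le_of_norm_le_const (μ := volume) (s := s) (C := η)
    (f := fun x => ⟪‖x - y‖⁻¹ • (x - y), P x⟫ - ⟪‖x - y‖⁻¹ • (x - y), P y⟫) hfin.lt_top
    (fun x hx => by
      rw [← inner_sub_right]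
      exact (hle _ _).trans (h x (hsB hx)))
  refine this.trans ?_
  exact mul_le_mul_of_nonneg_left (measureReal_mono hsB measure_ball_lt_top.ne) hη

/-- Test the divergence with the tent of radius `ε`, whose gradient is the inward unit radial field.
With `P` and `Q` frozen at `y`, the left-hand side is the jump of the normal component times an
integral comparable to the volume of the ball. The freezing errors, and the right-hand side (since
the tent is at most `ε`), are negligible with respect to this volume. -/
theorem inner_eq_inner_of_isWeakDiv (hdiv : IsWeakDiv Ω V g) (hΩ : IsOpen Ω)
    (hV : IntegrableOn V Ω) (hg : IntegrableOn g Ω) {Γ : ℝ}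
    (hgΓ : ∀ᵐ x ∂volume.restrict Ω, |g x| ≤ Γ) (hn : ‖n‖ = 1) (hy : ⟪n, y⟫ = c) {ρ : ℝ}
    (hρ : 0 < ρ) (hρΩ : Metric.ball y ρ ⊆ Ω)
    {P Q : EuclideanSpace ℝ (Fin d) → EuclideanSpace ℝ (Fin d)} (hP : Continuous P)
    (hQ : Continuous Q) (hVP : ∀ x ∈ lowerHalfBall n c y ρ, V x = P x)
    (hVQ : ∀ x ∈ upperHalfBall n c y ρ, V x = Q x) : ⟪n, P y⟫ = ⟪n, Q y⟫ := by
  have hn0 : n ≠ 0 := norm_ne_zero_iff.mp (by rw [hn]; exact one_ne_zero)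
  suffices H : ∀ η > 0, |⟪n, P y⟫ - ⟪n, Q y⟫| * (1 / 4) ^ (d + 1) ≤ η by
    have h1 : |⟪n, P y⟫ - ⟪n, Q y⟫| * (1 / 4) ^ (d + 1) ≤ 0 :=
      le_of_forall_pos_le_add fun η hη => by simpa using H η hη
    have h2 : |⟪n, P y⟫ - ⟪n, Q y⟫| ≤ 0 := by
      by_contra h
      exact absurd h1 (not_le.mpr (mul_pos (not_le.mp h) (by positivity)))
    exact sub_eq_zero.mp (abs_nonpos_iff.mp h2)
  intro η hη
  have hΓ' : 0 ≤ |Γ| := abs_nonneg _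
  -- the radius of the test function
  obtain ⟨ε, hε, hερ, hεΓ, hεP, hεQ⟩ : ∃ ε > 0, ε < ρ ∧ |Γ| * ε ≤ η / 3 ∧
      (∀ x ∈ Metric.ball y ε, ‖P x - P y‖ ≤ η / 3) ∧
      (∀ x ∈ Metric.ball y ε, ‖Q x - Q y‖ ≤ η / 3) := by
    obtain ⟨ε₁, h1, h1'⟩ := Metric.continuousAt_iff.mp hP.continuousAt (η / 3) (by positivity)
    obtain ⟨ε₂, h2, h2'⟩ := Metric.continuousAt_iff.mp hQ.continuousAt (η / 3) (by positivity)
    refine ⟨min (min ε₁ ε₂) (min (ρ / 2) (η / 3 / (|Γ| + 1))), by positivity, ?_, ?_, ?_, ?_⟩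
    · exact ((min_le_right _ _).trans (min_le_left _ _)).trans_lt (by linarith)
    · calc |Γ| * _ ≤ (|Γ| + 1) * (η / 3 / (|Γ| + 1)) := by
            gcongr
            · linarith
            · exact (min_le_right _ _).trans (min_le_right _ _)
        _ = η / 3 := by field_simp
    · intro x hx
      rw [← dist_eq_norm]
      exact (h1' (lt_of_lt_of_le hx ((min_le_left _ _).trans (min_le_left _ _)))).le
    · intro x hx
      rw [← dist_eq_norm]
      exact (h2' (lt_of_lt_of_le hx ((min_le_left _ _).trans (min_le_right _ _)))).le
  have hcB : Metric.closedBall y ε ⊆ Ω := (Metric.closedBall_subset_ball hερ).trans hρΩ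
  have hB : Metric.ball y ε ⊆ Ω := Metric.ball_subset_closedBall.trans hcB
  have key := hdiv.setIntegral_fderiv_of_lipschitzWith hΩ hV hg (lipschitzWith_tent y ε)
    (IsCompact.of_isClosed_subset (isCompact_closedBall y ε) (isClosed_tsupport _)
      (tsupport_tent_subset y ε)) ((tsupport_tent_subset y ε).trans hcB)
  set b := volume.real (Metric.ball y ε) with hb
  have hb0 : 0 < b := ENNReal.toReal_pos (Metric.measure_ball_pos _ _ hε).ne' measure_ball_lt_top.ne
  -- the right-hand side is small
  have rhs : |∫ x in Ω, g x * tent y ε x| ≤ η / 3 * b := by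
    have h1 : ∫ x in Ω, g x * tent y ε x = ∫ x in Metric.ball y ε, g x * tent y ε x := by
      refine setIntegral_eq_of_subset_of_forall_sdiff_eq_zero hΩ.measurableSet hB fun x hx => ?_
      have : tent y ε x = 0 := by
        refine max_eq_right ?_
        have := hx.2
        rw [Metric.mem_ball, dist_eq_norm, not_lt] at this
        linarith
      rw [this, mul_zero]
    rw [h1]
    rw [← Real.norm_eq_abs, hb]
    refine norm_setIntegral_le_of_norm_le_const_ae (C := η / 3) measure_ball_lt_top ?_
    filter_upwards [ae_restrict_of_ae_restrict_of_subset hB hgΓ,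
      ae_restrict_mem measurableSet_ball] with x hx hxB
    have h2 : 0 ≤ tent y ε x := le_max_right _ _
    have h3 : tent y ε x ≤ ε := max_le (by linarith [norm_nonneg (x - y)]) hε.le
    rw [norm_mul, Real.norm_eq_abs, Real.norm_of_nonneg h2]
    refine le_trans ?_ hεΓ
    exact mul_le_mul (hx.trans (le_abs_self _)) h3 h2 hΓ'
  -- the left-hand side
  have lhs : ∫ x in Ω, fderiv ℝ (tent y ε) x (V x) =
      - (∫ x in lowerHalfBall n c y ε, ⟪‖x - y‖⁻¹ • (x - y), P x⟫) -
        ∫ x in upperHalfBall n c y ε, ⟪‖x - y‖⁻¹ • (x - y), Q x⟫ := by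
    have hdisj : Disjoint (lowerHalfBall n c y ε) (upperHalfBall n c y ε) := by
      rw [Set.disjoint_left]
      exact fun x h1 h2 => lt_asymm (show ⟪n, x⟫ < c from h1.2) h2.2
    have hml := (isOpen_lowerHalfBall n c y ε).measurableSet
    have hmu := (isOpen_upperHalfBall n c y ε).measurableSet
    have e1 : ∀ x ∈ lowerHalfBall n c y ε,
        fderiv ℝ (tent y ε) x (V x) = -⟪‖x - y‖⁻¹ • (x - y), P x⟫ := fun x hx => by
      rw [fderiv_tent_of_mem_ball hx.1, hVP x ⟨Metric.ball_subset_ball hερ.le hx.1, hx.2⟩]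
      rintro rfl
      exact (ne_of_lt hx.2) hy
    have e2 : ∀ x ∈ upperHalfBall n c y ε,
        fderiv ℝ (tent y ε) x (V x) = -⟪‖x - y‖⁻¹ • (x - y), Q x⟫ := fun x hx => by
      rw [fderiv_tent_of_mem_ball hx.1, hVQ x ⟨Metric.ball_subset_ball hερ.le hx.1, hx.2⟩]
      rintro rfl
      exact (ne_of_gt hx.2) hy
    have h1 : ∫ x in Ω, fderiv ℝ (tent y ε) x (V x) =
        ∫ x in lowerHalfBall n c y ε ∪ upperHalfBall n c y ε, fderiv ℝ (tent y ε) x (V x) := by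
      refine (setIntegral_eq_of_subset_of_ae_sdiff_eq_zero hΩ.measurableSet.nullMeasurableSet
        (union_subset (inter_subset_left.trans hB) (inter_subset_left.trans hB)) ?_)
      -- The gradient of the tent is controlled off the sphere and the hyperplane, both negligible.
      have hnull : volume (Metric.sphere y ε ∪ hyperplane n c) = 0 :=
        measure_union_null (Measure.addHaar_sphere_of_ne_zero volume y hε.ne')
          (volume_hyperplane hn0 c)
      filter_upwards [measure_eq_zero_iff_ae_notMem.mp hnull] with x hx hxΩ
      rw [mem_union, not_or] at hx
      have hxB : x ∉ Metric.closedBall y ε := by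
        intro hxB
        have hxb : x ∈ Metric.ball y ε := by
          rw [← Metric.ball_union_sphere] at hxB
          exact hxB.resolve_right hx.1
        rcases lt_or_gt_of_ne (show ⟪n, x⟫ ≠ c from hx.2) with h | h
        · exact hxΩ.2 (Or.inl ⟨hxb, h⟩)
        · exact hxΩ.2 (Or.inr ⟨hxb, h⟩)
      rw [fderiv_tent_of_notMem hxB]
      rfl
    rw [h1, setIntegral_union hdisj hmu, setIntegral_congr_fun hml e1, setIntegral_congr_fun hmu e2,
      integral_neg, integral_neg]
    · rfl
    · exact (abs_setIntegral_radial_sub_le hP hml inter_subset_left hεP).1.neg.congr_fun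
        (fun x hx => (e1 x hx).symm) hml
    · exact (abs_setIntegral_radial_sub_le hQ hmu inter_subset_left hεQ).1.neg.congr_fun
        (fun x hx => (e2 x hx).symm) hmu
  rw [lhs] at key
  have hl := (abs_setIntegral_radial_sub_le hP (isOpen_lowerHalfBall n c y ε).measurableSet
    inter_subset_left hεP).2
  have hu := (abs_setIntegral_radial_sub_le hQ (isOpen_upperHalfBall n c y ε).measurableSet
    inter_subset_left hεQ).2
  rw [setIntegral_lowerHalfBall_translate hy, setIntegral_lowerHalfBall_radial hn] at hl
  rw [setIntegral_upperHalfBall_translate hy, setIntegral_lowerHalfBall_radial hn] at hu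
  have hA := mul_volume_ball_le_setIntegral_radial hn hε
  have hb' : volume.real (Metric.ball (0 : EuclideanSpace ℝ (Fin d)) ε) = b := by
    rw [hb, Measure.addHaar_real_ball_center volume y]
  rw [hb'] at hA
  set A := ∫ x in lowerHalfBall n 0 0 ε, ⟪‖x‖⁻¹ • x, n⟫
  rw [abs_le] at hl hu rhs
  have h5 : |⟪n, P y⟫ - ⟪n, Q y⟫| * (-A) ≤ η * b := by
    rw [← abs_of_nonneg (show 0 ≤ -A from le_trans (by positivity) hA), ← abs_mul, abs_le]
    constructor <;> linarith [hl.1, hl.2, hu.1, hu.2, rhs.1, rhs.2]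
  have h6 : |⟪n, P y⟫ - ⟪n, Q y⟫| * ((1 / 4) ^ (d + 1) * b) ≤ η * b :=
    (mul_le_mul_of_nonneg_left hA (abs_nonneg _)).trans h5
  rw [← mul_assoc] at h6
  exact le_of_mul_le_mul_right h6 hb0

end NormalTrace

/-! ### Trajectories -/

section Trajectories

variable {d : ℕ} {Ω : Set (EuclideanSpace ℝ (Fin d))}

/-- The velocity `V / φ` of the characteristics, seen from the cell `K`. -/
noncomputable def velocity (φ : EuclideanSpace ℝ (Fin d) → ℝ)
    (V : EuclideanSpace ℝ (Fin d) → EuclideanSpace ℝ (Fin d)) (K : Set (EuclideanSpace ℝ (Fin d)))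
    (y : EuclideanSpace ℝ (Fin d)) : EuclideanSpace ℝ (Fin d) :=
  (extendFrom K φ y)⁻¹ • extendFrom K V y

/-- `γ` is a characteristic on the time interval `[a, b]`. -/
structure IsTraj (M : PolytopalMesh Ω) (φ : EuclideanSpace ℝ (Fin d) → ℝ)
    (V : EuclideanSpace ℝ (Fin d) → EuclideanSpace ℝ (Fin d)) (a b : ℝ)
    (γ : ℝ → EuclideanSpace ℝ (Fin d)) : Prop where
  mem : ∀ r ∈ Icc a b, γ r ∈ closure Ω
  lipschitz : ∃ L, LipschitzOnWith L γ (Icc a b)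
  hasDerivAt : ∃ N : Set ℝ, N.Countable ∧ ∀ r ∈ Ioo a b \ N, ∃ K ∈ M.cells, γ r ∈ closure K ∧
    HasDerivAt γ (velocity φ V K (γ r)) r

variable {M : PolytopalMesh Ω} {φ : EuclideanSpace ℝ (Fin d) → ℝ}
  {V : EuclideanSpace ℝ (Fin d) → EuclideanSpace ℝ (Fin d)} {φlow φhigh Γ : ℝ}
  {a b : ℝ} {γ : ℝ → EuclideanSpace ℝ (Fin d)}

theorem IsTraj.mono {a' b' : ℝ} (h : IsTraj M φ V a b γ) (ha : a ≤ a') (hb : b' ≤ b) :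
    IsTraj M φ V a' b' γ := by
  obtain ⟨L, hL⟩ := h.lipschitz
  obtain ⟨N, hN, hd⟩ := h.hasDerivAt
  exact ⟨fun r hr => h.mem r (Icc_subset_Icc ha hb hr), ⟨L, hL.mono (Icc_subset_Icc ha hb)⟩,
    N, hN, fun r hr => hd r ⟨Ioo_subset_Ioo ha hb hr.1, hr.2⟩⟩

theorem IsTraj.comp_add_const (h : IsTraj M φ V a b γ) (s : ℝ) :
    IsTraj M φ V (a - s) (b - s) fun r => γ (r + s) := by
  obtain ⟨L, hL⟩ := h.lipschitz
  obtain ⟨N, hN, hd⟩ := h.hasDerivAt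
  have hI : ∀ r ∈ Icc (a - s) (b - s), r + s ∈ Icc a b := fun r hr =>
    ⟨by linarith [hr.1], by linarith [hr.2]⟩
  refine ⟨fun r hr => h.mem _ (hI r hr), ⟨L, ?_⟩, (fun r => r + s) ⁻¹' N,
    hN.preimage (add_left_injective s), fun r hr => ?_⟩
  · refine LipschitzOnWith.of_dist_le_mul fun r hr t ht => ?_
    have := hL.dist_le_mul _ (hI r hr) _ (hI t ht)
    rwa [dist_add_right] at this
  · obtain ⟨K, hK, hm, hd'⟩ := hd (r + s) ⟨⟨by linarith [hr.1.1], by linarith [hr.1.2]⟩, hr.2⟩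
    exact ⟨K, hK, hm, hd'.comp_add_const r s⟩

theorem contDiff_eval_mvPolynomial (p : MvPolynomial (Fin d) ℝ) :
    ContDiff ℝ ∞ fun x : EuclideanSpace ℝ (Fin d) => MvPolynomial.eval (fun j => x j) p := by
  induction p using MvPolynomial.induction_on with
  | C a => simpa using contDiff_const
  | add p q hp hq => simpa using hp.add hq
  | mul_X p i hp => simpa using hp.mul (by fun_prop)

theorem FlowAssumptions.exists_extension (h : FlowAssumptions M φ V φlow φhigh Γ)
    {K : Set (EuclideanSpace ℝ (Fin d))} (hK : K ∈ M.cells) :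
    ∃ (f : EuclideanSpace ℝ (Fin d) → ℝ) (P : EuclideanSpace ℝ (Fin d) → EuclideanSpace ℝ (Fin d)),
      ContDiff ℝ ∞ f ∧ ContDiff ℝ ∞ P ∧ (∀ x ∈ K, φ x = f x ∧ V x = P x) ∧
      ∀ y ∈ closure K, extendFrom K φ y = f y ∧ extendFrom K V y = P y ∧
        φlow ≤ f y ∧ f y ≤ φhigh := by
  obtain ⟨f, hf, hφ⟩ := h.smooth K hK
  obtain ⟨p, hp⟩ := h.polynomial K hK
  let P : EuclideanSpace ℝ (Fin d) → EuclideanSpace ℝ (Fin d) := fun x =>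
    WithLp.toLp 2 fun i => MvPolynomial.eval (fun j => x j) (p i)
  have hP : ContDiff ℝ ∞ P := by
    rw [contDiff_euclidean]
    exact fun i => contDiff_eval_mvPolynomial (p i)
  have hVP : EqOn V P K := fun x hx => by
    ext i
    exact hp x hx i
  refine ⟨f, P, hf, hP, fun x hx => ⟨hφ hx, hVP hx⟩, fun y hy => ⟨?_, ?_, ?_⟩⟩
  · refine extendFrom_eq hy ?_
    exact (hf.continuous.tendsto y |>.mono_left nhdsWithin_le_nhds).congr'
      (by filter_upwards [self_mem_nhdsWithin] with x hx using (hφ hx).symm)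
  · refine extendFrom_eq hy ?_
    exact (hP.continuous.tendsto y |>.mono_left nhdsWithin_le_nhds).congr'
      (by filter_upwards [self_mem_nhdsWithin] with x hx using (hVP hx).symm)
  · have hcl : IsClosed {x | φlow ≤ f x ∧ f x ≤ φhigh} :=
      (isClosed_le continuous_const hf.continuous).inter
        (isClosed_le hf.continuous continuous_const)
    exact closure_minimal (fun x hx => by
      have := h.bounds K hK x hx
      rwa [hφ hx] at this) hcl hy

/-- The extension of `φ` may vanish far from `K`, so the quotient is regular only around the points
of `closure K`, where the lower bound persists. -/
theorem FlowAssumptions.exists_velocity_extension (h : FlowAssumptions M φ V φlow φhigh Γ)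
    {K : Set (EuclideanSpace ℝ (Fin d))} (hK : K ∈ M.cells) :
    ∃ X : EuclideanSpace ℝ (Fin d) → EuclideanSpace ℝ (Fin d),
      ∀ y ∈ closure K, velocity φ V K y = X y ∧ ContDiffAt ℝ 1 X y := by
  obtain ⟨f, P, hf, hP, -, hcl⟩ := h.exists_extension hK
  refine ⟨fun y => (f y)⁻¹ • P y, fun y hy => ⟨?_, ?_⟩⟩
  · rw [velocity, (hcl y hy).1, (hcl y hy).2.1]
  · have hfy : f y ≠ 0 := (h.φlow_pos.trans_le (hcl y hy).2.2.1).ne'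
    exact ((hf.contDiffAt.inv hfy).smul hP.contDiffAt).of_le (by simp)

theorem FlowAssumptions.exists_velocity_bound (h : FlowAssumptions M φ V φlow φhigh Γ) :
    ∃ v : NNReal, 0 < v ∧ ∀ K ∈ M.cells, ∀ y ∈ closure K, ‖velocity φ V K y‖ ≤ v := by
  have h1 : ∀ K ∈ M.cells, ∃ v : ℝ, ∀ y ∈ closure K, ‖velocity φ V K y‖ ≤ v := fun K hK => by
    obtain ⟨X, hX⟩ := h.exists_velocity_extension hK
    obtain ⟨v, hv⟩ := (M.isCompact_closure_cell hK).exists_bound_of_continuousOn (f := X)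
      fun y hy => (hX y hy).2.continuousAt.continuousWithinAt
    exact ⟨v, fun y hy => (hX y hy).1 ▸ hv y hy⟩
  choose! v hv using h1
  obtain ⟨w, hw⟩ := (M.finite_cells.image v).bddAbove
  -- The maximum with 1 makes the bound positive, as it will serve as a denominator for times.
  refine ⟨(max w 1).toNNReal, Real.toNNReal_pos.mpr (lt_max_of_lt_right one_pos),
    fun K hK y hy => ?_⟩
  exact (hv K hK y hy).trans ((hw (mem_image_of_mem v hK)).trans
    ((le_max_left _ _).trans (Real.le_coe_toNNReal _)))

theorem IsTraj.norm_sub_le {v : NNReal}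
    (hv : ∀ K ∈ M.cells, ∀ y ∈ closure K, ‖velocity φ V K y‖ ≤ v) (h : IsTraj M φ V a b γ)
    (hab : a ≤ b) : ‖γ b - γ a‖ ≤ v * (b - a) := by
  obtain ⟨L, hL⟩ := h.lipschitz
  obtain ⟨N, hN, hd⟩ := h.hasDerivAt
  have := norm_sub_le_of_hasDerivAt_off_countable (w := 0) v.2 hab hL hN fun t ht => by
    obtain ⟨K, hK, hm, hd'⟩ := hd t ht
    exact ⟨_, hd', by simpa using hv K hK _ hm⟩
  simpa using this

/-- The local flow of the trajectories is well-posed around `p`. -/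
def HasLocalFlow (M : PolytopalMesh Ω) (φ : EuclideanSpace ℝ (Fin d) → ℝ)
    (V : EuclideanSpace ℝ (Fin d) → EuclideanSpace ℝ (Fin d))
    (p : EuclideanSpace ℝ (Fin d)) : Prop :=
  ∃ ρ > 0, ∃ δ > 0, ∃ C : ℝ, Metric.ball p ρ ⊆ Ω ∧
    (∀ x ∈ Metric.ball p ρ, ∃ γ, IsTraj M φ V 0 δ γ ∧ γ 0 = x) ∧
    ∀ b γ₁ γ₂, 0 ≤ b → b ≤ δ → IsTraj M φ V 0 b γ₁ → IsTraj M φ V 0 b γ₂ →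
      γ₁ 0 ∈ Metric.ball p ρ → γ₂ 0 ∈ Metric.ball p ρ → ‖γ₁ b - γ₂ b‖ ≤ C * ‖γ₁ 0 - γ₂ 0‖

/-- In a ball where at most two fields are visible, separated by a hyperplane, mesh trajectories and
broken trajectories are the same curves. The estimates on broken trajectories then apply when the
fields agree or cross the hyperplane transversally. -/
theorem hasLocalFlow_of_fields {v : NNReal} (hv0 : 0 < v)
    (hv : ∀ K ∈ M.cells, ∀ y ∈ closure K, ‖velocity φ V K y‖ ≤ v)
    {p n : EuclideanSpace ℝ (Fin d)} {A c : ℝ} (hA : 0 < A) (hAΩ : Metric.closedBall p A ⊆ Ω)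
    {X Y : EuclideanSpace ℝ (Fin d) → EuclideanSpace ℝ (Fin d)} {k : NNReal}
    (hX : LipschitzOnWith k X (Metric.closedBall p A))
    (hY : LipschitzOnWith k Y (Metric.closedBall p A))
    (hcell : ∀ K ∈ M.cells, ∀ x ∈ Metric.closedBall p A, x ∈ closure K →
      (velocity φ V K x = X x ∧ ⟪n, x⟫ ≤ c) ∨ (velocity φ V K x = Y x ∧ c ≤ ⟪n, x⟫))
    (hlow : ∀ x ∈ Metric.closedBall p A, ⟪n, x⟫ ≤ c → ∃ K ∈ M.cells, x ∈ closure K ∧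
      velocity φ V K x = X x)
    (hup : ∀ x ∈ Metric.closedBall p A, c ≤ ⟪n, x⟫ → ∃ K ∈ M.cells, x ∈ closure K ∧
      velocity φ V K x = Y x)
    (hXY : EqOn X Y (Metric.closedBall p A) ∨ (‖n‖ = 1 ∧ ∃ c₀ > 0, ∀ x ∈ Metric.closedBall p A,
      ‖X x‖ ≤ v ∧ ‖Y x‖ ≤ v ∧ c₀ ≤ ⟪n, X x⟫ ∧ c₀ ≤ ⟪n, Y x⟫)) :
    HasLocalFlow M φ V p := by
  have hv0' : (0 : ℝ) < v := hv0
  have toBroken : ∀ {b γ}, 0 ≤ b → b ≤ A / 4 / v → IsTraj M φ V 0 b γ →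
      γ 0 ∈ Metric.ball p (A / 2) → BrokenTraj X Y n c (Metric.closedBall p A) 0 b γ := by
    intro b γ hb0 hb hγ h0
    have hmem : ∀ r ∈ Icc 0 b, γ r ∈ Metric.closedBall p A := fun r hr => by
      have h1 := (hγ.mono le_rfl hr.2).norm_sub_le hv hr.1
      have h2 : (v : ℝ) * (r - 0) ≤ A / 4 := by
        rw [sub_zero, mul_comm, ← le_div_iff₀ hv0']
        exact hr.2.trans hb
      rw [← dist_eq_norm] at h1
      rw [Metric.mem_ball] at h0
      rw [Metric.mem_closedBall]
      linarith [dist_triangle (γ r) (γ 0) p]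
    obtain ⟨N, hN, hd⟩ := hγ.hasDerivAt
    refine ⟨hγ.lipschitz, hmem, N, hN, fun r hr => ?_⟩
    obtain ⟨K, hK, hm, hd'⟩ := hd r hr
    rcases hcell K hK _ (hmem r (Ioo_subset_Icc_self hr.1)) hm with ⟨h1, h2⟩ | ⟨h1, h2⟩
    · exact Or.inl ⟨h1 ▸ hd', h2⟩
    · exact Or.inr ⟨h1 ▸ hd', h2⟩
  have ofBroken : ∀ {b γ}, BrokenTraj X Y n c (Metric.closedBall p A) 0 b γ →
      IsTraj M φ V 0 b γ := by
    intro b γ hγ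
    obtain ⟨N, hN, hd⟩ := hγ.hasDerivAt
    refine ⟨fun r hr => subset_closure (hAΩ (hγ.mem r hr)), hγ.lipschitz, N, hN, fun r hr => ?_⟩
    have hm := hγ.mem r (Ioo_subset_Icc_self hr.1)
    rcases hd r hr with ⟨h1, h2⟩ | ⟨h1, h2⟩
    · obtain ⟨K, hK, hm', he⟩ := hlow _ hm h2
      exact ⟨K, hK, hm', he ▸ h1⟩
    · obtain ⟨K, hK, hm', he⟩ := hup _ hm h2
      exact ⟨K, hK, hm', he ▸ h1⟩
  -- In this time a trajectory moves by at most `A / 4`. Starting within `A / 2` of `p`, it stays in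
  -- the ball of radius `A`, even with the doubled margin required by the construction across a
  -- hyperplane.
  have hδ : 0 < A / 4 / v := by positivity
  have hvδ : v * (A / 4 / v) = A / 4 := by field_simp
  have hball : ∀ x, x ∈ Metric.ball p (A / 2) → x ∈ Metric.closedBall p (A / 2) := fun x hx =>
    Metric.ball_subset_closedBall hx
  have hΩ : Metric.ball p (A / 2) ⊆ Ω :=
    ((Metric.ball_subset_ball (by linarith)).trans Metric.ball_subset_closedBall).trans hAΩ
  have hk : ∀ b ≤ A / 4 / v, (k : ℝ) * (b - 0) ≤ k * (A / 4 / v) := fun b hb => by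
    rw [sub_zero]; exact mul_le_mul_of_nonneg_left hb k.2
  rcases hXY with hXY | ⟨hn, c₀, hc₀, hc⟩
  · have hvX : ∀ y ∈ Metric.closedBall p A, ‖X y‖ ≤ v := fun y hy => by
      rcases le_total ⟪n, y⟫ c with h | h
      · obtain ⟨K, hK, hm, he⟩ := hlow y hy h
        exact he ▸ hv K hK y hm
      · obtain ⟨K, hK, hm, he⟩ := hup y hy h
        rw [hXY hy]
        exact he ▸ hv K hK y hm
    refine ⟨A / 2, by positivity, A / 4 / v, hδ, Real.exp (k * (A / 4 / v)), hΩ, ?_, ?_⟩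
    · intro x hx
      obtain ⟨α, h0, hα⟩ := exists_brokenTraj_of_eqOn (n := n) (c := c) hX hXY hvX
        (by positivity) hδ.le (by rw [hvδ]; linarith) (hball x hx)
      exact ⟨α, ofBroken hα, h0⟩
    · intro b γ₁ γ₂ hb0 hb h₁ h₂ h01 h02
      refine ((toBroken hb0 hb h₁ h01).dist_le_of_eqOn hX hXY hb0
        (toBroken hb0 hb h₂ h02)).trans ?_
      rw [mul_comm]
      exact mul_le_mul_of_nonneg_right (Real.exp_le_exp.mpr (hk b hb)) (norm_nonneg _)
  · refine ⟨A / 2, by positivity, A / 4 / v, hδ,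
      (1 + 2 * v / c₀) * Real.exp ((1 + 2 * v / c₀) * (k * (A / 4 / v))), hΩ, ?_, ?_⟩
    · intro x hx
      obtain ⟨α, h0, hα⟩ := exists_brokenTraj_of_transversal (n := n) (c := c) hX hY
        (fun y hy => (hc y hy).1) (fun y hy => (hc y hy).2.1)
        (fun y hy => hc₀.trans_le (hc y hy).2.2.1) (fun y hy => hc₀.trans_le (hc y hy).2.2.2)
        (by positivity) hδ.le (by rw [hvδ]; linarith) (hball x hx)
      exact ⟨α, ofBroken hα, h0⟩
    · intro b γ₁ γ₂ hb0 hb h₁ h₂ h01 h02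
      have hJ : ∀ x ∈ Metric.closedBall p A, ‖X x - Y x‖ ≤ 2 * v := fun x hx => by
        have := norm_sub_le (X x) (Y x)
        linarith [(hc x hx).1, (hc x hx).2.1]
      refine ((toBroken hb0 hb h₁ h01).dist_le_of_transversal hc₀ (by positivity) hn hX hY hJ
        (fun y hy => (hc y hy).2.2.1) (fun y hy => (hc y hy).2.2.2) hb0
        (toBroken hb0 hb h₂ h02)).trans ?_
      have he : (1 + 2 * v / c₀) * k * (b - 0) ≤ (1 + 2 * v / c₀) * (k * (A / 4 / v)) := by
        rw [mul_assoc]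
        exact mul_le_mul_of_nonneg_left (hk b hb) (by positivity)
      calc _ ≤ (1 + 2 * v / c₀) * ‖γ₁ 0 - γ₂ 0‖ *
            Real.exp ((1 + 2 * v / c₀) * (k * (A / 4 / v))) := by
            exact mul_le_mul_of_nonneg_left (Real.exp_le_exp.mpr he) (by positivity)
        _ = _ := by ring

theorem FlowAssumptions.hasLocalFlow_of_mem_cell (h : FlowAssumptions M φ V φlow φhigh Γ)
    {K : Set (EuclideanSpace ℝ (Fin d))} (hK : K ∈ M.cells) {p : EuclideanSpace ℝ (Fin d)}
    (hp : p ∈ K) : HasLocalFlow M φ V p := by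
  obtain ⟨v, hv0, hv⟩ := h.exists_velocity_bound
  obtain ⟨X, hX⟩ := h.exists_velocity_extension hK
  obtain ⟨k, s, hs, hk⟩ := (hX p (subset_closure hp)).2.exists_lipschitzOnWith
  obtain ⟨A, hA, hAs⟩ := Metric.nhds_basis_closedBall.mem_iff.mp
    (inter_mem hs ((M.isOpen_cell K hK).mem_nhds hp))
  -- With `n = 0` and `c = 0` both closed half-spaces are the whole space: there is no interface.
  refine hasLocalFlow_of_fields (n := 0) (c := 0) (X := X) (Y := X) hv0 hv hA
    (fun x hx => M.cell_subset K hK (hAs hx).2) (hk.mono fun x hx => (hAs hx).1)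
    (hk.mono fun x hx => (hAs hx).1) ?_ ?_ ?_ (Or.inl fun x _ => rfl)
  · intro K' hK' x hx hxK'
    have hKK : K' = K := by
      by_contra hne
      obtain ⟨z, hz1, hz2⟩ := mem_closure_iff.mp hxK' K (M.isOpen_cell K hK) (hAs hx).2
      exact Set.disjoint_left.mp (M.disjoint_cells hK' hK hne) hz2 hz1
    subst hKK
    exact Or.inl ⟨(hX x hxK').1, by simp⟩
  · exact fun x hx _ => ⟨K, hK, subset_closure (hAs hx).2, (hX x (subset_closure (hAs hx).2)).1⟩
  · exact fun x hx _ => ⟨K, hK, subset_closure (hAs hx).2, (hX x (subset_closure (hAs hx).2)).1⟩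

end Trajectories

/-! ### Regular points and local well-posedness of the trajectories -/

section RegularPoints

variable {d : ℕ} {Ω : Set (EuclideanSpace ℝ (Fin d))}
  {M : PolytopalMesh Ω} {φ : EuclideanSpace ℝ (Fin d) → ℝ}
  {V : EuclideanSpace ℝ (Fin d) → EuclideanSpace ℝ (Fin d)} {φlow φhigh Γ : ℝ}
  {σ K L : Set (EuclideanSpace ℝ (Fin d))} {n y : EuclideanSpace ℝ (Fin d)}

theorem FlowAssumptions.integrableOn_velocity (h : FlowAssumptions M φ V φlow φhigh Γ) :
    IntegrableOn V Ω := by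
  have : IsFiniteMeasure (volume.restrict Ω) :=
    ⟨by simpa using M.isBounded_domain.measure_lt_top⟩
  exact h.memLp.integrable one_le_two

theorem FlowAssumptions.exists_div (h : FlowAssumptions M φ V φlow φhigh Γ) :
    ∃ g : EuclideanSpace ℝ (Fin d) → ℝ, IntegrableOn g Ω ∧ IsWeakDiv Ω V g ∧
      ∀ᵐ x ∂volume.restrict Ω, |g x| ≤ Γ := by
  have : IsFiniteMeasure (volume.restrict Ω) :=
    ⟨by simpa using M.isBounded_domain.measure_lt_top⟩
  obtain ⟨g, hg, hw, hb⟩ := h.hdiv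
  exact ⟨g, hg.integrable one_le_two, hw, hb⟩

/-- The two cells on the two sides of an interface, around a point of this interface. -/
theorem PolytopalMesh.exists_two_sided_ball (M : PolytopalMesh Ω) (hσ : σ ∈ M.faces) (hσΩ : σ ⊆ Ω)
    (hn : IsUnitNormal σ n) (hy : y ∈ σ) (hyb : y ∉ M.skeleton) :
    ∃ c, σ ⊆ hyperplane n c ∧ ∃ ρ > 0, Metric.ball y ρ ⊆ Ω ∧ Metric.ball y ρ ∩ hyperplane n c ⊆ σ ∧
      ∃ K ∈ M.cells, ∃ L ∈ M.cells, lowerHalfBall n c y ρ ⊆ K ∧ upperHalfBall n c y ρ ⊆ L ∧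
        σ ⊆ frontier K ∧ σ ⊆ frontier L ∧ Disjoint K L ∧
        (∀ K' ∈ M.cells, (closure K' ∩ Metric.ball y ρ).Nonempty → K' = K ∨ K' = L) ∧
        ∀ K' ∈ M.cells, σ ⊆ frontier K' → K' = K ∨ K' = L := by
  obtain ⟨c, hc⟩ := hn.2
  obtain ⟨ρ, hρ, hρσ, hloc⟩ := M.exists_ball_at_face hσ hn hc hy hyb
  obtain ⟨ρ', hρ', hρΩ⟩ := Metric.mem_nhds_iff.mp (M.isOpen_domain.mem_nhds (hσΩ hy))
  have hcard : {K ∈ M.cells | σ ⊆ frontier K}.ncard = 2 := by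
    rcases M.face_cells σ hσ with h | h
    · exact h.2
    · have h1 := h.1 hy
      rw [M.isOpen_domain.frontier_eq] at h1
      exact absurd (hσΩ hy) h1.2
  obtain ⟨K, L, hKL, hset⟩ := ncard_eq_two.mp hcard
  have hK : K ∈ {K ∈ M.cells | σ ⊆ frontier K} := hset ▸ mem_insert _ _
  have hL : L ∈ {K ∈ M.cells | σ ⊆ frontier K} := hset ▸ mem_insert_of_mem _ rfl
  have hall : ∀ K' ∈ M.cells, σ ⊆ frontier K' → K' = K ∨ K' = L := fun K' hK' hσK' =>
    M.eq_or_eq_of_face_subset hσ hK.1 hL.1 hKL hK.2 hL.2 hK' hσK'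
  have hle : min ρ ρ' ≤ ρ := min_le_left _ _
  have hball := Metric.ball_subset_ball (x := y) hle
  have hnear : ∀ K' ∈ M.cells, (closure K' ∩ Metric.ball y (min ρ ρ')).Nonempty →
      K' = K ∨ K' = L := fun K' hK' hne =>
    hall K' hK' (hloc K' hK' (hne.mono (inter_subset_inter_right _ hball))).1
  refine ⟨c, hc, min ρ ρ', lt_min hρ hρ',
    (Metric.ball_subset_ball (min_le_right _ _)).trans hρΩ,
    (inter_subset_inter_left _ hball).trans hρσ, ?_⟩
  rcases M.halfBall_subset_of_ne hK.1 hL.1 hKL hK.2 hL.2 hn.1 hρ hy hc hloc with h | h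
  · exact ⟨K, hK.1, L, hL.1, (inter_subset_inter_left _ hball).trans h.1,
      (inter_subset_inter_left _ hball).trans h.2, hK.2, hL.2, M.disjoint_cells hK.1 hL.1 hKL,
      hnear, hall⟩
  · refine ⟨L, hL.1, K, hK.1, (inter_subset_inter_left _ hball).trans h.1,
      (inter_subset_inter_left _ hball).trans h.2, hL.2, hK.2, M.disjoint_cells hL.1 hK.1 hKL.symm,
      fun K' hK' hne => (hnear K' hK' hne).symm, fun K' hK' hne => (hall K' hK' hne).symm⟩

theorem FlowAssumptions.inner_extendFrom_eq (h : FlowAssumptions M φ V φlow φhigh Γ)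
    (hσ : σ ∈ M.faces) (hσΩ : σ ⊆ Ω) (hn : IsUnitNormal σ n) (hy : y ∈ σ) (hyb : y ∉ M.skeleton)
    (hK : K ∈ M.cells) (hL : L ∈ M.cells) (hσK : σ ⊆ frontier K) (hσL : σ ⊆ frontier L) :
    ⟪n, extendFrom K V y⟫ = ⟪n, extendFrom L V y⟫ := by
  obtain ⟨c, hc, ρ, hρ, hρΩ, -, K₁, hK₁, L₁, hL₁, hlow, hup, hσK₁, hσL₁, -, -, hall⟩ :=
    M.exists_two_sided_ball hσ hσΩ hn hy hyb
  obtain ⟨g, hg, hdiv, hgΓ⟩ := h.exists_div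
  obtain ⟨f₁, P, -, hP, hVP, hP'⟩ := h.exists_extension hK₁
  obtain ⟨f₂, Q, -, hQ, hVQ, hQ'⟩ := h.exists_extension hL₁
  have key := inner_eq_inner_of_isWeakDiv hdiv M.isOpen_domain h.integrableOn_velocity hg hgΓ
    hn.1 (hc hy) hρ hρΩ hP.continuous hQ.continuous (fun x hx => (hVP x (hlow hx)).2)
    (fun x hx => (hVQ x (hup hx)).2)
  rw [← (hP' y (frontier_subset_closure (hσK₁ hy))).2.1,
    ← (hQ' y (frontier_subset_closure (hσL₁ hy))).2.1] at key
  rcases hall K hK hσK with rfl | rfl <;> rcases hall L hL hσL with rfl | rfl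
  · rfl
  · exact key
  · exact key.symm
  · rfl

/-- The points around which the trajectories form a flow: the points of the cells, and the points
of the interfaces, off the skeleton, that are crossed transversally. -/
def regularSet (M : PolytopalMesh Ω)
    (V : EuclideanSpace ℝ (Fin d) → EuclideanSpace ℝ (Fin d)) : Set (EuclideanSpace ℝ (Fin d)) :=
  M.cellUnion ∪ {y | ∃ σ ∈ M.faces, y ∈ σ ∧ y ∉ M.skeleton ∧ ∃ n, IsUnitNormal σ n ∧
    ∃ K ∈ M.cells, σ ⊆ frontier K ∧ ⟪n, extendFrom K V y⟫ ≠ 0}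

/-- The no-flow condition excludes faces on the boundary of `Ω`. -/
theorem FlowAssumptions.subset_domain_of_inner_ne (h : FlowAssumptions M φ V φlow φhigh Γ)
    (hσ : σ ∈ M.faces) (hy : y ∈ σ) (hn : IsUnitNormal σ n) (hK : K ∈ M.cells)
    (hσK : σ ⊆ frontier K) (hne : ⟪n, extendFrom K V y⟫ ≠ 0) : σ ⊆ Ω := by
  rcases M.face_cells σ hσ with h' | h'
  · exact h'.1
  · exact absurd (by rw [real_inner_comm]; exact h.no_flow σ hσ h'.1 n hn K hK hσK y hy) hne

/-- Seen from either cell, the velocity has a positive normal component, since it is the common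
value of `V · n` divided by a positive porosity. By continuity this persists in a small ball, where
the interface is crossed transversally. -/
theorem FlowAssumptions.hasLocalFlow_of_mem_face (h : FlowAssumptions M φ V φlow φhigh Γ)
    (hσ : σ ∈ M.faces) (hσΩ : σ ⊆ Ω) (hn : IsUnitNormal σ n) (hy : y ∈ σ) (hyb : y ∉ M.skeleton)
    (hK : K ∈ M.cells) (hσK : σ ⊆ frontier K) (hpos : 0 < ⟪n, extendFrom K V y⟫) :
    HasLocalFlow M φ V y := by
  obtain ⟨v, hv0, hv⟩ := h.exists_velocity_bound
  obtain ⟨c, hc, ρ, hρ, hρΩ, hρσ, K₁, hK₁, L₁, hL₁, hlow, hup, hσK₁, hσL₁, hdisj, hnear, -⟩ :=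
    M.exists_two_sided_ball hσ hσΩ hn hy hyb
  obtain ⟨X, hX⟩ := h.exists_velocity_extension hK₁
  obtain ⟨Y, hY⟩ := h.exists_velocity_extension hL₁
  have hyK := frontier_subset_closure (hσK₁ hy)
  have hyL := frontier_subset_closure (hσL₁ hy)
  have hvel : ∀ K' ∈ M.cells, σ ⊆ frontier K' → 0 < ⟪n, velocity φ V K' y⟫ := by
    intro K' hK' hσK'
    obtain ⟨f, P, -, -, -, hcl⟩ := h.exists_extension hK'
    have h1 := hcl y (frontier_subset_closure (hσK' hy))
    rw [velocity, inner_smul_right, h.inner_extendFrom_eq hσ hσΩ hn hy hyb hK' hK hσK' hσK, h1.1]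
    exact mul_pos (inv_pos.mpr (h.φlow_pos.trans_le h1.2.2.1)) hpos
  have hXpos : 0 < ⟪n, X y⟫ := (hX y hyK).1 ▸ hvel K₁ hK₁ hσK₁
  have hYpos : 0 < ⟪n, Y y⟫ := (hY y hyL).1 ▸ hvel L₁ hL₁ hσL₁
  obtain ⟨k₁, s₁, hs₁, hk₁⟩ := (hX y hyK).2.exists_lipschitzOnWith
  obtain ⟨k₂, s₂, hs₂, hk₂⟩ := (hY y hyL).2.exists_lipschitzOnWith
  have hXc := (hX y hyK).2.continuousAt
  have hYc := (hY y hyL).2.continuousAt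
  have evX : ∀ᶠ x in 𝓝 y, ⟪n, X y⟫ / 2 < ⟪n, X x⟫ ∧ ‖X x‖ < v + 1 := by
    refine ((continuousAt_const.inner hXc).eventually (lt_mem_nhds (by linarith))).and
      (hXc.norm.eventually (gt_mem_nhds ?_))
    exact lt_of_le_of_lt ((hX y hyK).1 ▸ hv K₁ hK₁ y hyK) (by linarith)
  have evY : ∀ᶠ x in 𝓝 y, ⟪n, Y y⟫ / 2 < ⟪n, Y x⟫ ∧ ‖Y x‖ < v + 1 := by
    refine ((continuousAt_const.inner hYc).eventually (lt_mem_nhds (by linarith))).and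
      (hYc.norm.eventually (gt_mem_nhds ?_))
    exact lt_of_le_of_lt ((hY y hyL).1 ▸ hv L₁ hL₁ y hyL) (by linarith)
  obtain ⟨A, hA, hAs⟩ := Metric.nhds_basis_closedBall.mem_iff.mp
    (inter_mem (inter_mem (inter_mem hs₁ hs₂) (inter_mem evX evY)) (Metric.ball_mem_nhds y hρ))
  have hlow' : ∀ x ∈ Metric.closedBall y A, ⟪n, x⟫ ≤ c → x ∈ closure K₁ := by
    intro x hx hxc
    rcases hxc.lt_or_eq with h1 | h1
    · exact subset_closure (hlow ⟨(hAs hx).2, h1⟩)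
    · exact frontier_subset_closure (hσK₁ (hρσ ⟨(hAs hx).2, h1⟩))
  have hup' : ∀ x ∈ Metric.closedBall y A, c ≤ ⟪n, x⟫ → x ∈ closure L₁ := by
    intro x hx hxc
    rcases hxc.lt_or_eq with h1 | h1
    · exact subset_closure (hup ⟨(hAs hx).2, h1⟩)
    · exact frontier_subset_closure (hσL₁ (hρσ ⟨(hAs hx).2, h1.symm⟩))
  -- The bound `v` holds for each field on the closure of its own cell only; continuity gives `v +
  -- 1` in a whole ball.
  refine hasLocalFlow_of_fields (n := n) (c := c) (v := v + 1) (k := max k₁ k₂) (X := X) (Y := Y)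
    (by positivity) (fun K hK y hy => (hv K hK y hy).trans (by simp)) hA
    (fun x hx => hρΩ (hAs hx).2)
    ((hk₁.mono fun x hx => (hAs hx).1.1.1).weaken (le_max_left _ _))
    ((hk₂.mono fun x hx => (hAs hx).1.1.2).weaken (le_max_right _ _)) ?_ ?_ ?_ (Or.inr ⟨hn.1, ?_⟩)
  · intro K' hK' x hx hxK'
    rcases hnear K' hK' ⟨x, hxK', (hAs hx).2⟩ with rfl | rfl
    · refine Or.inl ⟨(hX x hxK').1, not_lt.mp fun hlt => ?_⟩
      obtain ⟨z, hz1, hz2⟩ := mem_closure_iff.mp hxK' _ (isOpen_upperHalfBall n c y ρ)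
        ⟨(hAs hx).2, hlt⟩
      exact Set.disjoint_left.mp hdisj hz2 (hup hz1)
    · refine Or.inr ⟨(hY x hxK').1, not_lt.mp fun hlt => ?_⟩
      obtain ⟨z, hz1, hz2⟩ := mem_closure_iff.mp hxK' _ (isOpen_lowerHalfBall n c y ρ)
        ⟨(hAs hx).2, hlt⟩
      exact Set.disjoint_left.mp hdisj (hlow hz1) hz2
  · exact fun x hx hxc => ⟨K₁, hK₁, hlow' x hx hxc, (hX x (hlow' x hx hxc)).1⟩
  · exact fun x hx hxc => ⟨L₁, hL₁, hup' x hx hxc, (hY x (hup' x hx hxc)).1⟩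
  · refine ⟨min (⟪n, X y⟫ / 2) (⟪n, Y y⟫ / 2), by positivity, fun x hx => ?_⟩
    obtain ⟨h1, h2⟩ := (hAs hx).1.2
    simp only [NNReal.coe_add, NNReal.coe_one]
    exact ⟨h1.2.le, h2.2.le, (min_le_left _ _).trans h1.1.le, (min_le_right _ _).trans h2.1.le⟩

theorem FlowAssumptions.hasLocalFlow (h : FlowAssumptions M φ V φlow φhigh Γ)
    (hy : y ∈ regularSet M V) : HasLocalFlow M φ V y := by
  rcases hy with hy | ⟨σ, hσ, hyσ, hyb, n, hn, K, hK, hσK, hne⟩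
  · simp only [PolytopalMesh.cellUnion, mem_iUnion, exists_prop] at hy
    obtain ⟨K, hK, hyK⟩ := hy
    exact h.hasLocalFlow_of_mem_cell hK hyK
  · have hσΩ := h.subset_domain_of_inner_ne hσ hyσ hn hK hσK hne
    rcases hne.lt_or_gt with hlt | hgt
    · exact h.hasLocalFlow_of_mem_face hσ hσΩ hn.neg hyσ hyb hK hσK
        (by rw [inner_neg_left]; linarith)
    · exact h.hasLocalFlow_of_mem_face hσ hσΩ hn hyσ hyb hK hσK hgt

theorem FlowAssumptions.isOpen_regularSet (h : FlowAssumptions M φ V φlow φhigh Γ) :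
    IsOpen (regularSet M V) := by
  rw [isOpen_iff_mem_nhds]
  rintro y (hy | ⟨σ, hσ, hyσ, hyb, n, hn, K, hK, hσK, hne⟩)
  · exact mem_of_superset (M.isOpen_cellUnion.mem_nhds hy) subset_union_left
  · have hσΩ := h.subset_domain_of_inner_ne hσ hyσ hn hK hσK hne
    obtain ⟨c, hc, ρ, hρ, -, hρσ, K₁, hK₁, L₁, hL₁, hlow, hup, -⟩ :=
      M.exists_two_sided_ball hσ hσΩ hn hyσ hyb
    obtain ⟨f, P, -, hP, -, hcl⟩ := h.exists_extension hK
    have hyK : ∀ z ∈ σ, extendFrom K V z = P z := fun z hz =>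
      (hcl z (frontier_subset_closure (hσK hz))).2.1
    rw [hyK y hyσ] at hne
    have ev : ∀ᶠ x in 𝓝 y, ⟪n, P x⟫ ≠ 0 :=
      (continuousAt_const.inner hP.continuous.continuousAt).eventually (isOpen_ne.mem_nhds hne)
    filter_upwards [ev, Metric.ball_mem_nhds y hρ, M.isClosed_skeleton.isOpen_compl.mem_nhds hyb]
      with x h1 h2 h3
    rcases lt_trichotomy ⟪n, x⟫ c with hlt | heq | hgt
    · exact Or.inl (mem_biUnion hK₁ (hlow ⟨h2, hlt⟩))
    · have hxσ := hρσ ⟨h2, heq⟩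
      exact Or.inr ⟨σ, hσ, hxσ, h3, n, hn, K, hK, hσK, by rwa [hyK x hxσ]⟩
    · exact Or.inl (mem_biUnion hL₁ (hup ⟨h2, hgt⟩))

end RegularPoints

/-! ### The local flow and its compressibility -/

section LocalFlow

variable {d : ℕ} {Ω : Set (EuclideanSpace ℝ (Fin d))}
  {M : PolytopalMesh Ω} {φ : EuclideanSpace ℝ (Fin d) → ℝ}
  {V : EuclideanSpace ℝ (Fin d) → EuclideanSpace ℝ (Fin d)} {φlow φhigh Γ : ℝ}
  {p x y : EuclideanSpace ℝ (Fin d)} {v : NNReal} {ρ δ C r s : ℝ}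
  {G : ℝ → EuclideanSpace ℝ (Fin d) → EuclideanSpace ℝ (Fin d)}

/-- `G` is the flow of the trajectories around `p`, during a time so short that trajectories
cannot run farther than a quarter of the radius `ρ`. -/
structure IsLocalFlow (M : PolytopalMesh Ω) (φ : EuclideanSpace ℝ (Fin d) → ℝ)
    (V : EuclideanSpace ℝ (Fin d) → EuclideanSpace ℝ (Fin d)) (p : EuclideanSpace ℝ (Fin d))
    (v : NNReal) (ρ δ C : ℝ) (G : ℝ → EuclideanSpace ℝ (Fin d) → EuclideanSpace ℝ (Fin d)) :
    Prop where
  velocity_le : ∀ K ∈ M.cells, ∀ y ∈ closure K, ‖velocity φ V K y‖ ≤ v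
  radius_pos : 0 < ρ
  time_pos : 0 < δ
  time_le : v * δ ≤ ρ / 4
  lip_nonneg : 0 ≤ C
  ball_subset : Metric.ball p ρ ⊆ Ω
  isTraj : ∀ x ∈ Metric.ball p ρ, IsTraj M φ V 0 δ (fun r => G r x)
  apply_zero : ∀ x ∈ Metric.ball p ρ, G 0 x = x
  dist_le : ∀ b γ₁ γ₂, 0 ≤ b → b ≤ δ → IsTraj M φ V 0 b γ₁ → IsTraj M φ V 0 b γ₂ →
    γ₁ 0 ∈ Metric.ball p ρ → γ₂ 0 ∈ Metric.ball p ρ → ‖γ₁ b - γ₂ b‖ ≤ C * ‖γ₁ 0 - γ₂ 0‖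

theorem FlowAssumptions.exists_isLocalFlow (h : FlowAssumptions M φ V φlow φhigh Γ)
    (hp : HasLocalFlow M φ V p) : ∃ v ρ δ C G, IsLocalFlow M φ V p v ρ δ C G := by
  obtain ⟨v, hv0, hv⟩ := h.exists_velocity_bound
  obtain ⟨ρ, hρ, δ, hδ, C, hΩ, hex, hdist⟩ := hp
  choose! γ hγ h0 using hex
  have hv0' : (0 : ℝ) < v := hv0
  refine ⟨v, ρ, min δ (ρ / 4 / v), |C|, fun r x => γ x r, hv, hρ, by positivity, ?_, abs_nonneg _,
    hΩ, fun x hx => (hγ x hx).mono le_rfl (min_le_left _ _), h0, ?_⟩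
  · calc (v : ℝ) * min δ (ρ / 4 / v) ≤ v * (ρ / 4 / v) := by gcongr; exact min_le_right _ _
      _ = ρ / 4 := by field_simp
  · intro b γ₁ γ₂ hb0 hb h1 h2 h01 h02
    refine (hdist b γ₁ γ₂ hb0 (hb.trans (min_le_left _ _)) h1 h2 h01 h02).trans ?_
    gcongr
    exact le_abs_self C

namespace IsLocalFlow

theorem eq_apply (hG : IsLocalFlow M φ V p v ρ δ C G) {γ : ℝ → EuclideanSpace ℝ (Fin d)}
    (hr0 : 0 ≤ r) (hr : r ≤ δ) (hγ : IsTraj M φ V 0 r γ) (h0 : γ 0 ∈ Metric.ball p ρ) :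
    γ r = G r (γ 0) := by
  have := hG.dist_le r γ (fun s => G s (γ 0)) hr0 hr hγ ((hG.isTraj _ h0).mono le_rfl hr) h0
    (by simpa only [hG.apply_zero _ h0] using h0)
  simp only [hG.apply_zero _ h0, sub_self, norm_zero, mul_zero] at this
  exact sub_eq_zero.mp (norm_le_zero_iff.mp this)

theorem lipschitz_space (hG : IsLocalFlow M φ V p v ρ δ C G) (hr0 : 0 ≤ r) (hr : r ≤ δ)
    (hx : x ∈ Metric.ball p ρ) (hy : y ∈ Metric.ball p ρ) : ‖G r x - G r y‖ ≤ C * ‖x - y‖ := by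
  have := hG.dist_le r (fun s => G s x) (fun s => G s y) hr0 hr
    ((hG.isTraj _ hx).mono le_rfl hr) ((hG.isTraj _ hy).mono le_rfl hr)
    (by simpa only [hG.apply_zero _ hx] using hx) (by simpa only [hG.apply_zero _ hy] using hy)
  simpa only [hG.apply_zero _ hx, hG.apply_zero _ hy] using this

theorem lipschitz_time (hG : IsLocalFlow M φ V p v ρ δ C G) (hr0 : 0 ≤ r) (hrs : r ≤ s)
    (hs : s ≤ δ) (hx : x ∈ Metric.ball p ρ) : ‖G s x - G r x‖ ≤ v * (s - r) := by
  exact IsTraj.norm_sub_le (γ := fun t => G t x) hG.velocity_le ((hG.isTraj x hx).mono hr0 hs) hrs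

theorem dist_apply_le (hG : IsLocalFlow M φ V p v ρ δ C G) (hr0 : 0 ≤ r) (hr : r ≤ δ)
    (hx : x ∈ Metric.ball p ρ) : dist (G r x) x ≤ ρ / 4 := by
  have := hG.lipschitz_time le_rfl hr0 hr hx
  rw [hG.apply_zero x hx, sub_zero] at this
  rw [dist_eq_norm]
  exact this.trans ((mul_le_mul_of_nonneg_left hr v.2).trans hG.time_le)

theorem apply_add (hG : IsLocalFlow M φ V p v ρ δ C G) (hr : 0 ≤ r) (hs : 0 ≤ s)
    (hrs : r + s ≤ δ) (hx : x ∈ Metric.ball p ρ) (hsx : G s x ∈ Metric.ball p ρ) :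
    G (r + s) x = G r (G s x) := by
  have h1 : IsTraj M φ V 0 r (fun t => G (t + s) x) := by
    have := ((hG.isTraj x hx).mono hs hrs).comp_add_const s
    rwa [sub_self, add_sub_cancel_right] at this
  have := hG.eq_apply hr (by linarith) h1 (by simpa using hsx)
  simpa using this

/-- The equation may fail at the particular time 0, so the derivative comes from the mean value
inequality: shortly after 0 the curve is in the cell of `x`, with a velocity close to the one at
`x`. -/
theorem hasDerivWithinAt_zero (hG : IsLocalFlow M φ V p v ρ δ C G)
    (h : FlowAssumptions M φ V φlow φhigh Γ) (hx : x ∈ Metric.ball p ρ) (hxD : x ∈ M.cellUnion) :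
    HasDerivWithinAt (fun r => G r x) ((φ x)⁻¹ • V x) (Ici 0) 0 := by
  simp only [PolytopalMesh.cellUnion, mem_iUnion, exists_prop] at hxD
  obtain ⟨K, hK, hxK⟩ := hxD
  obtain ⟨f, P, hf, hP, hfP, hcl⟩ := h.exists_extension hK
  obtain ⟨X, hX⟩ := h.exists_velocity_extension hK
  have hXx : X x = (φ x)⁻¹ • V x := by
    rw [← (hX x (subset_closure hxK)).1, velocity, (hcl x (subset_closure hxK)).1,
      (hcl x (subset_closure hxK)).2.1, (hfP x hxK).1, (hfP x hxK).2]
  rw [hasDerivWithinAt_iff_isLittleO, Asymptotics.isLittleO_iff]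
  intro ε hε
  obtain ⟨η, hη, hηs⟩ := Metric.mem_nhds_iff.mp (inter_mem ((M.isOpen_cell K hK).mem_nhds hxK)
    ((hX x (subset_closure hxK)).2.continuousAt.eventually (Metric.ball_mem_nhds _ hε)))
  have hev : ∀ᶠ r : ℝ in 𝓝 0, r < δ ∧ v * r < η := by
    refine (gt_mem_nhds hG.time_pos).and ?_
    have : Continuous fun r : ℝ => (v : ℝ) * r := by fun_prop
    exact this.continuousAt.eventually (gt_mem_nhds (by simpa using hη))
  filter_upwards [nhdsWithin_le_nhds hev, self_mem_nhdsWithin] with r hr hr0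
  rw [hG.apply_zero x hx, sub_zero, Real.norm_of_nonneg hr0]
  obtain ⟨L, hL⟩ := (hG.isTraj x hx).lipschitz
  obtain ⟨N, hN, hd⟩ := (hG.isTraj x hx).hasDerivAt
  have key := norm_sub_le_of_hasDerivAt_off_countable (γ := fun r => G r x) (w := (φ x)⁻¹ • V x)
    hε.le (show (0 : ℝ) ≤ r from hr0) (hL.mono (Icc_subset_Icc_right hr.1.le)) hN fun t ht => by
      obtain ⟨K', hK', hm, hd'⟩ := hd t ⟨⟨ht.1.1, ht.1.2.trans hr.1⟩, ht.2⟩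
      have hball : G t x ∈ Metric.ball x η := by
        have := hG.lipschitz_time le_rfl ht.1.1.le (ht.1.2.le.trans hr.1.le) hx
        rw [hG.apply_zero x hx, sub_zero] at this
        rw [Metric.mem_ball, dist_eq_norm]
        exact lt_of_le_of_lt (this.trans (mul_le_mul_of_nonneg_left ht.1.2.le v.2)) hr.2
      have hKK : K' = K := by
        by_contra hne
        obtain ⟨z, hz1, hz2⟩ := mem_closure_iff.mp hm K (M.isOpen_cell K hK) (hηs hball).1
        exact Set.disjoint_left.mp (M.disjoint_cells hK' hK hne) hz2 hz1
      subst hKK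
      refine ⟨_, hd', ?_⟩
      have : dist (X (G t x)) (X x) < ε := (hηs hball).2
      rw [dist_eq_norm] at this
      rw [(hX _ hm).1, ← hXx]
      exact this.le
  simpa [hG.apply_zero x hx] using key

end IsLocalFlow

/-- The transport of the function `ψ` by a local flow. -/
noncomputable def transport (G : ℝ → EuclideanSpace ℝ (Fin d) → EuclideanSpace ℝ (Fin d))
    (p : EuclideanSpace ℝ (Fin d)) (ρ : ℝ) (ψ : EuclideanSpace ℝ (Fin d) → ℝ) (r : ℝ) :
    EuclideanSpace ℝ (Fin d) → ℝ :=
  (Metric.ball p ρ).indicator fun x => ψ (G r x)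

namespace IsLocalFlow

variable {ψ : EuclideanSpace ℝ (Fin d) → ℝ} {L : NNReal}

/-- Points move by at most `ρ / 4`, so a support in the ball of radius `ρ / 4` is pulled back into
the ball of radius `ρ / 2`. The cut-off at radius `ρ` thus creates no discontinuity. -/
theorem transport_eq_zero (hG : IsLocalFlow M φ V p v ρ δ C G)
    (hψ : ∀ x, x ∉ Metric.ball p (ρ / 4) → ψ x = 0) (hr0 : 0 ≤ r) (hr : r ≤ δ)
    (hx : x ∉ Metric.ball p (ρ / 2)) : transport G p ρ ψ r x = 0 := by
  by_cases hxB : x ∈ Metric.ball p ρ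
  · rw [transport, indicator_of_mem hxB]
    refine hψ _ fun hGx => hx ?_
    rw [Metric.mem_ball] at hGx ⊢
    have h1 := hG.dist_apply_le hr0 hr hxB
    rw [dist_comm] at h1
    linarith [dist_triangle x (G r x) p]
  · rw [transport, indicator_of_notMem hxB]

/-- Inside the ball the constant is `L * C`. Between a point of the half-radius ball and a point
outside the ball, the values differ by at most 1 and the distance is at least `ρ / 2`, whence `2 /
ρ`. -/
theorem exists_lipschitzWith_transport (hG : IsLocalFlow M φ V p v ρ δ C G)
    (hψL : LipschitzWith L ψ) (hψ : ∀ x, x ∉ Metric.ball p (ρ / 4) → ψ x = 0)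
    (hψ1 : ∀ x, |ψ x| ≤ 1) (hr0 : 0 ≤ r) (hr : r ≤ δ) :
    ∃ L', LipschitzWith L' (transport G p ρ ψ r) := by
  have hρ := hG.radius_pos
  have hC := hG.lip_nonneg
  have hLC : (0 : ℝ) ≤ L * C + 2 / ρ := by positivity
  refine ⟨⟨L * C + 2 / ρ, hLC⟩, LipschitzWith.of_dist_le_mul fun x y => ?_⟩
  change dist _ _ ≤ (L * C + 2 / ρ) * dist x y
  have aux : ∀ x y, x ∈ Metric.ball p ρ → y ∉ Metric.ball p ρ →
      dist (transport G p ρ ψ r x) (transport G p ρ ψ r y) ≤ (L * C + 2 / ρ) * dist x y := by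
    intro x y hx hy
    have hy0 : transport G p ρ ψ r y = 0 := indicator_of_notMem hy _
    by_cases hx2 : x ∈ Metric.ball p (ρ / 2)
    · have h1 : ρ / 2 ≤ dist x y := by
        rw [Metric.mem_ball] at hx2 hy
        linarith [dist_triangle y x p, dist_comm x y]
      have h2 : dist (transport G p ρ ψ r x) (transport G p ρ ψ r y) ≤ 1 := by
        rw [hy0, dist_zero_right, transport, indicator_of_mem hx]
        exact hψ1 _
      calc _ ≤ (1 : ℝ) := h2
        _ = 2 / ρ * (ρ / 2) := by field_simp
        _ ≤ 2 / ρ * dist x y := by gcongr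
        _ ≤ (L * C + 2 / ρ) * dist x y := by
          gcongr
          exact le_add_of_nonneg_left (by positivity)
    · rw [hy0, hG.transport_eq_zero hψ hr0 hr hx2, dist_self]
      positivity
  by_cases hx : x ∈ Metric.ball p ρ <;> by_cases hy : y ∈ Metric.ball p ρ
  · rw [transport, indicator_of_mem hx, indicator_of_mem hy]
    have h1 := hψL.dist_le_mul (G r x) (G r y)
    have h2 := hG.lipschitz_space hr0 hr hx hy
    rw [← dist_eq_norm, ← dist_eq_norm] at h2
    calc _ ≤ L * (C * dist x y) := h1.trans (by gcongr)
      _ ≤ (L * C + 2 / ρ) * dist x y := by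
        rw [← mul_assoc]
        gcongr
        exact le_add_of_nonneg_right (by positivity)
  · exact aux x y hx hy
  · rw [dist_comm, dist_comm x y]
    exact aux y x hy hx
  · rw [transport, indicator_of_notMem hx, indicator_of_notMem hy, dist_self]
    positivity

theorem abs_transport_sub_le (hG : IsLocalFlow M φ V p v ρ δ C G) (hψL : LipschitzWith L ψ)
    (hr0 : 0 ≤ r) (hrs : r ≤ s) (hs : s ≤ δ) (x : EuclideanSpace ℝ (Fin d)) :
    |transport G p ρ ψ s x - transport G p ρ ψ r x| ≤ L * v * (s - r) := by
  by_cases hx : x ∈ Metric.ball p ρ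
  · rw [transport, transport, indicator_of_mem hx, indicator_of_mem hx, mul_assoc]
    refine (hψL.norm_sub_le _ _).trans ?_
    gcongr
    exact hG.lipschitz_time hr0 hrs hs hx
  · rw [transport, transport, indicator_of_notMem hx, indicator_of_notMem hx, sub_self, abs_zero]
    have := sub_nonneg.mpr hrs
    positivity

/-- By the semigroup law, the transport at time `r + s` is the transport at time `r` evaluated at `G
s x`. The derivative in time is therefore a space derivative at fixed `r` along the initial velocity
at `x`. -/
theorem tendsto_slope_transport (hG : IsLocalFlow M φ V p v ρ δ C G)
    (h : FlowAssumptions M φ V φlow φhigh Γ)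
    (hψ : ∀ x, x ∉ Metric.ball p (ρ / 4) → ψ x = 0) (hr0 : 0 ≤ r) (hr : r < δ)
    (hxD : x ∈ M.cellUnion) (hd : DifferentiableAt ℝ (transport G p ρ ψ r) x) :
    Tendsto (fun s => s⁻¹ * (transport G p ρ ψ (r + s) x - transport G p ρ ψ r x)) (𝓝[>] 0)
      (𝓝 (fderiv ℝ (transport G p ρ ψ r) x ((φ x)⁻¹ • V x))) := by
  have hρ := hG.radius_pos
  have hsmall : ∀ᶠ s : ℝ in 𝓝[>] 0, r + s < δ := by
    have : Continuous fun s : ℝ => r + s := by fun_prop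
    exact nhdsWithin_le_nhds (this.continuousAt.eventually (gt_mem_nhds (by simpa using hr)))
  -- Within radius `3 ρ / 4` the point `G s x` is still in the ball of radius `ρ`, so the semigroup
  -- law applies; farther away the transported functions vanish.
  by_cases hx : x ∈ Metric.ball p (3 / 4 * ρ)
  · have hxB : x ∈ Metric.ball p ρ := Metric.ball_subset_ball (by linarith) hx
    have h1 := hG.hasDerivWithinAt_zero h hxB hxD
    have h2 : HasDerivWithinAt (fun s => transport G p ρ ψ r (G s x))
        (fderiv ℝ (transport G p ρ ψ r) x ((φ x)⁻¹ • V x)) (Ici 0) 0 := by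
      refine HasFDerivAt.comp_hasDerivWithinAt (0 : ℝ) ?_ h1
      rw [hG.apply_zero x hxB]
      exact hd.hasFDerivAt
    rw [hasDerivWithinAt_iff_tendsto_slope, Ici_sdiff_left] at h2
    refine h2.congr' ?_
    filter_upwards [hsmall, self_mem_nhdsWithin] with s hs hs0
    have hs0' : (0 : ℝ) < s := hs0
    have hGs : G s x ∈ Metric.ball p ρ := by
      have := hG.dist_apply_le hs0'.le (by linarith) hxB
      rw [Metric.mem_ball] at hx ⊢
      linarith [dist_triangle (G s x) x p]
    rw [slope_def_field, sub_zero, hG.apply_zero x hxB, div_eq_inv_mul]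
    congr 2
    rw [transport, transport, indicator_of_mem hGs, indicator_of_mem hxB,
      hG.apply_add hr0 hs0'.le hs.le hxB hGs]
  · have hx2 : x ∉ Metric.closedBall p (ρ / 2) := fun hx2 =>
      hx (Metric.closedBall_subset_ball (by linarith) hx2)
    have hz : ∀ t, 0 ≤ t → t ≤ δ → ∀ z, z ∉ Metric.closedBall p (ρ / 2) →
        transport G p ρ ψ t z = 0 := fun t ht0 ht z hz =>
      hG.transport_eq_zero hψ ht0 ht fun hz' => hz (Metric.ball_subset_closedBall hz')
    have hev : transport G p ρ ψ r =ᶠ[𝓝 x] fun _ => 0 := by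
      filter_upwards [Metric.isClosed_closedBall.isOpen_compl.mem_nhds hx2] with z hz'
      exact hz r hr0 hr.le z hz'
    rw [hev.fderiv_eq]
    refine tendsto_nhds_of_eventually_eq ?_
    filter_upwards [hsmall, self_mem_nhdsWithin] with s hs hs0
    have hs0' : (0 : ℝ) < s := hs0
    rw [hz (r + s) (by linarith) hs.le x hx2, hz r hr0 hr.le x hx2]
    simp

end IsLocalFlow

end LocalFlow

/-! ### Growth of the weighted integral of a transported test function -/

section Compression

variable {d : ℕ} {Ω : Set (EuclideanSpace ℝ (Fin d))}
  {M : PolytopalMesh Ω} {φ : EuclideanSpace ℝ (Fin d) → ℝ}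
  {V : EuclideanSpace ℝ (Fin d) → EuclideanSpace ℝ (Fin d)} {φlow φhigh Γ : ℝ}
  {p x y : EuclideanSpace ℝ (Fin d)} {v : NNReal} {ρ δ C r s : ℝ}
  {G : ℝ → EuclideanSpace ℝ (Fin d) → EuclideanSpace ℝ (Fin d)}
  {ψ : EuclideanSpace ℝ (Fin d) → ℝ} {L : NNReal}

theorem PolytopalMesh.restrict_domain (M : PolytopalMesh Ω) :
    (volume : Measure (EuclideanSpace ℝ (Fin d))).restrict Ω = volume.restrict M.cellUnion := by
  refine Measure.restrict_congr_set (Filter.EventuallyLE.antisymm ?_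
    M.cellUnion_subset.eventuallyLE)
  rw [ae_le_set]
  refine measure_mono_null (fun x hx => ?_) M.volume_faceUnion
  exact (M.closure_subset_union (subset_closure hx.1)).resolve_left hx.2

theorem FlowAssumptions.mem_bounds (h : FlowAssumptions M φ V φlow φhigh Γ)
    (hx : x ∈ M.cellUnion) : φlow ≤ φ x ∧ φ x ≤ φhigh := by
  simp only [PolytopalMesh.cellUnion, mem_iUnion, exists_prop] at hx
  obtain ⟨K, hK, hxK⟩ := hx
  exact h.bounds K hK x hxK

theorem FlowAssumptions.continuousOn_cellUnion (h : FlowAssumptions M φ V φlow φhigh Γ) :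
    ContinuousOn φ M.cellUnion := by
  intro x hx
  simp only [PolytopalMesh.cellUnion, mem_iUnion, exists_prop] at hx
  obtain ⟨K, hK, hxK⟩ := hx
  obtain ⟨f, hf, hφ⟩ := h.smooth K hK
  refine ContinuousAt.continuousWithinAt (hf.continuous.continuousAt.congr ?_)
  filter_upwards [(M.isOpen_cell K hK).mem_nhds hxK] with z hz using (hφ hz).symm

theorem FlowAssumptions.aestronglyMeasurable (h : FlowAssumptions M φ V φlow φhigh Γ) :
    AEStronglyMeasurable φ (volume.restrict M.cellUnion) :=
  h.continuousOn_cellUnion.aestronglyMeasurable M.isOpen_cellUnion.measurableSet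

theorem PolytopalMesh.volume_cellUnion_lt_top (M : PolytopalMesh Ω) :
    volume M.cellUnion < ⊤ :=
  (M.isBounded_domain.subset M.cellUnion_subset).measure_lt_top

theorem FlowAssumptions.abs_apply_le (h : FlowAssumptions M φ V φlow φhigh Γ)
    (hx : x ∈ M.cellUnion) : |φ x| ≤ φhigh := by
  have := h.mem_bounds hx
  rw [abs_of_nonneg (h.φlow_pos.le.trans this.1)]
  exact this.2

theorem FlowAssumptions.integrableOn_mul (h : FlowAssumptions M φ V φlow φhigh Γ)
    {u : EuclideanSpace ℝ (Fin d) → ℝ} {c : ℝ} (hu : Continuous u) (huc : ∀ x, |u x| ≤ c) :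
    IntegrableOn (fun x => u x * φ x) M.cellUnion := by
  have : IsFiniteMeasure (volume.restrict M.cellUnion) :=
    ⟨by simpa using M.volume_cellUnion_lt_top⟩
  refine Integrable.of_bound (hu.aestronglyMeasurable.mul h.aestronglyMeasurable) (c * φhigh) ?_
  refine (ae_restrict_mem M.isOpen_cellUnion.measurableSet).mono fun x hx => ?_
  rw [Real.norm_eq_abs, abs_mul]
  exact mul_le_mul (huc x) (h.abs_apply_le hx) (abs_nonneg _) ((abs_nonneg _).trans (huc x))

namespace IsLocalFlow

theorem abs_transport_le (hψ1 : ∀ x, |ψ x| ≤ 1) (x : EuclideanSpace ℝ (Fin d)) :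
    |transport G p ρ ψ r x| ≤ 1 := by
  by_cases hx : x ∈ Metric.ball p ρ
  · rw [transport, indicator_of_mem hx]
    exact hψ1 _
  · rw [transport, indicator_of_notMem hx, abs_zero]
    exact zero_le_one

theorem transport_nonneg (hψ0 : ∀ x, 0 ≤ ψ x) (x : EuclideanSpace ℝ (Fin d)) :
    0 ≤ transport G p ρ ψ r x :=
  indicator_nonneg (fun _ _ => hψ0 _) x

theorem hasCompactSupport_transport (hG : IsLocalFlow M φ V p v ρ δ C G)
    (hψ : ∀ x, x ∉ Metric.ball p (ρ / 4) → ψ x = 0) (hr0 : 0 ≤ r) (hr : r ≤ δ) :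
    HasCompactSupport (transport G p ρ ψ r) ∧ tsupport (transport G p ρ ψ r) ⊆ Ω := by
  have hρ := hG.radius_pos
  have hz : ∀ x, x ∉ Metric.closedBall p (ρ / 2) → transport G p ρ ψ r x = 0 := fun x hx =>
    hG.transport_eq_zero hψ hr0 hr fun hx' => hx (Metric.ball_subset_closedBall hx')
  refine ⟨HasCompactSupport.intro (isCompact_closedBall p (ρ / 2)) hz, ?_⟩
  have hsub : tsupport (transport G p ρ ψ r) ⊆ Metric.closedBall p (ρ / 2) :=
    closure_minimal (fun x hx => by_contra fun hx' => hx (hz x hx')) Metric.isClosed_closedBall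
  exact hsub.trans ((Metric.closedBall_subset_ball (by linarith)).trans hG.ball_subset)

/-- Under the integral the weight `φ` cancels the `1 / φ` of the velocity, which leaves `∫ V · ∇u`
for the Lipschitz function `u` transported at time `r`, an admissible test function for the
divergence of `V`. -/
theorem tendsto_slope_integral (hG : IsLocalFlow M φ V p v ρ δ C G)
    (h : FlowAssumptions M φ V φlow φhigh Γ) (hψL : LipschitzWith L ψ)
    (hψ : ∀ x, x ∉ Metric.ball p (ρ / 4) → ψ x = 0) (hψ1 : ∀ x, |ψ x| ≤ 1)
    {g : EuclideanSpace ℝ (Fin d) → ℝ} (hg : IntegrableOn g Ω) (hdiv : IsWeakDiv Ω V g)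
    (hr0 : 0 ≤ r) (hr : r < δ) :
    Tendsto (fun s => s⁻¹ * ((∫ x in M.cellUnion, transport G p ρ ψ (r + s) x * φ x) -
      ∫ x in M.cellUnion, transport G p ρ ψ r x * φ x)) (𝓝[>] 0)
      (𝓝 (-∫ x in M.cellUnion, g x * transport G p ρ ψ r x)) := by
  have hsmall : ∀ᶠ s : ℝ in 𝓝[>] 0, r + s ≤ δ := by
    have : Continuous fun s : ℝ => r + s := by fun_prop
    exact nhdsWithin_le_nhds ((this.continuousAt.eventually
      (gt_mem_nhds (by simpa using hr))).mono fun _ => le_of_lt)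
  have hlip := fun t (ht0 : 0 ≤ t) (ht : t ≤ δ) =>
    hG.exists_lipschitzWith_transport hψL hψ hψ1 ht0 ht
  have hint : ∀ t, 0 ≤ t → t ≤ δ →
      IntegrableOn (fun x => transport G p ρ ψ t x * φ x) M.cellUnion := fun t ht0 ht =>
    h.integrableOn_mul (hlip t ht0 ht).choose_spec.continuous (abs_transport_le hψ1)
  obtain ⟨L', hL'⟩ := hlip r hr0 hr.le
  have hsupp := hG.hasCompactSupport_transport hψ hr0 hr.le
  have hrhs : -∫ x in M.cellUnion, g x * transport G p ρ ψ r x =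
      ∫ x in M.cellUnion, fderiv ℝ (transport G p ρ ψ r) x (V x) := by
    rw [← M.restrict_domain]
    exact (hdiv.setIntegral_fderiv_of_lipschitzWith M.isOpen_domain h.integrableOn_velocity hg hL'
      hsupp.1 hsupp.2).symm
  have : IsFiniteMeasure (volume.restrict M.cellUnion) :=
    ⟨by simpa using M.volume_cellUnion_lt_top⟩
  rw [hrhs]
  have hdct : Tendsto (fun s => ∫ x in M.cellUnion,
      s⁻¹ * (transport G p ρ ψ (r + s) x - transport G p ρ ψ r x) * φ x) (𝓝[>] 0)
      (𝓝 (∫ x in M.cellUnion, fderiv ℝ (transport G p ρ ψ r) x (V x))) := by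
    refine tendsto_integral_filter_of_dominated_convergence (fun _ => L * v * φhigh) ?_ ?_
      (integrable_const _) ?_
    · filter_upwards [hsmall, self_mem_nhdsWithin] with s hs hs0
      have hs0' : (0 : ℝ) < s := hs0
      exact ((((hlip (r + s) (by linarith) hs).choose_spec.continuous.sub
        hL'.continuous).const_mul s⁻¹).aestronglyMeasurable).mul h.aestronglyMeasurable
    · filter_upwards [hsmall, self_mem_nhdsWithin] with s hs hs0
      have hs0' : (0 : ℝ) < s := hs0
      refine (ae_restrict_mem M.isOpen_cellUnion.measurableSet).mono fun x hx => ?_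
      rw [Real.norm_eq_abs, abs_mul]
      refine mul_le_mul ?_ (h.abs_apply_le hx) (abs_nonneg _) (by positivity)
      rw [abs_mul, abs_of_pos (inv_pos.mpr hs0'), inv_mul_le_iff₀ hs0']
      have := hG.abs_transport_sub_le (ψ := ψ) hψL hr0 (by linarith : r ≤ r + s) hs x
      linarith
    · filter_upwards [ae_restrict_mem M.isOpen_cellUnion.measurableSet,
        ae_restrict_of_ae hL'.ae_differentiableAt] with x hx hxd
      have h1 := (hG.tendsto_slope_transport h hψ hr0 hr hx hxd).mul_const (φ x)
      have hφ0 : φ x ≠ 0 := (h.φlow_pos.trans_le (h.mem_bounds hx).1).ne'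
      rwa [map_smul, smul_eq_mul, mul_comm (φ x)⁻¹, inv_mul_cancel_right₀ hφ0] at h1
  refine hdct.congr' ?_
  filter_upwards [hsmall, self_mem_nhdsWithin] with s hs hs0
  have hs0' : (0 : ℝ) < s := hs0
  rw [← integral_sub (hint _ (by linarith) hs) (hint _ hr0 hr.le), ← integral_const_mul]
  congr 1
  ext x
  ring

theorem integral_transport_le (hG : IsLocalFlow M φ V p v ρ δ C G)
    (h : FlowAssumptions M φ V φlow φhigh Γ) (hψL : LipschitzWith L ψ)
    (hψ : ∀ x, x ∉ Metric.ball p (ρ / 4) → ψ x = 0) (hψ0 : ∀ x, 0 ≤ ψ x) (hψ1 : ∀ x, ψ x ≤ 1)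
    (hr0 : 0 ≤ r) (hr : r ≤ δ) :
    ∫ x in M.cellUnion, transport G p ρ ψ r x * φ x ≤
      (∫ x in M.cellUnion, ψ x * φ x) * Real.exp (Γ / φlow * r) := by
  obtain ⟨g, hg, hdiv, hgΓ⟩ := h.exists_div
  have hψa : ∀ x, |ψ x| ≤ 1 := fun x => by rw [abs_of_nonneg (hψ0 x)]; exact hψ1 x
  have : IsFiniteMeasure (volume.restrict M.cellUnion) :=
    ⟨by simpa using M.volume_cellUnion_lt_top⟩
  have hint : ∀ t, 0 ≤ t → t ≤ δ →
      IntegrableOn (fun x => transport G p ρ ψ t x * φ x) M.cellUnion := fun t ht0 ht =>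
    h.integrableOn_mul (hG.exists_lipschitzWith_transport hψL hψ hψa ht0
      ht).choose_spec.continuous (abs_transport_le hψa)
  have hcont : ContinuousOn (fun t => ∫ x in M.cellUnion, transport G p ρ ψ t x * φ x)
      (Icc 0 δ) := by
    have hlip : ∀ a ∈ Icc (0 : ℝ) δ, ∀ b ∈ Icc (0 : ℝ) δ, a ≤ b →
        dist (∫ x in M.cellUnion, transport G p ρ ψ a x * φ x)
          (∫ x in M.cellUnion, transport G p ρ ψ b x * φ x) ≤
        (L * v * φhigh * volume.real M.cellUnion) * dist a b := by
      intro a ha b hb hab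
      rw [dist_comm, dist_eq_norm, ← integral_sub (hint b hb.1 hb.2) (hint a ha.1 ha.2)]
      have := norm_setIntegral_le_of_norm_le_const (μ := volume) (s := M.cellUnion)
        (f := fun x => transport G p ρ ψ b x * φ x - transport G p ρ ψ a x * φ x)
        (C := L * v * (b - a) * φhigh) M.volume_cellUnion_lt_top fun x hx => by
          rw [← sub_mul, Real.norm_eq_abs, abs_mul]
          have := sub_nonneg.mpr hab
          exact mul_le_mul (hG.abs_transport_sub_le hψL ha.1 hab hb.2 x) (h.abs_apply_le hx)
            (abs_nonneg _) (by positivity)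
      refine this.trans (le_of_eq ?_)
      rw [dist_comm, Real.dist_eq, abs_of_nonneg (sub_nonneg.mpr hab)]
      ring
    refine LipschitzOnWith.continuousOn
      (K := (L * v * φhigh * volume.real M.cellUnion).toNNReal) (LipschitzOnWith.of_dist_le_mul
      fun a ha b hb => ?_)
    have hle := Real.le_coe_toNNReal (L * v * φhigh * volume.real M.cellUnion)
    rcases le_total a b with hab | hab
    · exact (hlip a ha b hb hab).trans (by gcongr)
    · rw [dist_comm, dist_comm a b]
      exact (hlip b hb a ha hab).trans (by gcongr)
  -- Only right derivatives are known, and this form of Gronwall's lemma needs no more.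
  have hgron := le_gronwallBound_of_liminf_deriv_right_le (a := 0) (b := δ)
    (δ := ∫ x in M.cellUnion, transport G p ρ ψ 0 x * φ x) (K := Γ / φlow) (ε := 0) hcont
    (f' := fun t => -∫ x in M.cellUnion, g x * transport G p ρ ψ t x) ?_ le_rfl ?_ r ⟨hr0, hr⟩
  · rw [gronwallBound_ε0, sub_zero] at hgron
    refine hgron.trans (mul_le_mul_of_nonneg_right (le_of_eq ?_) (Real.exp_nonneg _))
    congr 1
    ext x
    congr 1
    by_cases hx : x ∈ Metric.ball p ρ
    · rw [transport, indicator_of_mem hx, hG.apply_zero x hx]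
    · rw [transport, indicator_of_notMem hx, hψ x fun hx' => hx
        (Metric.ball_subset_ball (by linarith [hG.radius_pos]) hx')]
  · intro t ht q hq
    have h1 := (hG.tendsto_slope_integral h hψL hψ hψa hg hdiv ht.1 ht.2).eventually
      (gt_mem_nhds hq)
    have h2 : Tendsto (fun z : ℝ => z - t) (𝓝[>] t) (𝓝[>] 0) := by
      refine tendsto_nhdsWithin_iff.mpr ⟨?_, ?_⟩
      · have : Continuous fun z : ℝ => z - t := by fun_prop
        simpa using (this.tendsto t).mono_left nhdsWithin_le_nhds
      · filter_upwards [self_mem_nhdsWithin] with z hz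
        exact sub_pos.mpr (show t < z from hz)
    refine ((h2.eventually h1).mono fun z hz => ?_).frequently
    simpa using hz
  · intro t ht
    rw [add_zero, ← integral_neg, ← integral_const_mul]
    have hu : Continuous (transport G p ρ ψ t) :=
      (hG.exists_lipschitzWith_transport hψL hψ hψa ht.1 ht.2.le).choose_spec.continuous
    rw [IntegrableOn, M.restrict_domain] at hg
    refine integral_mono_ae ?_ ((hint t ht.1 ht.2.le).const_mul _) ?_
    · refine Integrable.neg (Integrable.mul_bdd (c := 1) hg hu.aestronglyMeasurable ?_)
      exact Eventually.of_forall fun x => abs_transport_le hψa x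
    · rw [M.restrict_domain] at hgΓ
      filter_upwards [hgΓ, ae_restrict_mem M.isOpen_cellUnion.measurableSet] with x hx hxD
      have h0 := transport_nonneg (G := G) (p := p) (ρ := ρ) (r := t) hψ0 x
      have hφ := (h.mem_bounds hxD).1
      have hΓ : 0 ≤ Γ := (abs_nonneg _).trans hx
      have hl := h.φlow_pos
      calc -(g x * transport G p ρ ψ t x) = -g x * transport G p ρ ψ t x := by ring
        _ ≤ Γ * transport G p ρ ψ t x := by
          gcongr
          exact (neg_le_abs _).trans hx
        _ = Γ / φlow * (transport G p ρ ψ t x * φlow) := by field_simp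
        _ ≤ Γ / φlow * (transport G p ρ ψ t x * φ x) := by gcongr

end IsLocalFlow

end Compression

/-! ### Compression of arbitrary sets along regular trajectories -/

section GlobalCompression

variable {d : ℕ} {Ω : Set (EuclideanSpace ℝ (Fin d))}
  {M : PolytopalMesh Ω} {φ : EuclideanSpace ℝ (Fin d) → ℝ}
  {V : EuclideanSpace ℝ (Fin d) → EuclideanSpace ℝ (Fin d)} {φlow φhigh Γ : ℝ}
  {p x y : EuclideanSpace ℝ (Fin d)} {v : NNReal} {ρ δ C r s : ℝ}
  {G : ℝ → EuclideanSpace ℝ (Fin d) → EuclideanSpace ℝ (Fin d)}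
  {A Q : Set (EuclideanSpace ℝ (Fin d))}

/-- The measure with density `φ` on the cells. -/
noncomputable def weightedVolume (M : PolytopalMesh Ω) (φ : EuclideanSpace ℝ (Fin d) → ℝ) :
    Measure (EuclideanSpace ℝ (Fin d)) :=
  (volume.restrict M.cellUnion).withDensity fun x => ENNReal.ofReal (φ x)

theorem FlowAssumptions.weightedVolume_le (h : FlowAssumptions M φ V φlow φhigh Γ)
    (A : Set (EuclideanSpace ℝ (Fin d))) :
    weightedVolume M φ A ≤ ENNReal.ofReal φhigh * volume A := by
  have h1 : weightedVolume M φ ≤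
      (volume.restrict M.cellUnion).withDensity fun _ => ENNReal.ofReal φhigh := by
    refine withDensity_mono ?_
    filter_upwards [ae_restrict_mem M.isOpen_cellUnion.measurableSet] with x hx
    exact ENNReal.ofReal_le_ofReal (h.mem_bounds hx).2
  refine (h1 A).trans ?_
  rw [withDensity_const, Measure.smul_apply, smul_eq_mul]
  gcongr
  exact Measure.restrict_le_self

/-- The cells fill `closure Ω` up to the faces, which are negligible. -/
theorem FlowAssumptions.le_weightedVolume (h : FlowAssumptions M φ V φlow φhigh Γ)
    (hA : A ⊆ closure Ω) :
    ENNReal.ofReal φlow * volume A ≤ weightedVolume M φ A := by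
  have h1 : (volume.restrict M.cellUnion).withDensity (fun _ => ENNReal.ofReal φlow) ≤
      weightedVolume M φ := by
    refine withDensity_mono ?_
    filter_upwards [ae_restrict_mem M.isOpen_cellUnion.measurableSet] with x hx
    exact ENNReal.ofReal_le_ofReal (h.mem_bounds hx).1
  refine le_trans ?_ (h1 A)
  rw [withDensity_const, Measure.smul_apply, smul_eq_mul,
    Measure.restrict_apply' M.isOpen_cellUnion.measurableSet]
  refine mul_le_mul_right ?_ _
  calc volume A ≤ volume (A ∩ M.cellUnion ∪ M.faceUnion) := measure_mono fun x hx => by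
        rcases M.closure_subset_union (hA hx) with h | h
        · exact Or.inl ⟨hx, h⟩
        · exact Or.inr h
    _ ≤ _ := (measure_union_le _ _).trans (by rw [M.volume_faceUnion, add_zero])

theorem FlowAssumptions.isFiniteMeasure_weightedVolume (h : FlowAssumptions M φ V φlow φhigh Γ) :
    IsFiniteMeasure (weightedVolume M φ) := by
  constructor
  have h1 : weightedVolume M φ univ = weightedVolume M φ M.cellUnion := by
    rw [weightedVolume, ← withDensity_indicator M.isOpen_cellUnion.measurableSet,
      withDensity_apply _ MeasurableSet.univ,
      withDensity_apply _ M.isOpen_cellUnion.measurableSet, Measure.restrict_univ,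
      lintegral_indicator M.isOpen_cellUnion.measurableSet,
      setLIntegral_indicator M.isOpen_cellUnion.measurableSet, inter_self]
  rw [h1]
  exact (h.weightedVolume_le _).trans_lt
    (ENNReal.mul_lt_top ENNReal.ofReal_lt_top M.volume_cellUnion_lt_top)

theorem FlowAssumptions.lintegral_weightedVolume (h : FlowAssumptions M φ V φlow φhigh Γ)
    {u : EuclideanSpace ℝ (Fin d) → ℝ} (hu : Continuous u) (hu0 : ∀ x, 0 ≤ u x)
    (hu1 : ∀ x, u x ≤ 1) :
    ∫⁻ x, ENNReal.ofReal (u x) ∂(weightedVolume M φ) =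
      ENNReal.ofReal (∫ x in M.cellUnion, u x * φ x) := by
  rw [ofReal_integral_eq_lintegral_ofReal (h.integrableOn_mul hu (c := 1)
    fun x => by rw [abs_of_nonneg (hu0 x)]; exact hu1 x), weightedVolume,
    lintegral_withDensity_eq_lintegral_mul₀ h.aestronglyMeasurable.aemeasurable.ennreal_ofReal
      hu.measurable.ennreal_ofReal.aemeasurable]
  · congr 1
    ext x
    rw [Pi.mul_apply, ENNReal.ofReal_mul (hu0 x), mul_comm]
  · filter_upwards [ae_restrict_mem M.isOpen_cellUnion.measurableSet] with x hx
    exact mul_nonneg (hu0 x) (h.φlow_pos.le.trans (h.mem_bounds hx).1)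

/-- For an open target, apply the integral estimate to Lipschitz functions increasing to its
indicator, by monotone convergence. Outer regularity then gives all targets, measurable or not,
which matters because measurability is never established for the sets of trajectory starts. -/
theorem IsLocalFlow.weightedVolume_preimage_le [Nontrivial (EuclideanSpace ℝ (Fin d))]
    (hG : IsLocalFlow M φ V p v ρ δ C G)
    (h : FlowAssumptions M φ V φlow φhigh Γ) (hr0 : 0 ≤ r) (hr : r ≤ δ)
    (hA : A ⊆ Metric.ball p (ρ / 4)) :
    weightedVolume M φ {x | x ∈ Metric.ball p ρ ∧ G r x ∈ A} ≤
      ENNReal.ofReal (Real.exp (Γ / φlow * r)) * weightedVolume M φ A := by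
  have := h.isFiniteMeasure_weightedVolume
  have hopen : ∀ O ⊆ Metric.ball p (ρ / 4), IsOpen O →
      weightedVolume M φ {x | x ∈ Metric.ball p ρ ∧ G r x ∈ O} ≤
        ENNReal.ofReal (Real.exp (Γ / φlow * r)) * weightedVolume M φ O := by
    intro O hO hOo
    -- The distance to an empty complement would be 0 by convention, and the functions below would
    -- not approximate the indicator.
    have hne : Oᶜ.Nonempty := by
      rw [nonempty_compl]
      rintro rfl
      exact NormedSpace.unbounded_univ ℝ (EuclideanSpace ℝ (Fin d))
        (Metric.isBounded_ball.subset hO)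
    let ψ : ℕ → EuclideanSpace ℝ (Fin d) → ℝ := fun k x => min 1 (k * Metric.infDist x Oᶜ)
    have hψL : ∀ k : ℕ, LipschitzWith k (ψ k) := fun k => by
      refine LipschitzWith.const_min (LipschitzWith.of_dist_le_mul fun x y => ?_) 1
      rw [Real.dist_eq, ← mul_sub, abs_mul, Nat.abs_cast, ← Real.dist_eq, NNReal.coe_natCast]
      gcongr
      simpa using (Metric.lipschitz_infDist_pt Oᶜ).dist_le_mul x y
    have hψ0 : ∀ k x, 0 ≤ ψ k x := fun k x =>
      le_min zero_le_one (mul_nonneg k.cast_nonneg Metric.infDist_nonneg)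
    have hψ1 : ∀ k x, ψ k x ≤ 1 := fun k x => min_le_left _ _
    have hψO : ∀ k x, x ∉ O → ψ k x = 0 := fun k x hx => by
      simp only [ψ, Metric.infDist_zero_of_mem (mem_compl hx), mul_zero]
      exact min_eq_right zero_le_one
    have hψB : ∀ k x, x ∉ Metric.ball p (ρ / 4) → ψ k x = 0 := fun k x hx =>
      hψO k x fun hx' => hx (hO hx')
    have hmono : Monotone fun k x => ENNReal.ofReal (transport G p ρ (ψ k) r x) := by
      intro k l hkl x
      refine ENNReal.ofReal_le_ofReal (indicator_le_indicator ?_)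
      refine min_le_min_left _ ?_
      gcongr
      exact Metric.infDist_nonneg
    have hcont : ∀ k, Continuous (transport G p ρ (ψ k) r) := fun k =>
      (hG.exists_lipschitzWith_transport (hψL k) (hψB k) (fun x => by
        rw [abs_of_nonneg (hψ0 k x)]; exact hψ1 k x) hr0 hr).choose_spec.continuous
    have hk : ∀ k, ∫⁻ x, ENNReal.ofReal (transport G p ρ (ψ k) r x) ∂(weightedVolume M φ) ≤
        ENNReal.ofReal (Real.exp (Γ / φlow * r)) * weightedVolume M φ O := by
      intro k
      rw [h.lintegral_weightedVolume (hcont k) (IsLocalFlow.transport_nonneg (hψ0 k)) fun x =>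
        (le_abs_self _).trans (IsLocalFlow.abs_transport_le (fun x => by
          rw [abs_of_nonneg (hψ0 k x)]; exact hψ1 k x) x)]
      refine (ENNReal.ofReal_le_ofReal (hG.integral_transport_le h (hψL k) (hψB k) (hψ0 k)
        (hψ1 k) hr0 hr)).trans ?_
      rw [mul_comm, ENNReal.ofReal_mul (Real.exp_nonneg _),
        ← h.lintegral_weightedVolume (hψL k).continuous (hψ0 k) (hψ1 k)]
      gcongr
      rw [← lintegral_indicator_one hOo.measurableSet]
      refine lintegral_mono fun x => ?_
      by_cases hx : x ∈ O
      · simpa [indicator_of_mem hx] using hψ1 k x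
      · simp [hψO k x hx]
    calc weightedVolume M φ {x | x ∈ Metric.ball p ρ ∧ G r x ∈ O}
        -- The preimage is enclosed in a superlevel set, to which Markov's inequality applies.
        ≤ weightedVolume M φ
          {x | 1 ≤ ⨆ k, ENNReal.ofReal (transport G p ρ (ψ k) r x)} := by
          refine measure_mono fun x hx => ?_
          have hpos : 0 < Metric.infDist (G r x) Oᶜ := by
            refine (hOo.isClosed_compl.notMem_iff_infDist_pos hne).mp ?_
            simpa using hx.2
          obtain ⟨k, hk⟩ := exists_nat_ge (Metric.infDist (G r x) Oᶜ)⁻¹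
          rw [Set.mem_ofPred_eq]
          refine le_trans ?_ (le_iSup (fun k => ENNReal.ofReal (transport G p ρ (ψ k) r x)) k)
          rw [ENNReal.one_le_ofReal, transport, indicator_of_mem hx.1]
          refine le_min le_rfl ?_
          rwa [inv_le_iff_one_le_mul₀ hpos] at hk
      _ ≤ ∫⁻ x, ⨆ k, ENNReal.ofReal (transport G p ρ (ψ k) r x) ∂(weightedVolume M φ) := by
          have := mul_meas_ge_le_lintegral (μ := weightedVolume M φ)
            (f := fun x => ⨆ k, ENNReal.ofReal (transport G p ρ (ψ k) r x))
            (.iSup fun k => (hcont k).measurable.ennreal_ofReal) 1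
          rwa [one_mul] at this
      _ = ⨆ k, ∫⁻ x, ENNReal.ofReal (transport G p ρ (ψ k) r x) ∂(weightedVolume M φ) :=
          lintegral_iSup (fun k => (hcont k).measurable.ennreal_ofReal) hmono
      _ ≤ _ := iSup_le hk
  rw [A.measure_eq_iInf_isOpen (weightedVolume M φ), ENNReal.mul_iInf_of_ne
    (ENNReal.ofReal_pos.mpr (Real.exp_pos _)).ne' ENNReal.ofReal_ne_top]
  refine le_iInf fun O => ?_
  simp only [ENNReal.mul_iInf_of_ne (ENNReal.ofReal_pos.mpr (Real.exp_pos (Γ / φlow * r))).ne'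
    ENNReal.ofReal_ne_top]
  refine le_iInf₂ fun hAO hO => ?_
  refine (measure_mono fun x hx => ?_).trans ((hopen (O ∩ Metric.ball p (ρ / 4)) inter_subset_right
    (hO.inter Metric.isOpen_ball)).trans (mul_le_mul_right (measure_mono inter_subset_left) _))
  exact ⟨hx.1, hAO hx.2, hA hx.2⟩

/-- The starting points of the trajectories that stay in `Q` during the time interval `[0, r]` and
end in `A`. -/
def trajPreimage (M : PolytopalMesh Ω) (φ : EuclideanSpace ℝ (Fin d) → ℝ)
    (V : EuclideanSpace ℝ (Fin d) → EuclideanSpace ℝ (Fin d))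
    (Q : Set (EuclideanSpace ℝ (Fin d))) (r : ℝ) (A : Set (EuclideanSpace ℝ (Fin d))) :
    Set (EuclideanSpace ℝ (Fin d)) :=
  {x | ∃ γ, IsTraj M φ V 0 r γ ∧ (∀ s ∈ Icc 0 r, γ s ∈ Q) ∧ γ 0 = x ∧ γ r ∈ A}

theorem IsLocalFlow.weightedVolume_trajPreimage_le [Nontrivial (EuclideanSpace ℝ (Fin d))]
    (hG : IsLocalFlow M φ V p v ρ δ C G) (h : FlowAssumptions M φ V φlow φhigh Γ) (hr0 : 0 ≤ r)
    (hr : r ≤ δ) (hA : A ⊆ Metric.ball p (ρ / 4)) :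
    weightedVolume M φ (trajPreimage M φ V Q r A) ≤
      ENNReal.ofReal (Real.exp (Γ / φlow * r)) * weightedVolume M φ A := by
  refine le_trans (measure_mono ?_) (hG.weightedVolume_preimage_le h hr0 hr hA)
  rintro x ⟨γ, hγ, -, rfl, hγA⟩
  have h0 : γ 0 ∈ Metric.ball p ρ := by
    have h1 := hγ.norm_sub_le hG.velocity_le hr0
    have h2 := hA hγA
    have h3 : v * r ≤ ρ / 4 := (mul_le_mul_of_nonneg_left hr v.2).trans hG.time_le
    rw [sub_zero, ← dist_eq_norm, dist_comm] at h1
    rw [Metric.mem_ball] at h2 ⊢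
    linarith [dist_triangle (γ 0) (γ r) p, hG.radius_pos]
  exact ⟨h0, hG.eq_apply hr0 hr hγ h0 ▸ hγA⟩

theorem trajPreimage_add_subset (hr : 0 ≤ r) (hs : 0 ≤ s) :
    trajPreimage M φ V Q (r + s) A ⊆ trajPreimage M φ V Q s (trajPreimage M φ V Q r A) := by
  rintro x ⟨γ, hγ, hQ, rfl, hγA⟩
  refine ⟨γ, hγ.mono le_rfl (by linarith), fun t ht => hQ t ⟨ht.1, by linarith [ht.2]⟩, rfl,
    fun t => γ (t + s), ?_, fun t ht => hQ _ ⟨by linarith [ht.1], by linarith [ht.2]⟩,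
    by simp, hγA⟩
  have := (hγ.mono hs le_rfl).comp_add_const s
  rwa [sub_self, add_sub_cancel_right] at this

/-- Cut the time into equal short steps and multiply the exponential factors. Each intermediate
target is again an arbitrary set. -/
theorem weightedVolume_trajPreimage_le_of_step {c s₀ : ℝ} (hs₀ : 0 < s₀)
    (hstep : ∀ s, 0 ≤ s → s ≤ s₀ → ∀ A, weightedVolume M φ (trajPreimage M φ V Q s A) ≤
      ENNReal.ofReal (Real.exp (c * s)) * weightedVolume M φ A) (hr : 0 ≤ r)
    (A : Set (EuclideanSpace ℝ (Fin d))) :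
    weightedVolume M φ (trajPreimage M φ V Q r A) ≤
      ENNReal.ofReal (Real.exp (c * r)) * weightedVolume M φ A := by
  have key : ∀ (s : ℝ), 0 ≤ s → s ≤ s₀ → ∀ k : ℕ,
      weightedVolume M φ (trajPreimage M φ V Q ((k + 1 : ℕ) * s) A) ≤
        ENNReal.ofReal (Real.exp (c * ((k + 1 : ℕ) * s))) * weightedVolume M φ A := by
    intro s hs0 hs k
    induction k with
    | zero => simpa using hstep s hs0 hs A
    | succ k ih =>
      have h1 : ((k + 1 + 1 : ℕ) : ℝ) * s = (k + 1 : ℕ) * s + s := by push_cast; ring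
      rw [h1]
      refine (measure_mono (trajPreimage_add_subset (by positivity) hs0)).trans
        ((hstep s hs0 hs _).trans ((mul_le_mul_right ih _).trans (le_of_eq ?_)))
      rw [← mul_assoc, ← ENNReal.ofReal_mul (Real.exp_nonneg _), ← Real.exp_add]
      congr 3
      ring
  obtain ⟨k, hk⟩ := exists_nat_ge (r / s₀)
  have hk' : r / (k + 1 : ℕ) ≤ s₀ := by
    rw [div_le_iff₀ hs₀] at hk
    rw [div_le_iff₀ (by positivity)]
    push_cast
    linarith
  have := key (r / (k + 1 : ℕ)) (by positivity) hk' k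
  rwa [mul_div_cancel₀ r (by positivity : ((k + 1 : ℕ) : ℝ) ≠ 0)] at this

/-- A trajectory has a compact image, hence stays in one set of an increasing open exhaustion. -/
theorem trajPreimage_iUnion {Q : ℕ → Set (EuclideanSpace ℝ (Fin d))} (hQ : ∀ n, IsOpen (Q n))
    (hmono : Monotone Q) :
    trajPreimage M φ V (⋃ n, Q n) r A = ⋃ n, trajPreimage M φ V (Q n) r A := by
  refine Subset.antisymm ?_ (iUnion_subset fun n => ?_)
  · rintro x ⟨γ, hγ, hγQ, h0, hγA⟩
    obtain ⟨L, hL⟩ := hγ.lipschitz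
    obtain ⟨n, hn⟩ := (isCompact_Icc.image_of_continuousOn hL.continuousOn).elim_directed_cover Q
      hQ (by rintro _ ⟨s, hs, rfl⟩; exact hγQ s hs) hmono.directed_le
    exact mem_iUnion.mpr ⟨n, γ, hγ, fun s hs => hn ⟨s, hs, rfl⟩, h0, hγA⟩
  · rintro x ⟨γ, hγ, hγQ, h0, hγA⟩
    exact ⟨γ, hγ, fun s hs => mem_iUnion.mpr ⟨n, hγQ s hs⟩, h0, hγA⟩

/-- The lifetime of the local flow may degenerate near the boundary of the regular set. Countably
many local flows cover this set (Lindelöf), and it is exhausted by open sets `Q n` on which the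
lifetime is at least `1 / (n + 1)`. In each `Q n` the short-step argument applies, and `n` tends to
infinity. -/
theorem FlowAssumptions.weightedVolume_trajPreimage_le [Nontrivial (EuclideanSpace ℝ (Fin d))]
    (h : FlowAssumptions M φ V φlow φhigh Γ) (hr : 0 ≤ r) (A : Set (EuclideanSpace ℝ (Fin d))) :
    weightedVolume M φ (trajPreimage M φ V (regularSet M V) r A) ≤
      ENNReal.ofReal (Real.exp (Γ / φlow * r)) * weightedVolume M φ A := by
  have hloc : ∀ p ∈ regularSet M V, ∃ B, IsOpen B ∧ p ∈ B ∧ ∃ δ > 0, ∀ s, 0 ≤ s → s ≤ δ →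
      ∀ Q, ∀ A ⊆ B, weightedVolume M φ (trajPreimage M φ V Q s A) ≤
        ENNReal.ofReal (Real.exp (Γ / φlow * s)) * weightedVolume M φ A := by
    intro p hp
    obtain ⟨v, ρ, δ, C, G, hG⟩ := h.exists_isLocalFlow (h.hasLocalFlow hp)
    exact ⟨Metric.ball p (ρ / 4), Metric.isOpen_ball,
      Metric.mem_ball_self (by linarith [hG.radius_pos]), δ, hG.time_pos, fun s hs0 hs Q A hA =>
        hG.weightedVolume_trajPreimage_le h hs0 hs hA⟩
  choose! B hBo hpB δ hδ hB using hloc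
  obtain ⟨t, htR, htc, hcov⟩ := TopologicalSpace.countable_cover_nhdsWithin (s := regularSet M V)
    (f := B) fun p hp => mem_nhdsWithin_of_mem_nhds ((hBo p hp).mem_nhds (hpB p hp))
  rcases t.eq_empty_or_nonempty with rfl | hne
  · have : trajPreimage M φ V (regularSet M V) r A = ∅ := by
      refine eq_empty_of_forall_notMem ?_
      rintro x ⟨γ, -, hγ, -⟩
      simpa using hcov (hγ 0 ⟨le_rfl, hr⟩)
    rw [this, measure_empty]
    exact zero_le
  obtain ⟨p, rfl⟩ := htc.exists_eq_range hne
  have hp : ∀ i, p i ∈ regularSet M V := fun i => htR (mem_range_self i)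
  let P : ℕ → ℕ → Set (EuclideanSpace ℝ (Fin d)) := fun n i =>
    {x | 1 / ((n : ℝ) + 1) ≤ δ (p i) ∧ x ∈ B (p i)}
  let Q : ℕ → Set (EuclideanSpace ℝ (Fin d)) := fun n => ⋃ i, P n i
  have hPo : ∀ n i, IsOpen (P n i) := fun n i => isOpen_const.inter (hBo _ (hp i))
  have hQo : ∀ n, IsOpen (Q n) := fun n => isOpen_iUnion (hPo n)
  have hmono : Monotone Q := by
    intro m n hmn
    refine iUnion_mono fun i x hx => ⟨le_trans ?_ hx.1, hx.2⟩
    exact one_div_le_one_div_of_le (by positivity) (by gcongr)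
  have hRQ : regularSet M V ⊆ ⋃ n, Q n := by
    intro x hx
    obtain ⟨_, ⟨i, rfl⟩, hi⟩ := mem_iUnion₂.mp (hcov hx)
    obtain ⟨n, hn⟩ := exists_nat_one_div_lt (hδ _ (hp i))
    exact mem_iUnion.mpr ⟨n, mem_iUnion.mpr ⟨i, hn.le, hi⟩⟩
  have hn : ∀ n, weightedVolume M φ (trajPreimage M φ V (Q n) r A) ≤
      ENNReal.ofReal (Real.exp (Γ / φlow * r)) * weightedVolume M φ A := by
    intro n
    refine weightedVolume_trajPreimage_le_of_step (s₀ := 1 / ((n : ℝ) + 1)) (by positivity)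
      (fun s hs0 hs A => ?_) hr A
    -- The target is split into disjoint pieces, each inside the range of one local flow, so that
    -- the measures of the pieces add up without overlap.
    have hsub : trajPreimage M φ V (Q n) s A ⊆
        ⋃ i, trajPreimage M φ V (Q n) s (A ∩ disjointed (P n) i) := by
      rintro x ⟨γ, hγ, hγQ, h0, hγA⟩
      have h1 : γ s ∈ ⋃ i, disjointed (P n) i := by
        rw [iUnion_disjointed]
        exact hγQ s ⟨hs0, le_rfl⟩
      obtain ⟨i, hi⟩ := mem_iUnion.mp h1
      exact mem_iUnion.mpr ⟨i, γ, hγ, hγQ, h0, hγA, hi⟩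
    have hmeas : ∀ i, MeasurableSet (disjointed (P n) i) :=
      MeasurableSet.disjointed fun i => (hPo n i).measurableSet
    calc weightedVolume M φ (trajPreimage M φ V (Q n) s A)
        ≤ ∑' i, weightedVolume M φ (trajPreimage M φ V (Q n) s (A ∩ disjointed (P n) i)) :=
          (measure_mono hsub).trans (measure_iUnion_le _)
      -- The set `A` need not be measurable. Restricting the measure to `A` and evaluating it on the
      -- measurable pieces restores countable additivity.
      _ ≤ ∑' i, ENNReal.ofReal (Real.exp (Γ / φlow * s)) *
          (weightedVolume M φ).restrict A (disjointed (P n) i) := by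
          refine ENNReal.tsum_le_tsum fun i => ?_
          rw [Measure.restrict_apply (hmeas i), inter_comm (disjointed _ _)]
          by_cases hi : 1 / ((n : ℝ) + 1) ≤ δ (p i)
          · exact hB _ (hp i) s hs0 (hs.trans hi) _ _ fun x hx => (disjointed_subset _ _ hx.2).2
          · have hempty : A ∩ disjointed (P n) i = ∅ := eq_empty_of_forall_notMem fun x hx =>
              hi (disjointed_subset _ _ hx.2).1
            have hempty' : trajPreimage M φ V (Q n) s (A ∩ disjointed (P n) i) = ∅ := by
              rw [hempty]
              exact eq_empty_of_forall_notMem fun x ⟨γ, hγ⟩ => hγ.2.2.2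
            rw [hempty', measure_empty]
            exact zero_le
      _ = ENNReal.ofReal (Real.exp (Γ / φlow * s)) *
          (weightedVolume M φ).restrict A (⋃ i, disjointed (P n) i) := by
          rw [ENNReal.tsum_mul_left, measure_iUnion (disjoint_disjointed _) hmeas]
      _ ≤ _ := by
          refine mul_le_mul_right ((measure_mono (subset_univ _)).trans (le_of_eq ?_)) _
          exact Measure.restrict_apply_univ A
  calc weightedVolume M φ (trajPreimage M φ V (regularSet M V) r A)
      ≤ weightedVolume M φ (trajPreimage M φ V (⋃ n, Q n) r A) :=
        measure_mono fun x ⟨γ, hγ, hγQ, h⟩ => ⟨γ, hγ, fun s hs => hRQ (hγQ s hs), h⟩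
    _ = ⨆ n, weightedVolume M φ (trajPreimage M φ V (Q n) r A) := by
        rw [trajPreimage_iUnion hQo hmono]
        refine Monotone.measure_iUnion fun m n hmn => ?_
        rintro x ⟨γ, hγ, hγQ, h⟩
        exact ⟨γ, hγ, fun s hs => hmono hmn (hγQ s hs), h⟩
    _ ≤ _ := iSup_le hn

end GlobalCompression

/-! ### Surface measure on hyperplanes and Fubini's theorem -/

section Layers

variable {d : ℕ} {n y : EuclideanSpace ℝ (Fin d)} {c : ℝ}

theorem finrank_orthogonal_span_singleton_eq (hn : ‖n‖ = 1) :
    Module.finrank ℝ (ℝ ∙ n)ᗮ = d - 1 := by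
  have hn0 : n ≠ 0 := fun h => by simp [h] at hn
  have h1 := (ℝ ∙ n).finrank_add_finrank_orthogonal
  rw [finrank_span_singleton hn0, finrank_euclideanSpace_fin] at h1
  omega

/-- The parametrization of a hyperplane by the orthogonal complement of its normal vector. -/
def hyperplaneParam (n : EuclideanSpace ℝ (Fin d)) (c : ℝ) (w : (ℝ ∙ n)ᗮ) :
    EuclideanSpace ℝ (Fin d) :=
  (w : EuclideanSpace ℝ (Fin d)) + c • n

theorem isometry_hyperplaneParam (n : EuclideanSpace ℝ (Fin d)) (c : ℝ) :
    Isometry (hyperplaneParam n c) :=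
  Isometry.of_dist_eq fun x y => by simp [hyperplaneParam, Subtype.dist_eq]

theorem range_hyperplaneParam (hn : ‖n‖ = 1) : range (hyperplaneParam n c) = hyperplane n c := by
  have hnn : ⟪n, n⟫ = 1 := by rw [real_inner_self_eq_norm_sq, hn, one_pow]
  ext x
  constructor
  · rintro ⟨w, rfl⟩
    have hw : ⟪n, (w : EuclideanSpace ℝ (Fin d))⟫ = 0 :=
      Submodule.mem_orthogonal_singleton_iff_inner_right.mp w.2
    simp [hyperplane, hyperplaneParam, inner_add_right, inner_smul_right, hw, hn]
  · intro hx
    have hx' : ⟪n, x⟫ = c := hx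
    refine ⟨⟨x - c • n, Submodule.mem_orthogonal_singleton_iff_inner_right.mpr ?_⟩, ?_⟩
    · rw [inner_sub_right, inner_smul_right, hx', hnn, mul_one, sub_self]
    · simp [hyperplaneParam]

theorem map_hyperplaneParam (hn : ‖n‖ = 1) :
    (volume : Measure (ℝ ∙ n)ᗮ).map (hyperplaneParam n c) =
      μHE[d - 1].restrict (hyperplane n c) := by
  rw [← InnerProductSpace.euclideanHausdorffMeasure_eq_volume,
    finrank_orthogonal_span_singleton_eq hn,
    (isometry_hyperplaneParam n c).map_euclideanHausdorffMeasure,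
    range_hyperplaneParam hn]

theorem euclideanHausdorffMeasure_lt_top (hn : ‖n‖ = 1) {Y : Set (EuclideanSpace ℝ (Fin d))}
    (hY : Bornology.IsBounded Y) (hYc : Y ⊆ hyperplane n c) : μHE[d - 1] Y < ⊤ := by
  have h1 : μHE[d - 1] Y = (volume : Measure (ℝ ∙ n)ᗮ) (hyperplaneParam n c ⁻¹' Y) := by
    rw [← InnerProductSpace.euclideanHausdorffMeasure_eq_volume,
      finrank_orthogonal_span_singleton_eq hn,
      (isometry_hyperplaneParam n c).euclideanHausdorffMeasure_preimage, range_hyperplaneParam hn,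
      inter_eq_left.mpr hYc]
  rw [h1]
  exact ((isometry_hyperplaneParam n c).antilipschitz.isBounded_preimage hY).measure_lt_top

/-- Fubini's theorem for the fibres orthogonal to a hyperplane. -/
theorem volume_eq_lintegral_hyperplane (hn : ‖n‖ = 1) (c : ℝ)
    {t : Set (EuclideanSpace ℝ (Fin d))} (ht : MeasurableSet t) :
    volume t = ∫⁻ y in hyperplane n c, volume {a : ℝ | y + a • n ∈ t} ∂μHE[d - 1] := by
  have hmeas : Measurable fun y : EuclideanSpace ℝ (Fin d) => volume {a : ℝ | y + a • n ∈ t} := by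
    have h1 : Measurable fun z : EuclideanSpace ℝ (Fin d) × ℝ => z.1 + z.2 • n := by fun_prop
    exact measurable_measure_prodMk_left (h1 ht)
  rw [← map_hyperplaneParam hn,
    lintegral_map hmeas (isometry_hyperplaneParam n c).continuous.measurable]
  have h1 := (ℝ ∙ n).measurePreserving_measurableEquivProd (c • n)
  rw [InnerProductSpace.euclideanHausdorffMeasure_eq_volume] at h1
  rw [← h1.symm.measure_preimage_equiv, Measure.volume_eq_prod,
    Measure.prod_apply_symm ((MeasurableEquiv.measurable _) ht)]
  congr 1
  ext w
  rw [← (LinearIsometryEquiv.toSpanUnitSingleton n hn).measurePreserving.measure_preimage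
    (measurableSet_preimage measurable_prodMk_right
      ((MeasurableEquiv.measurable _) ht)).nullMeasurableSet]
  congr 1
  ext a
  simp only [mem_preimage, Submodule.measurableEquivProd_symm_apply, vadd_eq_add,
    LinearIsometryEquiv.toSpanUnitSingleton_apply, hyperplaneParam, Set.mem_ofPred_eq]
  rw [add_assoc, add_comm]

end Layers

/-! ### Volume of thin layers over a flat compact set -/

section LayerEstimate

variable {d : ℕ} {n y : EuclideanSpace ℝ (Fin d)} {c : ℝ}

/-- Points of `S h` are at heights between `-h α` and `h β` above points of `Y`, but their
orthogonal projections may fall outside `Y`, at distance `O(h)`. Enlarge `Y` slightly, compare `α`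
and `β` at the two base points by uniform continuity, and integrate the thickness by Fubini. -/
theorem eventually_volume_layer_le (hn : ‖n‖ = 1) {Y : Set (EuclideanSpace ℝ (Fin d))}
    (hY : IsCompact Y) (hYc : Y ⊆ hyperplane n c) {α β : EuclideanSpace ℝ (Fin d) → ℝ}
    (hα : Continuous α) (hβ : Continuous β) (hα0 : ∀ y, 0 ≤ α y) (hβ0 : ∀ y, 0 ≤ β y) (v : NNReal)
    {S : ℝ → Set (EuclideanSpace ℝ (Fin d))}
    (hS : ∀ ε > 0, ∀ᶠ h in 𝓝[>] (0 : ℝ), ∀ z ∈ S h, ∃ y ∈ Y, ‖z - y‖ ≤ v * h ∧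
      -(h * (α y + ε)) ≤ ⟪n, z - y⟫ ∧ ⟪n, z - y⟫ ≤ h * (β y + ε)) {b : ENNReal}
    (hb : ∫⁻ y in Y, ENNReal.ofReal (α y + β y) ∂μHE[d - 1] < b) :
    ∀ᶠ h in 𝓝[>] (0 : ℝ), volume (S h) ≤ ENNReal.ofReal h * b := by
  have hμY := euclideanHausdorffMeasure_lt_top hn hY.isBounded hYc
  have hcont : ∀ ε : ℝ, Continuous fun y => α y + β y + 4 * ε := fun ε => by fun_prop
  -- On each side of the hyperplane one `ε` comes from `hS` and one from the change of base point.
  obtain ⟨ε, hε, hεb⟩ : ∃ ε > 0, ∫⁻ y in Y, ENNReal.ofReal (α y + β y + 4 * ε) ∂μHE[d - 1] < b := by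
    have h1 : Tendsto (fun ε : ℝ => ∫⁻ y in Y, ENNReal.ofReal (α y + β y) ∂μHE[d - 1] +
        ENNReal.ofReal (4 * ε) * μHE[d - 1] Y) (𝓝[>] 0)
        (𝓝 (∫⁻ y in Y, ENNReal.ofReal (α y + β y) ∂μHE[d - 1] +
          ENNReal.ofReal (4 * 0) * μHE[d - 1] Y)) := by
      refine Tendsto.const_add _ (ENNReal.Tendsto.mul_const ?_ (Or.inr hμY.ne))
      have : Continuous fun ε : ℝ => ENNReal.ofReal (4 * ε) :=
        ENNReal.continuous_ofReal.comp (by fun_prop)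
      exact (this.tendsto 0).mono_left nhdsWithin_le_nhds
    rw [mul_zero, ENNReal.ofReal_zero, zero_mul, add_zero] at h1
    obtain ⟨ε, hε, hε0⟩ := ((h1.eventually (gt_mem_nhds hb)).and self_mem_nhdsWithin).exists
    refine ⟨ε, hε0, lt_of_le_of_lt (le_of_eq ?_) hε⟩
    have hε0' : (0 : ℝ) < ε := hε0
    have h2 : ∀ y, ENNReal.ofReal (α y + β y + 4 * ε) =
        ENNReal.ofReal (α y + β y) + ENNReal.ofReal (4 * ε) := fun y =>
      ENNReal.ofReal_add (add_nonneg (hα0 y) (hβ0 y)) (by positivity)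
    simp_rw [h2]
    rw [lintegral_add_right _ measurable_const, setLIntegral_const]
  let ν : Measure (EuclideanSpace ℝ (Fin d)) := (μHE[d - 1].restrict (hyperplane n c)).withDensity
    fun y => ENNReal.ofReal (α y + β y + 4 * ε)
  have hYthick : IsCompact (Metric.cthickening 1 Y) := hY.cthickening
  have hfin : ν (Metric.cthickening 1 Y) ≠ ⊤ := by
    obtain ⟨B, hB⟩ := hYthick.exists_bound_of_continuousOn (hcont ε).continuousOn
    rw [withDensity_apply _ hYthick.measurableSet, Measure.restrict_restrict hYthick.measurableSet]
    refine ((setLIntegral_mono measurable_const fun y hy => ENNReal.ofReal_le_ofReal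
      ((le_abs_self _).trans (hB y hy.1))).trans_lt ?_).ne
    rw [setLIntegral_const]
    exact ENNReal.mul_lt_top ENNReal.ofReal_lt_top (euclideanHausdorffMeasure_lt_top hn
      (hYthick.isBounded.subset inter_subset_left) inter_subset_right)
  have hνY : ν Y < b := by
    rwa [withDensity_apply _ hY.measurableSet, Measure.restrict_restrict hY.measurableSet,
      inter_eq_left.mpr hYc]
  -- The closed thickenings decrease to the closed set `Y`, and their `ν`-measures are finite, so
  -- the strict bound survives a small enlargement.
  obtain ⟨r, hrb, hr0, hr1⟩ : ∃ r, ν (Metric.cthickening r Y) < b ∧ 0 < r ∧ r < 1 := by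
    have h1 := (tendsto_measure_cthickening_of_isClosed (μ := ν) ⟨1, one_pos, hfin⟩
      hY.isClosed).mono_left (nhdsWithin_le_nhds (s := Ioi 0))
    have h2 : ∀ᶠ r : ℝ in 𝓝[>] 0, r < 1 := nhdsWithin_le_nhds (gt_mem_nhds one_pos)
    obtain ⟨r, hr, hr', hr0⟩ := ((h1.eventually (gt_mem_nhds hνY)).and
      (h2.and self_mem_nhdsWithin)).exists
    exact ⟨r, hr, hr0, hr'⟩
  have hcomp : IsCompact (Metric.cthickening r Y) := hY.cthickening
  obtain ⟨δ₁, hδ₁, hα'⟩ := Metric.uniformContinuousOn_iff.mp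
    (hcomp.uniformContinuousOn_of_continuous hα.continuousOn) ε hε
  obtain ⟨δ₂, hδ₂, hβ'⟩ := Metric.uniformContinuousOn_iff.mp
    (hcomp.uniformContinuousOn_of_continuous hβ.continuousOn) ε hε
  have hsmall : ∀ᶠ h : ℝ in 𝓝[>] 0, 2 * (v * h) < min r (min δ₁ δ₂) := by
    have : Continuous fun h : ℝ => 2 * ((v : ℝ) * h) := by fun_prop
    exact nhdsWithin_le_nhds (this.continuousAt.eventually
      (gt_mem_nhds (by simp [hr0, hδ₁, hδ₂])))
  filter_upwards [hS ε hε, hsmall, self_mem_nhdsWithin] with h hSh hh hh0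
  have hh0' : (0 : ℝ) < h := hh0
  -- Here `a z` is the height of `z` above the hyperplane and `w z` its orthogonal projection.
  let a : EuclideanSpace ℝ (Fin d) → ℝ := fun z => ⟪n, z⟫ - c
  let w : EuclideanSpace ℝ (Fin d) → EuclideanSpace ℝ (Fin d) := fun z => z - a z • n
  have ha : Continuous a := by fun_prop
  have hw : Continuous w := by fun_prop
  let t : Set (EuclideanSpace ℝ (Fin d)) := {z | w z ∈ Metric.cthickening r Y ∧
    -(h * (α (w z) + 2 * ε)) ≤ a z ∧ a z ≤ h * (β (w z) + 2 * ε)}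
  have ht : IsClosed t := (Metric.isClosed_cthickening.preimage hw).inter
    ((isClosed_le (((hα.comp hw).add continuous_const).const_mul h).neg ha).inter
      (isClosed_le ha (((hβ.comp hw).add continuous_const).const_mul h)))
  have hSt : S h ⊆ t := by
    intro z hz
    obtain ⟨y, hy, hzy, h1, h2⟩ := hSh z hz
    have haz : a z = ⟪n, z - y⟫ := by
      have : ⟪n, y⟫ = c := hYc hy
      simp only [a, inner_sub_right, this]
    have hdist : dist (w z) y ≤ 2 * (v * h) := by
      have h3 : |⟪n, z - y⟫| ≤ v * h := by
        have := abs_real_inner_le_norm n (z - y)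
        rw [hn, one_mul] at this
        exact this.trans hzy
      rw [dist_eq_norm]
      calc ‖z - a z • n - y‖ = ‖(z - y) - a z • n‖ := by congr 1; abel
        _ ≤ ‖z - y‖ + ‖a z • n‖ := norm_sub_le _ _
        _ ≤ v * h + v * h := by
          rw [norm_smul, hn, mul_one, Real.norm_eq_abs, haz]
          exact add_le_add hzy h3
        _ = 2 * (v * h) := by ring
    have hwr : w z ∈ Metric.cthickening r Y := Metric.mem_cthickening_of_dist_le _ y _ _ hy
      (hdist.trans (hh.le.trans (min_le_left _ _)))
    have hyr : y ∈ Metric.cthickening r Y := Metric.self_subset_cthickening _ hy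
    have e1 := hα' _ hwr _ hyr (hdist.trans_lt (hh.trans_le ((min_le_right _ _).trans
      (min_le_left _ _))))
    have e2 := hβ' _ hwr _ hyr (hdist.trans_lt (hh.trans_le ((min_le_right _ _).trans
      (min_le_right _ _))))
    rw [Real.dist_eq] at e1 e2
    refine ⟨hwr, ?_, ?_⟩ <;> rw [haz]
    · refine le_trans (neg_le_neg (mul_le_mul_of_nonneg_left ?_ hh0'.le)) h1
      linarith [(abs_lt.mp e1).1]
    · refine h2.trans (mul_le_mul_of_nonneg_left ?_ hh0'.le)
      linarith [(abs_lt.mp e2).1]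
  have hnn : ⟪n, n⟫ = 1 := by rw [real_inner_self_eq_norm_sq, hn, one_pow]
  calc volume (S h) ≤ volume t := measure_mono hSt
    _ = ∫⁻ y in hyperplane n c, volume {s : ℝ | y + s • n ∈ t} ∂μHE[d - 1] :=
        volume_eq_lintegral_hyperplane hn c ht.measurableSet
    _ ≤ ∫⁻ y in hyperplane n c, (Metric.cthickening r Y).indicator
        (fun y => ENNReal.ofReal h * ENNReal.ofReal (α y + β y + 4 * ε)) y ∂μHE[d - 1] := by
        refine setLIntegral_mono' (isClosed_hyperplane n c).measurableSet fun y hy => ?_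
        have hy' : ⟪n, y⟫ = c := hy
        have has : ∀ s : ℝ, a (y + s • n) = s := fun s => by
          simp only [a, inner_add_right, inner_smul_right, hnn, hy']
          ring
        have hws : ∀ s : ℝ, w (y + s • n) = y := fun s => by
          simp only [w, has, add_sub_cancel_right]
        by_cases hyr : y ∈ Metric.cthickening r Y
        · rw [indicator_of_mem hyr, ← ENNReal.ofReal_mul hh0'.le]
          have hset : {s : ℝ | y + s • n ∈ t} = Icc (-(h * (α y + 2 * ε))) (h * (β y + 2 * ε)) := by
            ext s
            simp only [t, Set.mem_ofPred_eq, has, hws, mem_Icc]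
            tauto
          rw [hset, Real.volume_Icc]
          refine le_of_eq ?_
          congr 1
          ring
        · have hset : {s : ℝ | y + s • n ∈ t} = ∅ := by
            ext s
            simp only [t, Set.mem_ofPred_eq, hws, mem_empty_iff_false, iff_false]
            tauto
          rw [hset, measure_empty]
          exact zero_le
    _ = ENNReal.ofReal h * ν (Metric.cthickening r Y) := by
        rw [lintegral_indicator hcomp.measurableSet, lintegral_const_mul _
          (hcont ε).measurable.ennreal_ofReal, withDensity_apply _ hcomp.measurableSet]
    _ ≤ ENNReal.ofReal h * b := by gcongr

end LayerEstimate

/-! ### Volume of the set of points that reach a face in a short time -/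

section Arrival

variable {d : ℕ} {Ω : Set (EuclideanSpace ℝ (Fin d))}
  {M : PolytopalMesh Ω} {φ : EuclideanSpace ℝ (Fin d) → ℝ}
  {V : EuclideanSpace ℝ (Fin d) → EuclideanSpace ℝ (Fin d)} {φlow φhigh Γ : ℝ}
  {σ K L Y : Set (EuclideanSpace ℝ (Fin d))} {n y : EuclideanSpace ℝ (Fin d)} {h : ℝ}

/-- The starting points of the trajectories that reach `Y` within the time `h`. -/
def arrivalSet (M : PolytopalMesh Ω) (φ : EuclideanSpace ℝ (Fin d) → ℝ)
    (V : EuclideanSpace ℝ (Fin d) → EuclideanSpace ℝ (Fin d))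
    (Y : Set (EuclideanSpace ℝ (Fin d))) (h : ℝ) : Set (EuclideanSpace ℝ (Fin d)) :=
  {x | ∃ s γ, 0 ≤ s ∧ s ≤ h ∧ IsTraj M φ V 0 s γ ∧ γ 0 = x ∧ γ s ∈ Y}

theorem FlowAssumptions.inner_extendFrom_eq_of_adjacent (hF : FlowAssumptions M φ V φlow φhigh Γ)
    (hσ : σ ∈ M.faces) (hn : IsUnitNormal σ n) (hy : y ∈ σ) (hyb : y ∉ M.skeleton)
    (hK : K ∈ M.cells) (hL : L ∈ M.cells) (hσK : σ ⊆ frontier K) (hσL : σ ⊆ frontier L) :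
    ⟪n, extendFrom K V y⟫ = ⟪n, extendFrom L V y⟫ := by
  rcases M.face_cells σ hσ with h' | h'
  · exact hF.inner_extendFrom_eq hσ h'.1 hn hy hyb hK hL hσK hσL
  · obtain ⟨K₀, hK₀⟩ := ncard_eq_one.mp h'.2
    have h1 : K ∈ ({K₀} : Set (Set (EuclideanSpace ℝ (Fin d)))) := hK₀ ▸ ⟨hK, hσK⟩
    have h2 : L ∈ ({K₀} : Set (Set (EuclideanSpace ℝ (Fin d)))) := hK₀ ▸ ⟨hL, hσL⟩
    rw [mem_singleton_iff] at h1 h2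
    rw [h1, h2]

/-- Near a point of `σ` off the skeleton, every visible cell is adjacent to `σ` and sees the same
normal component `q` there; compactness of `Y` gives a uniform radius. The porosity seen from the
cell is replaced by `φlow`, which is an upper bound only for nonnegative quantities, hence the
positive and negative parts. -/
theorem FlowAssumptions.exists_inner_velocity_bound (hF : FlowAssumptions M φ V φlow φhigh Γ)
    (hσ : σ ∈ M.faces) (hn : IsUnitNormal σ n) (hK : K ∈ M.cells) (hσK : σ ⊆ frontier K)
    {q : EuclideanSpace ℝ (Fin d) → ℝ} (hq : Continuous q)
    (hqσ : ∀ y ∈ σ, q y = ⟪n, extendFrom K V y⟫) (hY : IsCompact Y) (hYσ : Y ⊆ σ)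
    (hYb : Disjoint Y M.skeleton) {ε : ℝ} (hε : 0 < ε) :
    ∃ r > 0, ∀ y ∈ Y, ∀ K' ∈ M.cells, ∀ x ∈ closure K', x ∈ Metric.ball y r →
      -((max (-q y) 0) / φlow + ε) ≤ ⟪n, velocity φ V K' x⟫ ∧
        ⟪n, velocity φ V K' x⟫ ≤ (max (q y) 0) / φlow + ε := by
  have hl := hF.φlow_pos
  have hloc : ∀ y₀ ∈ Y, ∃ r > 0, ∀ x ∈ Metric.ball y₀ r, |q x - q y₀| < φlow * ε / 2 ∧
      ∀ K' ∈ M.cells, x ∈ closure K' → |⟪n, extendFrom K' V x⟫ - q y₀| < φlow * ε / 2 := by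
    intro y₀ hy₀
    have hy₀b := Set.disjoint_left.mp hYb hy₀
    have hη : 0 < φlow * ε / 2 := by positivity
    have h1 : ∀ᶠ x in 𝓝 y₀, |q x - q y₀| < φlow * ε / 2 := by
      have := hq.continuousAt.eventually (Metric.ball_mem_nhds (q y₀) hη)
      simpa [Real.dist_eq] using this
    have h2 : ∀ᶠ x in 𝓝 y₀, ∀ K' ∈ M.cells, x ∈ closure K' →
        |⟪n, extendFrom K' V x⟫ - q y₀| < φlow * ε / 2 := by
      refine (eventually_all_finite M.finite_cells).mpr fun K' hK' => ?_
      by_cases hyK : y₀ ∈ closure K'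
      · obtain ⟨c, hc⟩ := hn.2
        obtain ⟨ρ, hρ, -, hball⟩ := M.exists_ball_at_face hσ hn hc (hYσ hy₀) hy₀b
        have hσK' := (hball K' hK' ⟨y₀, hyK, Metric.mem_ball_self hρ⟩).1
        obtain ⟨f, P, -, hP, -, hcl⟩ := hF.exists_extension hK'
        have hPn : Continuous fun x => ⟪n, P x⟫ := continuous_const.inner hP.continuous
        have hP₀ : ⟪n, P y₀⟫ = q y₀ := by
          rw [← (hcl y₀ hyK).2.1, hqσ y₀ (hYσ hy₀)]
          exact hF.inner_extendFrom_eq_of_adjacent hσ hn (hYσ hy₀) hy₀b hK' hK hσK' hσK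
        have := hPn.continuousAt.eventually (Metric.ball_mem_nhds (⟪n, P y₀⟫) hη)
        filter_upwards [this] with x hx hxK
        have hx' : dist ⟪n, P x⟫ ⟪n, P y₀⟫ < φlow * ε / 2 := hx
        rwa [hP₀, Real.dist_eq, ← (hcl x hxK).2.1] at hx'
      · filter_upwards [isClosed_closure.isOpen_compl.mem_nhds hyK] with x hx hx'
        exact absurd hx' hx
    exact Metric.eventually_nhds_iff_ball.mp (h1.and h2)
  choose! r hr hball using hloc
  obtain ⟨δ, hδ, hleb⟩ := lebesgue_number_lemma_of_metric (s := Y) (ι := Y) hY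
    (c := fun y₀ => Metric.ball y₀ (r y₀)) (fun _ => Metric.isOpen_ball)
    fun y hy => mem_iUnion.mpr ⟨⟨y, hy⟩, Metric.mem_ball_self (hr y hy)⟩
  refine ⟨δ, hδ, fun y hy K' hK' x hxK hx => ?_⟩
  obtain ⟨⟨y₀, hy₀⟩, hsub⟩ := hleb y hy
  have h1 := abs_lt.mp (hball y₀ hy₀ y (hsub (Metric.mem_ball_self hδ))).1
  have h2 := abs_lt.mp ((hball y₀ hy₀ x (hsub hx)).2 K' hK' hxK)
  obtain ⟨f, P, -, -, -, hcl⟩ := hF.exists_extension hK'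
  have hf : φlow ≤ extendFrom K' φ x := by
    rw [(hcl x hxK).1]
    exact (hcl x hxK).2.2.1
  have hf0 : 0 < extendFrom K' φ x := hl.trans_le hf
  have aux : ∀ a b : ℝ, a ≤ b + φlow * ε → (extendFrom K' φ x)⁻¹ * a ≤ max b 0 / φlow + ε := by
    intro a b hab
    calc (extendFrom K' φ x)⁻¹ * a ≤ (extendFrom K' φ x)⁻¹ * (max b 0 + φlow * ε) := by
          gcongr
          exact hab.trans (by gcongr; exact le_max_left _ _)
      _ ≤ φlow⁻¹ * (max b 0 + φlow * ε) := by
          have : 0 ≤ max b 0 := le_max_right _ _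
          gcongr
      _ = max b 0 / φlow + ε := by field_simp
  rw [velocity, inner_smul_right]
  constructor
  · have := aux (-⟪n, extendFrom K' V x⟫) (-q y) (by linarith [h1.1, h2.1, h1.2, h2.2])
    linarith
  · exact aux _ _ (by linarith [h1.1, h2.2])

theorem IsTraj.inner_sub_le {a b c : ℝ} {γ : ℝ → EuclideanSpace ℝ (Fin d)}
    (hγ : IsTraj M φ V a b γ) (hab : a ≤ b) (m : EuclideanSpace ℝ (Fin d))
    (hc : ∀ K ∈ M.cells, ∀ r ∈ Icc a b, γ r ∈ closure K → ⟪m, velocity φ V K (γ r)⟫ ≤ c) :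
    ⟪m, γ b - γ a⟫ ≤ c * (b - a) := by
  obtain ⟨L, hL⟩ := hγ.lipschitz
  obtain ⟨N, hN, hd⟩ := hγ.hasDerivAt
  rw [inner_sub_right]
  refine sub_le_of_hasDerivAt_le_off_countable (f := fun t => ⟪m, γ t⟫) hab
    (lipschitzOnWith_inner_left m hL) hN fun t ht => ?_
  obtain ⟨K, hK, hm, hd'⟩ := hd t ht
  exact ⟨_, hasDerivAt_inner_left m hd', hc K hK t (Ioo_subset_Icc_self ht.1) hm⟩

/-- A start is found by going back from its arrival point. Positive normal velocity puts it below
the face and negative velocity above it, so the layer has depths governed by the positive and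
negative parts of `q`, and total thickness `h |q| / φlow`. -/
theorem FlowAssumptions.eventually_volume_arrivalSet_le_of_disjoint
    (hF : FlowAssumptions M φ V φlow φhigh Γ)
    (hσ : σ ∈ M.faces) (hn : IsUnitNormal σ n) (hK : K ∈ M.cells) (hσK : σ ⊆ frontier K)
    {q : EuclideanSpace ℝ (Fin d) → ℝ} (hq : Continuous q)
    (hqσ : ∀ y ∈ σ, q y = ⟪n, extendFrom K V y⟫) (hY : IsCompact Y) (hYσ : Y ⊆ σ)
    (hYb : Disjoint Y M.skeleton) {b : ENNReal}
    (hb : ∫⁻ y in Y, ENNReal.ofReal (|q y| / φlow) ∂μHE[d - 1] < b) :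
    ∀ᶠ h in 𝓝[>] (0 : ℝ), volume (arrivalSet M φ V Y h) ≤ ENNReal.ofReal h * b := by
  obtain ⟨v, hv0, hv⟩ := hF.exists_velocity_bound
  obtain ⟨c, hc⟩ := hn.2
  have hl := hF.φlow_pos
  refine eventually_volume_layer_le hn.1 hY (hYσ.trans hc) (α := fun y => max (q y) 0 / φlow)
    (β := fun y => max (-q y) 0 / φlow) ((hq.max continuous_const).div_const _)
    ((hq.neg.max continuous_const).div_const _) (fun y => by positivity) (fun y => by positivity)
    v (fun ε hε => ?_) ?_
  · obtain ⟨r, hr, hball⟩ := hF.exists_inner_velocity_bound hσ hn hK hσK hq hqσ hY hYσ hYb hε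
    have hsmall : ∀ᶠ h : ℝ in 𝓝[>] 0, v * h < r := by
      have : Continuous fun h : ℝ => (v : ℝ) * h := by fun_prop
      exact nhdsWithin_le_nhds (this.continuousAt.eventually (gt_mem_nhds (by simpa using hr)))
    filter_upwards [hsmall] with h hh
    rintro _ ⟨s, γ, hs0, hsh, hγ, rfl, hγY⟩
    have hmem : ∀ t ∈ Icc 0 s, γ t ∈ Metric.ball (γ s) r := by
      intro t ht
      rw [Metric.mem_ball, dist_comm, dist_eq_norm]
      refine ((hγ.mono ht.1 le_rfl).norm_sub_le hv ht.2).trans_lt (lt_of_le_of_lt ?_ hh)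
      gcongr
      linarith [ht.1]
    refine ⟨γ s, hγY, ?_, ?_, ?_⟩
    · rw [norm_sub_rev]
      refine (hγ.norm_sub_le hv hs0).trans ?_
      gcongr
      linarith
    · have h1 := hγ.inner_sub_le hs0 n fun K' hK' t ht htK =>
        (hball _ hγY K' hK' _ htK (hmem t ht)).2
      have h2 : (max (q (γ s)) 0 / φlow + ε) * (s - 0) ≤ h * (max (q (γ s)) 0 / φlow + ε) := by
        rw [sub_zero, mul_comm]
        have : 0 ≤ max (q (γ s)) 0 := le_max_right _ _
        gcongr
      rw [← neg_sub (γ s), inner_neg_right]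
      linarith
    · have h1 := hγ.inner_sub_le hs0 (-n) fun K' hK' t ht htK => by
        rw [inner_neg_left]
        exact neg_le.mp (hball _ hγY K' hK' _ htK (hmem t ht)).1
      have h2 : (max (-q (γ s)) 0 / φlow + ε) * (s - 0) ≤ h * (max (-q (γ s)) 0 / φlow + ε) := by
        rw [sub_zero, mul_comm]
        have : 0 ≤ max (-q (γ s)) 0 := le_max_right _ _
        gcongr
      rw [← neg_sub (γ s), inner_neg_right, ← inner_neg_left]
      linarith
  · refine lt_of_le_of_lt (le_of_eq ?_) hb
    congr 1
    ext y
    rw [← add_div]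
    congr 2
    rcases le_total 0 (q y) with h0 | h0
    · rw [max_eq_left h0, max_eq_right (by linarith), abs_of_nonneg h0, add_zero]
    · rw [max_eq_right h0, max_eq_left (by linarith), abs_of_nonpos h0, zero_add]

/-- A crude bound with the full speed on both sides, meant for arrival sets close to the skeleton,
where nothing is known on the normal component but the surface measure is small. -/
theorem FlowAssumptions.eventually_volume_arrivalSet_le_of_velocity_le
    {v : NNReal} (hv : ∀ K ∈ M.cells, ∀ y ∈ closure K, ‖velocity φ V K y‖ ≤ v)
    (hn : ‖n‖ = 1) {c : ℝ} (hY : IsCompact Y) (hYc : Y ⊆ hyperplane n c) {b : ENNReal}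
    (hb : ENNReal.ofReal (v + v) * μHE[d - 1] Y < b) :
    ∀ᶠ h in 𝓝[>] (0 : ℝ), volume (arrivalSet M φ V Y h) ≤ ENNReal.ofReal h * b := by
  refine eventually_volume_layer_le hn hY hYc (α := fun _ => v) (β := fun _ => v)
    continuous_const continuous_const (fun _ => v.2) (fun _ => v.2) v (fun ε hε => ?_)
    (by rwa [setLIntegral_const])
  filter_upwards [self_mem_nhdsWithin] with h hh
  have hh' : (0 : ℝ) < h := hh
  rintro _ ⟨s, γ, hs0, hsh, hγ, rfl, hγY⟩
  have h1 : ‖γ 0 - γ s‖ ≤ v * h := by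
    rw [norm_sub_rev]
    refine (hγ.norm_sub_le hv hs0).trans ?_
    gcongr
    linarith
  have h2 : |⟪n, γ 0 - γ s⟫| ≤ h * (v + ε) := by
    have := abs_real_inner_le_norm n (γ 0 - γ s)
    rw [hn, one_mul] at this
    nlinarith
  exact ⟨γ s, hγY, h1, (abs_le.mp h2).1, (abs_le.mp h2).2⟩

theorem PolytopalMesh.measure_skeleton (M : PolytopalMesh Ω) : μHE[d - 1] M.skeleton = 0 :=
  (measure_biUnion_null_iff M.finite_faces.countable).mpr M.face_boundary_null

/-- The set `Y` is cut into a part away from the skeleton, with the sharp bound `b₁`, and a part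
near it whose crude bound fits into the slack `b - b₁`. -/
theorem FlowAssumptions.eventually_volume_arrivalSet_le
    (hF : FlowAssumptions M φ V φlow φhigh Γ)
    (hσ : σ ∈ M.faces) (hn : IsUnitNormal σ n) (hK : K ∈ M.cells) (hσK : σ ⊆ frontier K)
    {q : EuclideanSpace ℝ (Fin d) → ℝ} (hq : Continuous q)
    (hqσ : ∀ y ∈ σ, q y = ⟪n, extendFrom K V y⟫) (hY : IsCompact Y) (hYσ : Y ⊆ closure σ)
    {b : ENNReal} (hb : ∫⁻ y in Y, ENNReal.ofReal (|q y| / φlow) ∂μHE[d - 1] < b) :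
    ∀ᶠ h in 𝓝[>] (0 : ℝ), volume (arrivalSet M φ V Y h) ≤ ENNReal.ofReal h * b := by
  obtain ⟨v, hv0, hv⟩ := hF.exists_velocity_bound
  obtain ⟨c, hc⟩ := hn.2
  have hYc : Y ⊆ hyperplane n c := hYσ.trans (closure_minimal hc (isClosed_hyperplane n c))
  have hμY := euclideanHausdorffMeasure_lt_top hn.1 hY.isBounded hYc
  obtain ⟨b₁, hb₁, hb₁b⟩ := exists_between hb
  have hb₂ : 0 < b - b₁ := tsub_pos_of_lt hb₁b
  -- The closed thickenings of the skeleton decrease to the skeleton, which is closed and of zero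
  -- surface measure.
  obtain ⟨ρ, hρ, hρ0⟩ : ∃ ρ, ENNReal.ofReal (v + v) *
      μHE[d - 1] (Y ∩ Metric.cthickening ρ M.skeleton) < b - b₁ ∧ 0 < ρ := by
    have h1 := (tendsto_measure_cthickening_of_isClosed (μ := μHE[d - 1].restrict Y)
      (s := M.skeleton) ⟨1, one_pos, ((measure_mono (subset_univ _)).trans_lt
        ((Measure.restrict_apply_univ Y).trans_lt hμY)).ne⟩
      M.isClosed_skeleton).mono_left (nhdsWithin_le_nhds (s := Ioi 0))
    rw [Measure.restrict_apply' hY.measurableSet,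
      measure_mono_null inter_subset_left M.measure_skeleton] at h1
    have h2 := ENNReal.Tendsto.const_mul (a := ENNReal.ofReal (v + v)) h1
      (Or.inr ENNReal.ofReal_ne_top)
    rw [mul_zero] at h2
    obtain ⟨ρ, hρ, hρ0⟩ := ((h2.eventually (gt_mem_nhds hb₂)).and self_mem_nhdsWithin).exists
    rw [Measure.restrict_apply' hY.measurableSet, inter_comm] at hρ
    exact ⟨ρ, hρ, hρ0⟩
  have hY₂σ : Y \ Metric.thickening ρ M.skeleton ⊆ σ := by
    intro y hy
    by_contra hyσ
    refine hy.2 (Metric.self_subset_thickening hρ0 _ ?_)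
    exact mem_biUnion hσ ⟨hYσ hy.1, hyσ⟩
  have hY₂b : Disjoint (Y \ Metric.thickening ρ M.skeleton) M.skeleton :=
    Set.disjoint_left.mpr fun y hy hyb => hy.2 (Metric.self_subset_thickening hρ0 _ hyb)
  -- An open thickening is removed here and a closed one kept below, so that both pieces are
  -- compact.
  have e₁ := hF.eventually_volume_arrivalSet_le_of_disjoint hσ hn hK hσK hq hqσ
    (hY.diff Metric.isOpen_thickening) hY₂σ hY₂b
    ((lintegral_mono_set sdiff_subset).trans_lt hb₁)
  have e₂ := eventually_volume_arrivalSet_le_of_velocity_le hv hn.1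
    (hY.inter_right Metric.isClosed_cthickening) (inter_subset_left.trans hYc) hρ
  filter_upwards [e₁, e₂] with h h₁ h₂
  calc volume (arrivalSet M φ V Y h)
      ≤ volume (arrivalSet M φ V (Y \ Metric.thickening ρ M.skeleton) h ∪
        arrivalSet M φ V (Y ∩ Metric.cthickening ρ M.skeleton) h) := by
        refine measure_mono ?_
        rintro x ⟨s, γ, hs0, hsh, hγ, h0, hγY⟩
        by_cases hy : γ s ∈ Metric.thickening ρ M.skeleton
        · exact Or.inr ⟨s, γ, hs0, hsh, hγ, h0, hγY, Metric.thickening_subset_cthickening _ _ hy⟩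
        · exact Or.inl ⟨s, γ, hs0, hsh, hγ, h0, hγY, hy⟩
    _ ≤ ENNReal.ofReal h * b₁ + ENNReal.ofReal h * (b - b₁) :=
        (measure_union_le _ _).trans (add_le_add h₁ h₂)
    _ = ENNReal.ofReal h * b := by rw [← mul_add, add_tsub_cancel_of_le hb₁b.le]

end Arrival

/-! ### Stopping the trajectories and summing over time layers -/

section Stopping

variable {d : ℕ} {Ω : Set (EuclideanSpace ℝ (Fin d))}
  {M : PolytopalMesh Ω} {φ : EuclideanSpace ℝ (Fin d) → ℝ}
  {V : EuclideanSpace ℝ (Fin d) → EuclideanSpace ℝ (Fin d)} {φlow φhigh Γ : ℝ}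
  {σ K Y : Set (EuclideanSpace ℝ (Fin d))} {n x y : EuclideanSpace ℝ (Fin d)} {T : ℝ}

theorem PolytopalMesh.measurableSet_face (M : PolytopalMesh Ω) (hσ : σ ∈ M.faces) :
    MeasurableSet σ := by
  obtain ⟨n, c, U, -, hU, rfl⟩ := M.face_flat σ hσ
  exact hU.measurableSet.inter (isClosed_hyperplane _ _).measurableSet

/-- The closed set on which the backward flow from `σ` is stopped. -/
def stoppingSet (M : PolytopalMesh Ω) (V : EuclideanSpace ℝ (Fin d) → EuclideanSpace ℝ (Fin d))
    (σ : Set (EuclideanSpace ℝ (Fin d))) : Set (EuclideanSpace ℝ (Fin d)) :=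
  (regularSet M V)ᶜ ∪ closure σ

theorem FlowAssumptions.isClosed_stoppingSet (hF : FlowAssumptions M φ V φlow φhigh Γ) :
    IsClosed (stoppingSet M V σ) :=
  hF.isOpen_regularSet.isClosed_compl.union isClosed_closure

theorem stoppingSet_disjoint_cellUnion (hσ : σ ∈ M.faces) :
    Disjoint (stoppingSet M V σ) M.cellUnion := by
  refine Disjoint.union_left (disjoint_compl_left.mono_right subset_union_left) ?_
  exact (M.face_disjoint_cellUnion hσ).closure_left M.isOpen_cellUnion

theorem FlowAssumptions.exists_continuous_inner (hF : FlowAssumptions M φ V φlow φhigh Γ)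
    (hK : K ∈ M.cells) (n : EuclideanSpace ℝ (Fin d)) :
    ∃ q : EuclideanSpace ℝ (Fin d) → ℝ, Continuous q ∧
      ∀ y ∈ closure K, q y = ⟪n, extendFrom K V y⟫ := by
  obtain ⟨f, P, -, hP, -, hcl⟩ := hF.exists_extension hK
  exact ⟨fun y => ⟪n, P y⟫, continuous_const.inner hP.continuous, fun y hy => by
    rw [(hcl y hy).2.1]⟩

/-- Off the skeleton, a stopping point on another face is not regular, so the normal component of
`V` vanishes there. The surface integral is zero and the layer has volume `o(h)`. -/
theorem FlowAssumptions.eventually_volume_arrivalSet_le_of_ne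
    (hF : FlowAssumptions M φ V φlow φhigh Γ) {σ' : Set (EuclideanSpace ℝ (Fin d))}
    (hσ : σ ∈ M.faces) (hσ' : σ' ∈ M.faces) (hne : σ' ≠ σ) {b : ENNReal} (hb : 0 < b) :
    ∀ᶠ h in 𝓝[>] (0 : ℝ), volume (arrivalSet M φ V (stoppingSet M V σ ∩ closure σ') h) ≤
      ENNReal.ofReal h * b := by
  obtain ⟨n, hn⟩ := M.exists_isUnitNormal hσ'
  obtain ⟨K, hK, hσK⟩ := M.exists_cell_of_face hσ'
  obtain ⟨q, hq, hqK⟩ := hF.exists_continuous_inner hK n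
  have hqσ : ∀ y ∈ σ', q y = ⟪n, extendFrom K V y⟫ := fun y hy =>
    hqK y (frontier_subset_closure (hσK hy))
  have hY : IsCompact (stoppingSet M V σ ∩ closure σ') :=
    (M.isCompact_closure_face hσ').inter_left hF.isClosed_stoppingSet
  refine hF.eventually_volume_arrivalSet_le hσ' hn hK hσK hq hqσ hY inter_subset_right ?_
  refine lt_of_le_of_lt (le_of_eq ?_) hb
  have hm : Measurable fun y => ENNReal.ofReal (|q y| / φlow) :=
    (hq.abs.div_const φlow).measurable.ennreal_ofReal
  rw [setLIntegral_eq_zero_iff hY.measurableSet hm]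
  have hnull : ∀ᵐ y ∂(μHE[d - 1] : Measure (EuclideanSpace ℝ (Fin d))), y ∉ M.skeleton :=
    measure_eq_zero_iff_ae_notMem.mp M.measure_skeleton
  filter_upwards [hnull] with y hyb hy
  have hyσ' : y ∈ σ' := by
    by_contra hyσ'
    exact hyb (mem_biUnion hσ' ⟨hy.2, hyσ'⟩)
  have hyσ : y ∉ closure σ := fun hyσ => by
    by_cases hyσ'' : y ∈ σ
    · exact Set.disjoint_left.mp (M.disjoint_faces hσ' hσ hne) hyσ' hyσ''
    · exact hyb (mem_biUnion hσ ⟨hyσ, hyσ''⟩)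
  have hyR : y ∉ regularSet M V := hy.1.resolve_right hyσ
  have hq0 : q y = 0 := by
    by_contra h0
    exact hyR (Or.inr ⟨σ', hσ', hyσ', hyb, n, hn, K, hK, hσK, hqσ y hyσ' ▸ h0⟩)
  simp [hq0]

/-- The stopping points in `closure Ω` lie on the finitely many closed faces. Only `σ` contributes
at first order; the others share the slack `b - b₁`. -/
theorem FlowAssumptions.eventually_volume_arrivalSet_stoppingSet_le
    (hF : FlowAssumptions M φ V φlow φhigh Γ) (hσ : σ ∈ M.faces) (hn : IsUnitNormal σ n)
    (hK : K ∈ M.cells) (hσK : σ ⊆ frontier K) {b : ENNReal}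
    (hb : ∫⁻ y in σ, ENNReal.ofReal (|⟪n, extendFrom K V y⟫| / φlow) ∂μHE[d - 1] < b) :
    ∀ᶠ h in 𝓝[>] (0 : ℝ), volume (arrivalSet M φ V (stoppingSet M V σ ∩ closure Ω) h) ≤
      ENNReal.ofReal h * b := by
  obtain ⟨b₁, hb₁, hb₁b⟩ := exists_between hb
  have hb₂ : 0 < (b - b₁) / (M.finite_faces.toFinset.card + 1 : ℕ) :=
    ENNReal.div_pos (tsub_pos_of_lt hb₁b).ne' (ENNReal.natCast_ne_top _)
  obtain ⟨q, hq, hqK⟩ := hF.exists_continuous_inner hK n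
  have hKcl : closure σ ⊆ closure K :=
    closure_minimal (hσK.trans frontier_subset_closure) isClosed_closure
  have hY : IsCompact (stoppingSet M V σ ∩ closure σ) :=
    (M.isCompact_closure_face hσ).inter_left hF.isClosed_stoppingSet
  have hae : closure σ =ᵐ[μHE[d - 1]] σ := by
    refine Filter.EventuallyLE.antisymm ?_ subset_closure.eventuallyLE
    rw [ae_le_set]
    exact M.face_boundary_null σ hσ
  have hσm := M.measurableSet_face hσ
  have e₁ := hF.eventually_volume_arrivalSet_le hσ hn hK hσK hq
    (fun y hy => hqK y (hKcl (subset_closure hy))) hY inter_subset_right (b := b₁) (by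
      refine lt_of_le_of_lt ?_ hb₁
      calc _ ≤ ∫⁻ y in closure σ, ENNReal.ofReal (|q y| / φlow) ∂μHE[d - 1] :=
            lintegral_mono_set inter_subset_right
        _ = ∫⁻ y in σ, ENNReal.ofReal (|q y| / φlow) ∂μHE[d - 1] := setLIntegral_congr hae
        _ = _ := setLIntegral_congr_fun hσm fun y hy => by
            simp only [hqK y (hKcl (subset_closure hy))])
  have e₂ : ∀ᶠ h in 𝓝[>] (0 : ℝ), ∀ σ' ∈ M.faces, σ' ≠ σ →
      volume (arrivalSet M φ V (stoppingSet M V σ ∩ closure σ') h) ≤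
        ENNReal.ofReal h * ((b - b₁) / (M.finite_faces.toFinset.card + 1 : ℕ)) := by
    refine (eventually_all_finite M.finite_faces).mpr fun σ' hσ' => ?_
    by_cases hne : σ' = σ
    · exact Eventually.of_forall fun h hne' => absurd hne hne'
    · exact (hF.eventually_volume_arrivalSet_le_of_ne hσ hσ' hne hb₂).mono fun h hh _ => hh
  classical
  filter_upwards [e₁, e₂] with h h₁ h₂
  have hsub : arrivalSet M φ V (stoppingSet M V σ ∩ closure Ω) h ⊆
      arrivalSet M φ V (stoppingSet M V σ ∩ closure σ) h ∪
        ⋃ σ' ∈ M.finite_faces.toFinset.erase σ,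
          arrivalSet M φ V (stoppingSet M V σ ∩ closure σ') h := by
    rintro x ⟨s, γ, hs0, hsh, hγ, h0, hγY⟩
    have h1 : γ s ∈ M.faceUnion := (M.closure_subset_union hγY.2).resolve_left fun h' =>
      Set.disjoint_left.mp (stoppingSet_disjoint_cellUnion hσ) hγY.1 h'
    obtain ⟨σ', hσ', hγσ'⟩ := mem_iUnion₂.mp h1
    by_cases hne : σ' = σ
    · exact Or.inl ⟨s, γ, hs0, hsh, hγ, h0, hγY.1, hne ▸ hγσ'⟩
    · exact Or.inr (mem_iUnion₂.mpr ⟨σ', Finset.mem_erase.mpr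
        ⟨hne, M.finite_faces.mem_toFinset.mpr hσ'⟩, s, γ, hs0, hsh, hγ, h0, hγY.1, hγσ'⟩)
  calc _ ≤ _ := measure_mono hsub
    _ ≤ ENNReal.ofReal h * b₁ + ∑ σ' ∈ M.finite_faces.toFinset.erase σ,
        ENNReal.ofReal h * ((b - b₁) / (M.finite_faces.toFinset.card + 1 : ℕ)) := by
        refine (measure_union_le _ _).trans (add_le_add h₁ ?_)
        refine (measure_biUnion_finset_le _ _).trans (Finset.sum_le_sum fun σ' hσ' => ?_)
        rw [Finset.mem_erase, M.finite_faces.mem_toFinset] at hσ'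
        exact h₂ σ' hσ'.2 hσ'.1
    _ ≤ ENNReal.ofReal h * b₁ + ENNReal.ofReal h * (b - b₁) := by
        rw [Finset.sum_const, nsmul_eq_mul, mul_left_comm]
        gcongr
        rw [mul_comm]
        refine le_trans ?_ (ENNReal.div_mul_cancel (b := b - b₁)
          (a := (M.finite_faces.toFinset.card + 1 : ℕ)) (by simp) (ENNReal.natCast_ne_top _)).le
        gcongr
        exact (Finset.card_erase_le).trans (Nat.le_succ _)
    _ = ENNReal.ofReal h * b := by rw [← mul_add, add_tsub_cancel_of_le hb₁b.le]

/-- Sort the trajectories by the time step that contains their first stopping time `τ`. Up to the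
beginning of this step they are regular, and from there they reach the stopping set within `h`. -/
theorem arrivalSet_subset_of_step (hF : FlowAssumptions M φ V φlow φhigh Γ)
    (hσ : σ ∈ M.faces) {h : ℝ} (hh : 0 < h) (N : ℕ) :
    arrivalSet M φ V σ (N * h) ⊆ M.faceUnion ∪ ⋃ j ∈ Finset.range N,
      trajPreimage M φ V (regularSet M V) (j * h)
        (arrivalSet M φ V (stoppingSet M V σ ∩ closure Ω) h) := by
  rintro _ ⟨s, γ, hs0, hsT, hγ, rfl, hγσ⟩
  by_cases hx : γ 0 ∈ M.faceUnion
  · exact Or.inl hx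
  right
  obtain ⟨L, hL⟩ := hγ.lipschitz
  have hZ : IsCompact (Icc 0 s ∩ γ ⁻¹' stoppingSet M V σ) :=
    isCompact_Icc.of_isClosed_subset
      (hL.continuousOn.preimage_isClosed_of_isClosed isClosed_Icc hF.isClosed_stoppingSet)
      inter_subset_left
  obtain ⟨τ, ⟨⟨hτ0, hτs⟩, hτC⟩, hmin⟩ := hZ.exists_isLeast
    ⟨s, ⟨hs0, le_rfl⟩, Or.inr (subset_closure hγσ)⟩
  -- Off the faces the start is in a cell, which the stopping set does not meet.
  have hτpos : 0 < τ := by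
    refine hτ0.lt_of_ne ?_
    rintro rfl
    have h1 := (M.closure_subset_union (hγ.mem 0 ⟨le_rfl, hs0⟩)).resolve_right hx
    exact Set.disjoint_left.mp (stoppingSet_disjoint_cellUnion hσ) hτC h1
  have hR : ∀ r, 0 ≤ r → r < τ → γ r ∈ regularSet M V := fun r hr0 hr => by
    by_contra hr'
    exact (hmin ⟨⟨hr0, hr.le.trans hτs⟩, Or.inl hr'⟩).not_gt hr
  -- Rounding up makes `j h < τ` strict, so the trajectory is regular on the closed interval `[0, j
  -- h]`.
  obtain ⟨j, hj⟩ : ∃ j, ⌈τ / h⌉₊ = j + 1 :=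
    Nat.exists_eq_succ_of_ne_zero (Nat.ceil_pos.mpr (div_pos hτpos hh)).ne'
  have hj1 : j * h < τ := by
    rw [← lt_div_iff₀ hh]
    exact Nat.lt_ceil.mp (by omega)
  have hj2 : τ ≤ j * h + h := by
    have := Nat.le_ceil (τ / h)
    rw [hj, div_le_iff₀ hh] at this
    push_cast at this
    linarith
  have hj0 : 0 ≤ j * h := by positivity
  have hjN : j < N := by
    have : j * h < N * h := hj1.trans_le (hτs.trans hsT)
    exact_mod_cast lt_of_mul_lt_mul_right this hh.le
  refine mem_iUnion₂.mpr ⟨j, Finset.mem_range.mpr hjN, γ, hγ.mono le_rfl (hj1.le.trans hτs),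
    fun r hr => hR r hr.1 (hr.2.trans_lt hj1), rfl, τ - j * h, fun r => γ (r + j * h),
    by linarith, by linarith, ?_, by simp, ?_⟩
  · have := (hγ.mono hj0 hτs).comp_add_const (j * h)
    rwa [sub_self] at this
  · simp only [sub_add_cancel]
    exact ⟨hτC, hγ.mem τ ⟨hτ0, hτs⟩⟩

theorem FlowAssumptions.divergence_bound_nonneg (hF : FlowAssumptions M φ V φlow φhigh Γ)
    (hK : K ∈ M.cells) : 0 ≤ Γ := by
  obtain ⟨g, -, -, hg⟩ := hF.exists_div
  have hne : (volume.restrict Ω : Measure (EuclideanSpace ℝ (Fin d))) ≠ 0 := by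
    rw [Ne, Measure.restrict_eq_zero]
    exact (M.isOpen_domain.measure_pos _
      ((M.nonempty_cell K hK).mono (M.cell_subset K hK))).ne'
  have : NeBot (ae (volume.restrict Ω : Measure (EuclideanSpace ℝ (Fin d)))) := ae_neBot.mpr hne
  obtain ⟨x, hx⟩ := hg.exists
  exact (abs_nonneg _).trans hx

/-- There are `N + 1` layers of step `h`, with `(N + 1) h = T`. Each has weighted volume at most
`φhigh h b` before transport, and compression costs at most `exp (Γ T / φlow)`. -/
theorem FlowAssumptions.volume_arrivalSet_le (hF : FlowAssumptions M φ V φlow φhigh Γ)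
    (hσ : σ ∈ M.faces) (hn : IsUnitNormal σ n) (hK : K ∈ M.cells) (hσK : σ ⊆ frontier K)
    (hT : 0 < T) :
    ENNReal.ofReal φlow * volume (arrivalSet M φ V σ T) ≤
      ENNReal.ofReal (φhigh * Real.exp (Γ / φlow * T) * T) *
        ∫⁻ y in σ, ENNReal.ofReal (|⟪n, extendFrom K V y⟫| / φlow) ∂μHE[d - 1] := by
  have hl := hF.φlow_pos
  have hΓ := hF.divergence_bound_nonneg hK
  have hn0 : n ≠ 0 := fun h => by simpa [h] using hn.1
  have : Nontrivial (EuclideanSpace ℝ (Fin d)) := ⟨n, 0, hn0⟩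
  have hhigh : 0 < φhigh := by
    obtain ⟨x, hx⟩ := M.nonempty_cell K hK
    exact hl.trans_le ((hF.bounds K hK x hx).1.trans (hF.bounds K hK x hx).2)
  have hc : 0 < φhigh * Real.exp (Γ / φlow * T) * T := by positivity
  have hc0 := (ENNReal.ofReal_pos.mpr hc).ne'
  rw [← ENNReal.div_le_iff' hc0 ENNReal.ofReal_ne_top]
  -- The layer estimate holds for every `b` strictly above the surface integral, once `h` is small.
  refine le_of_forall_gt_imp_ge_of_dense fun b hb => ?_
  rw [ENNReal.div_le_iff' hc0 ENNReal.ofReal_ne_top]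
  have hstep : Tendsto (fun N : ℕ => T / ((N : ℝ) + 1)) atTop (𝓝[>] 0) := by
    refine tendsto_nhdsWithin_iff.mpr ⟨?_, Eventually.of_forall fun N => ?_⟩
    · simpa [div_eq_mul_inv] using (tendsto_one_div_add_atTop_nhds_zero_nat (𝕜 := ℝ)).const_mul T
    · exact div_pos hT (by positivity)
  obtain ⟨N, hN⟩ := (hstep.eventually
    (hF.eventually_volume_arrivalSet_stoppingSet_le hσ hn hK hσK hb)).exists
  set h := T / ((N : ℝ) + 1) with hh_def
  have hh : 0 < h := by positivity
  have hNh : ((N + 1 : ℕ) : ℝ) * h = T := by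
    rw [hh_def]
    push_cast
    field_simp
  have hsub := arrivalSet_subset_of_step (V := V) hF hσ hh (N + 1)
  rw [hNh] at hsub
  calc ENNReal.ofReal φlow * volume (arrivalSet M φ V σ T)
      ≤ weightedVolume M φ (arrivalSet M φ V σ T) := by
        refine hF.le_weightedVolume ?_
        rintro _ ⟨s, γ, hs0, -, hγ, rfl, -⟩
        exact hγ.mem 0 ⟨le_rfl, hs0⟩
    _ ≤ weightedVolume M φ M.faceUnion + ∑ j ∈ Finset.range (N + 1),
        weightedVolume M φ (trajPreimage M φ V (regularSet M V) (j * h)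
          (arrivalSet M φ V (stoppingSet M V σ ∩ closure Ω) h)) :=
        (measure_mono hsub).trans ((measure_union_le _ _).trans
          (add_le_add_right (measure_biUnion_finset_le _ _) _))
    _ ≤ 0 + ∑ j ∈ Finset.range (N + 1), ENNReal.ofReal (Real.exp (Γ / φlow * T)) *
        (ENNReal.ofReal φhigh * (ENNReal.ofReal h * b)) := by
        refine add_le_add ?_ (Finset.sum_le_sum fun j hj => ?_)
        · refine (hF.weightedVolume_le _).trans ?_
          rw [M.volume_faceUnion, mul_zero]
        · have hjT : j * h ≤ T := by
            rw [← hNh]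
            have : j ≤ N + 1 := (Finset.mem_range.mp hj).le
            gcongr
          refine (hF.weightedVolume_trajPreimage_le (by positivity) _).trans ?_
          refine mul_le_mul' (ENNReal.ofReal_le_ofReal ?_) ((hF.weightedVolume_le _).trans ?_)
          · gcongr
          · gcongr
    _ = ENNReal.ofReal (φhigh * Real.exp (Γ / φlow * T) * T) * b := by
        rw [zero_add, Finset.sum_const, Finset.card_range, nsmul_eq_mul, ← hNh,
          ENNReal.ofReal_mul (by positivity), ENNReal.ofReal_mul (by positivity),
          ENNReal.ofReal_mul (by positivity), ENNReal.ofReal_natCast]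
        ring

end Stopping

/-! ### Time reversal, and from swept regions to arrival sets -/

section Reversal

variable {d : ℕ} {Ω : Set (EuclideanSpace ℝ (Fin d))}
  {M : PolytopalMesh Ω} {φ : EuclideanSpace ℝ (Fin d) → ℝ}
  {V : EuclideanSpace ℝ (Fin d) → EuclideanSpace ℝ (Fin d)} {φlow φhigh Γ : ℝ}
  {σ K : Set (EuclideanSpace ℝ (Fin d))} {n y : EuclideanSpace ℝ (Fin d)} {s t : ℝ}
  {γ : ℝ → EuclideanSpace ℝ (Fin d)}

theorem FlowAssumptions.extendFrom_neg (hF : FlowAssumptions M φ V φlow φhigh Γ)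
    (hK : K ∈ M.cells) (hy : y ∈ closure K) : extendFrom K (-V) y = -extendFrom K V y := by
  obtain ⟨f, P, -, hP, hfP, hcl⟩ := hF.exists_extension hK
  rw [(hcl y hy).2.1]
  refine extendFrom_eq hy ?_
  refine ((hP.continuous.tendsto y).neg.mono_left nhdsWithin_le_nhds).congr' ?_
  filter_upwards [self_mem_nhdsWithin] with x hx
  rw [Pi.neg_apply, (hfP x hx).2]

theorem FlowAssumptions.neg (hF : FlowAssumptions M φ V φlow φhigh Γ) :
    FlowAssumptions M φ (-V) φlow φhigh Γ where
  φlow_pos := hF.φlow_pos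
  smooth := hF.smooth
  bounds := hF.bounds
  polynomial K hK := by
    obtain ⟨p, hp⟩ := hF.polynomial K hK
    exact ⟨-p, fun x hx i => by simp [hp x hx i]⟩
  memLp := hF.memLp.neg
  hdiv := by
    obtain ⟨g, hg, hdiv, hgΓ⟩ := hF.hdiv
    refine ⟨-g, hg.neg, fun ψ h1 h2 h3 => ?_, by simpa using hgΓ⟩
    simpa [inner_neg_left, integral_neg, neg_eq_iff_eq_neg] using hdiv ψ h1 h2 h3
  no_flow σ hσ hσΩ n hn K hK hσK y hy := by
    rw [hF.extendFrom_neg hK (frontier_subset_closure (hσK hy)), inner_neg_left,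
      hF.no_flow σ hσ hσΩ n hn K hK hσK y hy, neg_zero]

theorem IsTraj.reverse (hF : FlowAssumptions M φ V φlow φhigh Γ) (hγ : IsTraj M φ V 0 s γ) :
    IsTraj M φ (-V) 0 s fun r => γ (s - r) := by
  obtain ⟨L, hL⟩ := hγ.lipschitz
  obtain ⟨N, hN, hd⟩ := hγ.hasDerivAt
  have hI : ∀ r ∈ Icc 0 s, s - r ∈ Icc 0 s := fun r hr => ⟨by linarith [hr.2], by linarith [hr.1]⟩
  refine ⟨fun r hr => hγ.mem _ (hI r hr), ⟨L, ?_⟩, (fun r => s - r) ⁻¹' N,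
    hN.preimage sub_right_injective, fun r hr => ?_⟩
  · refine LipschitzOnWith.of_dist_le_mul fun r hr t ht => ?_
    have := hL.dist_le_mul _ (hI r hr) _ (hI t ht)
    rwa [dist_sub_left] at this
  · obtain ⟨K, hK, hm, hd'⟩ := hd (s - r) ⟨⟨by linarith [hr.1.2], by linarith [hr.1.1]⟩, hr.2⟩
    refine ⟨K, hK, hm, ?_⟩
    have h1 := hd'.comp_const_sub s r
    rwa [velocity, hF.extendFrom_neg hK hm, smul_neg]

theorem IsCharacteristic.isTraj (hγ : IsCharacteristic M φ V y s γ) :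
    IsTraj M φ V (min 0 s) (max 0 s) γ := by
  obtain ⟨-, hmem, hL, N, hN, hd⟩ := hγ
  refine ⟨hmem, hL, N, hN, fun r hr => ?_⟩
  obtain ⟨K, hK, hm, hd'⟩ := hd r ⟨Ioo_subset_Icc_self hr.1, hr.2⟩
  exact ⟨K, hK, hm, hd'.hasDerivAt (Icc_mem_nhds hr.1.1 hr.1.2)⟩

/-- A characteristic run back to the time `s ≤ 0` becomes, after a shift of time, a trajectory that
starts at the swept point and ends on `σ`. -/
theorem sweptRegion_subset_of_nonpos (ht : t ≤ 0) :
    sweptRegion M φ V σ t ⊆ arrivalSet M φ V σ |t| := by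
  intro x hx
  simp only [sweptRegion, flow, mem_iUnion, exists_prop, Set.mem_ofPred_eq] at hx
  obtain ⟨s, hs, y, hy, γ, hγ, rfl⟩ := hx
  rw [uIcc_of_ge ht] at hs
  have h1 := hγ.isTraj.comp_add_const s
  rw [min_eq_right hs.2, max_eq_left hs.2, sub_self, zero_sub] at h1
  refine ⟨-s, fun r => γ (r + s), by linarith [hs.2], ?_, h1, by simp, by simpa [hγ.1] using hy⟩
  rw [abs_of_nonpos ht]
  linarith [hs.1]

theorem sweptRegion_subset_of_nonneg (hF : FlowAssumptions M φ V φlow φhigh Γ) (ht : 0 ≤ t) :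
    sweptRegion M φ V σ t ⊆ arrivalSet M φ (-V) σ |t| := by
  intro x hx
  simp only [sweptRegion, flow, mem_iUnion, exists_prop, Set.mem_ofPred_eq] at hx
  obtain ⟨s, hs, y, hy, γ, hγ, rfl⟩ := hx
  rw [uIcc_of_le ht] at hs
  have h1 := hγ.isTraj
  rw [min_eq_left hs.1, max_eq_right hs.1] at h1
  refine ⟨s, fun r => γ (s - r), hs.1, ?_, h1.reverse hF, by simp, by simpa [hγ.1] using hy⟩
  rw [abs_of_nonneg ht]
  exact hs.2

theorem arrivalSet_zero_subset : arrivalSet M φ V σ 0 ⊆ σ := by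
  rintro _ ⟨s, γ, hs0, hs, -, rfl, hγ⟩
  rwa [le_antisymm hs hs0] at hγ

theorem FlowAssumptions.integrableOn_inner (hF : FlowAssumptions M φ V φlow φhigh Γ)
    (hσ : σ ∈ M.faces) (hn : IsUnitNormal σ n) (hK : K ∈ M.cells) (hσK : σ ⊆ frontier K) :
    IntegrableOn (fun y => |⟪extendFrom K V y, n⟫|) σ μHE[d - 1] := by
  obtain ⟨q, hq, hqK⟩ := hF.exists_continuous_inner hK n
  obtain ⟨c, U, hU, hσU⟩ := M.exists_isOpen_of_isUnitNormal hσ hn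
  have hσm := M.measurableSet_face hσ
  have hσc : closure σ ⊆ hyperplane n c :=
    closure_minimal (hσU ▸ inter_subset_right) (isClosed_hyperplane n c)
  have hcomp := M.isCompact_closure_face hσ
  have hfin : μHE[d - 1] σ < ⊤ := (measure_mono subset_closure).trans_lt
    (euclideanHausdorffMeasure_lt_top hn.1 hcomp.isBounded hσc)
  obtain ⟨B, hB⟩ := hcomp.exists_bound_of_continuousOn hq.abs.continuousOn
  have h1 : IntegrableOn (fun y => |q y|) σ μHE[d - 1] :=
    Measure.integrableOn_of_bounded hfin.ne hq.abs.aestronglyMeasurable (M := B)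
      ((ae_restrict_mem hσm).mono fun y hy => hB y (subset_closure hy))
  refine h1.congr_fun (fun y hy => ?_) hσm
  simp only [hqK y (frontier_subset_closure (hσK hy)), real_inner_comm]

theorem FlowAssumptions.volume_arrivalSet_le_integral (hF : FlowAssumptions M φ V φlow φhigh Γ)
    (hσ : σ ∈ M.faces) (hn : IsUnitNormal σ n) (hK : K ∈ M.cells) (hσK : σ ⊆ frontier K)
    {T : ℝ} (htT : |t| ≤ T) :
    volume (arrivalSet M φ V σ |t|) ≤ ENNReal.ofReal (C₁ φlow φhigh Γ T / φlow * |t| *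
      ∫ y in σ, |⟪extendFrom K V y, n⟫| ∂μHE[d - 1]) := by
  have hl := hF.φlow_pos
  -- Subdividing the time requires a positive duration; at `t = 0` the arrival set is contained in
  -- the face, which is negligible.
  rcases eq_or_ne t 0 with rfl | ht0
  · refine le_of_eq_of_le ?_ zero_le
    rw [abs_zero]
    exact measure_mono_null (arrivalSet_zero_subset.trans
      (subset_closure.trans (subset_biUnion_of_mem (u := closure) hσ))) M.volume_faceUnion
  have ht : 0 < |t| := abs_pos.mpr ht0
  have hΓ := hF.divergence_bound_nonneg hK
  have hhigh : 0 < φhigh := by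
    obtain ⟨x, hx⟩ := M.nonempty_cell K hK
    exact hl.trans_le ((hF.bounds K hK x hx).1.trans (hF.bounds K hK x hx).2)
  have key := hF.volume_arrivalSet_le hσ hn hK hσK ht
  have hint := hF.integrableOn_inner hσ hn hK hσK
  have hJ : ∫⁻ y in σ, ENNReal.ofReal (|⟪n, extendFrom K V y⟫| / φlow) ∂μHE[d - 1] =
      ENNReal.ofReal ((∫ y in σ, |⟪extendFrom K V y, n⟫| ∂μHE[d - 1]) / φlow) := by
    rw [← integral_div, ofReal_integral_eq_lintegral_ofReal (hint.div_const φlow)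
      (Eventually.of_forall fun y => by positivity)]
    simp only [real_inner_comm]
  have hJ0 : 0 ≤ ∫ y in σ, |⟪extendFrom K V y, n⟫| ∂μHE[d - 1] :=
    integral_nonneg fun y => abs_nonneg _
  rw [hJ, ← ENNReal.ofReal_mul (by positivity)] at key
  rw [← ENNReal.mul_le_mul_iff_right (ENNReal.ofReal_pos.mpr hl).ne' ENNReal.ofReal_ne_top]
  refine key.trans ?_
  rw [← ENNReal.ofReal_mul hl.le]
  refine ENNReal.ofReal_le_ofReal ?_
  rw [C₁, abs_of_nonneg (ht.le.trans htT)]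
  calc _ = φhigh / φlow * Real.exp (Γ / φlow * |t|) * |t| *
        ∫ y in σ, |⟪extendFrom K V y, n⟫| ∂μHE[d - 1] := by ring
    _ ≤ φhigh / φlow * Real.exp (Γ / φlow * T) * |t| *
        ∫ y in σ, |⟪extendFrom K V y, n⟫| ∂μHE[d - 1] := by gcongr
    _ = _ := by field_simp

end Reversal

end EllamFlow

theorem lemma5p4 {d : ℕ} {Ω : Set (EuclideanSpace ℝ (Fin d))}
    (M : EllamFlow.PolytopalMesh Ω)
    (φ : EuclideanSpace ℝ (Fin d) → ℝ)
    (V : EuclideanSpace ℝ (Fin d) → EuclideanSpace ℝ (Fin d))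
    (φlow φhigh Γ T : ℝ)
    (h : EllamFlow.FlowAssumptions M φ V φlow φhigh Γ)
    (σ : Set (EuclideanSpace ℝ (Fin d))) (hσ : σ ∈ M.faces)
    (n : EuclideanSpace ℝ (Fin d)) (hn : EllamFlow.IsUnitNormal σ n)
    (K : Set (EuclideanSpace ℝ (Fin d))) (hK : K ∈ M.cells) (hσK : σ ⊆ frontier K)
    (t : ℝ) (ht : t ∈ Set.Icc (-T) T) :
    MeasureTheory.volume (EllamFlow.sweptRegion M φ V σ t) ≤
      ENNReal.ofReal (EllamFlow.C₁ φlow φhigh Γ T / φlow * |t| *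
        ∫ y in σ, |⟪extendFrom K V y, n⟫| ∂μHE[d - 1]) := by
  have htT : |t| ≤ T := abs_le.mpr ht
  rcases le_total t 0 with ht0 | ht0
  · exact (measure_mono (EllamFlow.sweptRegion_subset_of_nonpos ht0)).trans
      (h.volume_arrivalSet_le_integral hσ hn hK hσK htT)
  · refine (measure_mono (EllamFlow.sweptRegion_subset_of_nonneg h ht0)).trans
      ((h.neg.volume_arrivalSet_le_integral hσ hn hK hσK htT).trans (le_of_eq ?_))
    -- The flux of `-V` has the same absolute value as that of `V`.
    congr 2
    refine setIntegral_congr_fun (M.measurableSet_face hσ) fun y hy => ?_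
    simp only [h.extendFrom_neg hK (frontier_subset_closure (hσK hy)), inner_neg_left, abs_neg]
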